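/- **Algebra.** Let $\mathcal S$ be an additive symmetric monoidal category with bilinear tensor product, unit object $\mathbb 1$ and symmetric braiding $\sigma$ (only the abelian group structure on morphism sets is used). Let $A\in\mathcal S$ be a Frobenius algebra: an algebra $(A,\mu,\eta)$ and a coalgebra $(A,\Delta,\varepsilon)$ such that $\Delta$ is a morphism of left and of right $A$-modules, i.e. $(\mu\otimes \mathrm{id})\circ(\mathrm{id}\otimes\Delta)=\Delta\circ\mu=(\mathrm{id}\otimes\mu)\circ(\Delta\otimes \mathrm{id})$. Put $$b=\varepsilon\circ\mu,\qquad t=\varepsilon\circ\mu\circ(\mu\otimes \mathrm{id}):A^{\otimes 3}\to\mathbb 1,\qquad c_{-1}=\Delta\circ\eta,\qquad c_{+1}=\sigma_{A,A}\circ\Delta\circ\eta,$$ $$N=(b\otimes \mathrm{id})\circ(\mathrm{id}\otimes\sigma_{A,A})\circ(\mathrm{id}\otimes c_{-1}):A\to A,\qquad N*\mathrm{id}=\mu\circ(N\otimes \mathrm{id})\circ\Delta,$$ $$P^{NS}=\mu\circ\sigma_{A,A}\circ(N\otimes \mathrm{id})\circ\Delta,\qquad P^{R}=\mu\circ\sigma_{A,A}\circ\Delta,$$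 and let $\iota^{13}:A\to A^{\otimes3}$ be the iterated coproduct $(\mathrm{id}\otimes\Delta)\circ\Delta$ followed by the permutation that reverses the order of the three tensor factors. Assume that $\mu\circ\Delta=\mathrm{id}_A$ ($\Delta$-separability), $N\circ N=\mathrm{id}_A$ and $N*\mathrm{id}=0$. **Surfaces.** Let $\underline\Lambda$ be an oriented compact surface (possibly disconnected or closed), triangulated by a finite two-dimensional simplicial complex, whose boundary consists of $B\ge 0$ components. Each component is a cycle of exactly three edges and is parametrised by the boundary of a triangle: for $k\in\mathbb Z/3$ let $w_{i,k}$ be the image of the $k$-th vertex $e^{2\pi i k/3}$ of the standard triangle under the $i$-th parametrisation. The parametrisation is opposite to the orientation which the surface induces on its boundary, i.e. the surface lies to the right of the boundary edges $w_{i,k}\to w_{i,k+1}$. A *marking* consists of an orientation of each edge, where a boundary edge is oriented from $w_{i,k}$ to $w_{i,k+1}$, and of a preferred edge of each triangle. Number the edges of each triangle $0,1,2$ counterclockwise starting from the preferred edge, and let the $k$-th edge of the $i$-th boundary component be $w_{i,k}\to w_{i,k+1}$. Choose in addition arbitrary edge signs, i.e. a sign $s(e)\in\{\pm1\}$ for every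 edge $e$. **Admissibility.** For a vertex $v$ let $K(v)$ be the number of edges oriented away from $v$, and let $D(v)$ be the number of triangles $\sigma$ for which $v$ is the initial vertex of the preferred edge with respect to the counterclockwise orientation of $\partial\sigma$. The signs satisfy the rule at an inner vertex $v$ if $$\prod_{e\ni v}s(e)=(-1)^{D(v)+K(v)+1}.$$ They satisfy the rule for type $R$ at a boundary vertex $v=w_{i,k}$ if the same equation holds, and the rule for type $NS$ if the equation holds after $D(v)$ has been replaced by $D(v)+1$ in the case $k=0$ (no change for $k=1,2$). For $\delta=(\delta_1,\dots,\delta_B)\in\{NS,R\}^B$, the signs are *admissible of type $\delta$* if the rule holds at all inner vertices and, for each $i$, the rule for type $\delta_i$ holds at the three vertices of the $i$-th boundary component. They are *admissible* if they are admissible of type $\delta$ for some $\delta$. **State sum.** Let $T_{\mathrm{triang}}:\mathbb 1\to (A^{\otimes3})^{\otimes B}$ be the following morphism. Take the tensor product of the copairings $c_{s(e)}$ over all edges $e$; the first (second) tensor factor of $c_{s(e)}$ belongs to the left (right) side of the oriented edge $e$. Then apply the permutation of tensor factors which moves the factor of a side of $e$, if on that side $e$ is the $k$-th edge of a triangle,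 to the $k$-th input of the copy of $t$ belonging to that triangle, and which moves the left factor of the $k$-th edge of the $i$-th boundary component to the $k$-th factor of the $i$-th copy of $A^{\otimes 3}$. Then apply one $t$ for every triangle. Finally, let $T'_A(\underline\Lambda;s):(A^{\otimes3})^{\otimes B}\to\mathbb 1$ be obtained from $T_{\mathrm{triang}}$ by pairing, via $b$, the $j$-th argument (first entry of $b$) with the $j$-th output of $T_{\mathrm{triang}}$ (second entry of $b$), for all $j=1,\dots,3B$. **Proposition.** If the edge signs $s$ are not admissible, then for all $\delta_1,\dots,\delta_B\in\{NS,R\}$ $$T'_A(\underline\Lambda;s)\circ\bigotimes_{i=1}^B\big(\iota^{13}\circ P^{\delta_i}\big)=0 .$$ More generally, for any given $\delta_1,\dots,\delta_B\in\{NS,R\}$, this composite vanishes whenever $s$ is not admissible of type $(\delta_1,\dots,\delta_B)$. -/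

import Mathlib

open CategoryTheory MonoidalCategory
open scoped MonObj ComonObj

universe v u w

noncomputable section

/-! ## Marked combinatorial surfaces with parametrised boundary -/

/-- The triangles (2-simplices) of an abstract simplicial complex. -/
abbrev AbstractSimplicialComplex.Triangle {V : Type w} (K : AbstractSimplicialComplex V) : Type w :=
  {σ : Finset V // σ ∈ K.faces ∧ σ.card = 3}

/-- The edges (1-simplices) of an abstract simplicial complex. -/
abbrev AbstractSimplicialComplex.Edge {V : Type w} (K : AbstractSimplicialComplex V) : Type w :=
  {e : Finset V // e ∈ K.faces ∧ e.card = 2}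

/-- An oriented combinatorial surface (not necessarily connected, possibly closed) with `B`
parametrised boundary components, each of which consists of three edges.  The vertex set is `V`;
the theorem takes it to be finite.

The vertices of the standard triangle are `ω ^ k`, where `ω = exp (2πi/3)` and `k : Fin 3`; its
`k`-th edge joins `ω ^ k` to `ω ^ (k + 1)`. -/
structure CombinatorialSurface (V : Type w) [DecidableEq V] (B : ℕ) extends
    AbstractSimplicialComplex V where
  /-- The complex is purely two-dimensional. -/
  card_le : ∀ σ ∈ faces, σ.card ≤ 3
  exists_triangle : ∀ σ ∈ faces, ∃ τ : toAbstractSimplicialComplex.Triangle, σ ⊆ τ.1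
  /-- The orientation of a triangle: `next σ a` is the vertex of `σ` which follows the vertex `a`
  in counterclockwise direction.  So `σ` induces on its edge `{a, next σ a}` the orientation from
  `a` to `next σ a`. (The values of `next σ` outside `σ` play no role.) -/
  next : toAbstractSimplicialComplex.Triangle → V → V
  next_mem : ∀ σ : toAbstractSimplicialComplex.Triangle, ∀ a ∈ σ.1, next σ a ∈ σ.1
  next_ne : ∀ σ : toAbstractSimplicialComplex.Triangle, ∀ a ∈ σ.1, next σ a ≠ a
  next_next_next : ∀ σ : toAbstractSimplicialComplex.Triangle, ∀ a ∈ σ.1,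
    next σ (next σ (next σ a)) = a
  /-- Two distinct triangles never induce the same orientation on a common edge.  So every edge
  lies in one triangle, or in two triangles which induce opposite orientations on it. -/
  coherent : ∀ σ τ : toAbstractSimplicialComplex.Triangle, ∀ a, a ∈ σ.1 → a ∈ τ.1 →
    next σ a = next τ a → σ = τ
  /-- The link of every vertex is connected.  By the previous conditions the link is a graph
  in which every vertex has one or two neighbours, so it is then a circle or an interval: this is
  the condition that the complex is a two-dimensional manifold with boundary. -/
  link_connected : ∀ v a b : V, a ≠ v → b ≠ v → ({v, a} : Finset V) ∈ faces →
    ({v, b} : Finset V) ∈ faces →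
    Relation.ReflTransGen
      (fun x y : V => ({v, x, y} : Finset V) ∈ faces ∧ ({v, x, y} : Finset V).card = 3) a b
  /-- The boundary parametrisations: `param i k` is the image of `ω ^ k` under the `i`-th one. -/
  param : Fin B → Fin 3 → V
  /-- The parametrisations are embeddings with disjoint images. -/
  param_injective : Function.Injective (fun p : Fin B × Fin 3 => param p.1 p.2)
  /-- The parametrisations cover precisely the boundary edges and reverse the orientation:
  the oriented edges from `param i k` to `param i (k + 1)` are precisely those `a → b` for which
  some triangle induces the orientation `b → a` on `{a, b}` and none induces `a → b`. -/
  param_boundary : ∀ a b : V, (∃ i k, param i k = a ∧ param i (k + 1) = b) ↔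
    ((∃ σ : toAbstractSimplicialComplex.Triangle, b ∈ σ.1 ∧ next σ b = a) ∧
      ¬ ∃ σ : toAbstractSimplicialComplex.Triangle, a ∈ σ.1 ∧ next σ a = b)

namespace CombinatorialSurface

variable {V : Type w} [DecidableEq V] {B : ℕ}

/-- The set of triangles. -/
abbrev Triangle (S : CombinatorialSurface V B) : Type w := S.toAbstractSimplicialComplex.Triangle

/-- The set of edges. -/
abbrev Edge (S : CombinatorialSurface V B) : Type w := S.toAbstractSimplicialComplex.Edge

/-- A marking: an orientation of every edge and a preferred edge of every triangle.  Boundary edges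
are oriented in accordance with the boundary parametrisation. -/
structure Marking (S : CombinatorialSurface V B) where
  /-- `source e` is the vertex at which the oriented edge `e` starts. -/
  source : S.Edge → V
  source_mem : ∀ e, source e ∈ e.1
  source_boundary : ∀ (e : S.Edge) (i : Fin B) (k : Fin 3),
    e.1 = {S.param i k, S.param i (k + 1)} → source e = S.param i k
  /-- The preferred edge of `σ` is the edge from `start σ` to `S.next σ (start σ)`. -/
  start : S.Triangle → V
  start_mem : ∀ σ, start σ ∈ σ.1

namespace Marking

variable {S : CombinatorialSurface V B} (M : S.Marking)

/-- For a triangle `σ`, `M.corner (.inl σ)` is the orientation preserving identification of the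
vertices of the standard triangle with those of `σ` which maps the `0`-th edge to the preferred edge
of `σ`.  So the `k`-th edge of `σ` is `{M.corner (.inl σ) k, M.corner (.inl σ) (k + 1)}`, and these
edges are numbered counterclockwise, starting from the preferred edge.
For a boundary component `i`, `M.corner (.inr i)` is the boundary parametrisation. -/
def corner : S.Triangle ⊕ Fin B → Fin 3 → V
  | .inl σ, k => (S.next σ)^[(k : ℕ)] (M.start σ)
  | .inr i, k => S.param i k

lemma corner_mem (σ : S.Triangle) (k : Fin 3) : M.corner (.inl σ) k ∈ σ.1 := by
  have h0 := M.start_mem σ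
  have h1 := S.next_mem σ _ h0
  have h2 := S.next_mem σ _ h1
  fin_cases k <;> simpa [corner]

lemma corner_succ (σ : S.Triangle) (k : Fin 3) :
    M.corner (.inl σ) (k + 1) = S.next σ (M.corner (.inl σ) k) := by
  have h3 := S.next_next_next σ _ (M.start_mem σ)
  fin_cases k
  · simp [corner]
  · simp [corner]
  · simpa [corner] using h3.symm

lemma next_next_ne (S : CombinatorialSurface V B) (σ : S.Triangle) {a : V} (ha : a ∈ σ.1) :
    S.next σ (S.next σ a) ≠ a := by
  intro h
  have h3 := S.next_next_next σ a ha
  rw [h] at h3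
  exact S.next_ne σ a ha h3

lemma eq_triple (S : CombinatorialSurface V B) (σ : S.Triangle) {a b : V} (ha : a ∈ σ.1)
    (hb : b ∈ σ.1) : b = a ∨ b = S.next σ a ∨ b = S.next σ (S.next σ a) := by
  have h1 := S.next_mem σ _ ha
  have h2 := S.next_mem σ _ h1
  have n1 := S.next_ne σ _ ha
  have n2 := S.next_ne σ _ h1
  have n3 := next_next_ne S σ ha
  have hsub : ({a, S.next σ a, S.next σ (S.next σ a)} : Finset V) ⊆ σ.1 := by
    intro x hx
    simp only [Finset.mem_insert, Finset.mem_singleton] at hx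
    rcases hx with rfl | rfl | rfl <;> assumption
  have hcard : ({a, S.next σ a, S.next σ (S.next σ a)} : Finset V).card = 3 :=
    Finset.card_eq_three.2 ⟨_, _, _, n1.symm, n3.symm, n2.symm, rfl⟩
  have heq := Finset.eq_of_subset_of_card_le hsub (by rw [hcard, σ.2.2])
  rw [← heq] at hb
  simpa using hb

lemma corner_injective (σ : S.Triangle) : Function.Injective (M.corner (.inl σ)) := by
  have h0 := M.start_mem σ
  have n1 := S.next_ne σ _ h0
  have n2 := S.next_ne σ _ (S.next_mem σ _ h0)
  have n3 := next_next_ne S σ h0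
  intro k l
  fin_cases k <;> fin_cases l <;> simp [corner, n1, n2, n3, n1.symm, n2.symm, n3.symm]

lemma exists_corner (σ : S.Triangle) {a : V} (ha : a ∈ σ.1) : ∃ k, M.corner (.inl σ) k = a := by
  rcases eq_triple S σ (M.start_mem σ) ha with h | h | h
  · exact ⟨0, by simp [corner, h]⟩
  · exact ⟨1, by simp [corner, h]⟩
  · exact ⟨2, by simp [corner, h]⟩

lemma corner_ne (x : S.Triangle ⊕ Fin B) (k : Fin 3) : M.corner x k ≠ M.corner x (k + 1) := by
  rcases x with σ | i
  · rw [corner_succ]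
    exact (S.next_ne σ _ (M.corner_mem σ k)).symm
  · intro h
    have := S.param_injective (a₁ := (i, k)) (a₂ := (i, k + 1)) h
    fin_cases k <;> simp at this

lemma corner_edge (x : S.Triangle ⊕ Fin B) (k : Fin 3) :
    ({M.corner x k, M.corner x (k + 1)} : Finset V) ∈ S.faces ∧
      ({M.corner x k, M.corner x (k + 1)} : Finset V).card = 2 := by
  refine ⟨?_, Finset.card_pair (M.corner_ne x k)⟩
  have key : ∃ σ : S.Triangle, M.corner x k ∈ σ.1 ∧ M.corner x (k + 1) ∈ σ.1 := by
    rcases x with σ | i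
    · exact ⟨σ, M.corner_mem σ _, M.corner_mem σ _⟩
    · obtain ⟨⟨σ, hb, hn⟩, -⟩ := (S.param_boundary _ _).1 ⟨i, k, rfl, rfl⟩
      refine ⟨σ, ?_, hb⟩
      rw [show M.corner (.inr i) k = S.param i k from rfl, ← hn]
      exact S.next_mem σ _ hb
  obtain ⟨σ, h1, h2⟩ := key
  refine (S.isRelLowerSet_faces σ.2.1).2 ?_ (Finset.insert_nonempty _ _)
  intro y hy
  simp only [Finset.mem_insert, Finset.mem_singleton] at hy
  rcases hy with rfl | rfl <;> assumption

/-- The `k`-th edge of a triangle or of a boundary component. -/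
def edgeAt (x : S.Triangle ⊕ Fin B) (k : Fin 3) : S.Edge :=
  ⟨{M.corner x k, M.corner x (k + 1)}, M.corner_edge x k⟩

open Classical in
/-- The triangle (or boundary component) `x` lies to the left (side `0`) or to the right (side `1`)
of its `k`-th edge `e`: it lies to the left if and only if going around `x` counterclockwise one
traverses `e` along the orientation of `e`, i.e. if the `k`-th edge of `x` starts at `source e`.
A boundary component is treated here like a triangle glued into it. -/
def side (x : S.Triangle ⊕ Fin B) (k : Fin 3) : Fin 2 :=
  if M.source (M.edgeAt x k) = M.corner x k then 0 else 1

lemma corner_unique (x y : S.Triangle ⊕ Fin B) (k l : Fin 3) (h : M.corner x k = M.corner y l)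
    (h' : M.corner x (k + 1) = M.corner y (l + 1)) : (x, k) = (y, l) := by
  have aux : ∀ (σ : S.Triangle) (i : Fin B) (k l : Fin 3),
      M.corner (.inl σ) k = M.corner (.inr i) l →
      M.corner (.inl σ) (k + 1) = M.corner (.inr i) (l + 1) → False := by
    intro σ i k l h h'
    rw [corner_succ] at h'
    have hm : S.param i l ∈ σ.1 := by
      have := M.corner_mem σ k
      rw [h] at this
      exact this
    have hn : S.next σ (S.param i l) = S.param i (l + 1) := by
      rw [h] at h'
      exact h'
    exact ((S.param_boundary _ _).1 ⟨i, l, rfl, rfl⟩).2 ⟨σ, hm, hn⟩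
  rcases x with σ | i <;> rcases y with τ | j
  · have hσ : σ = τ := by
      refine S.coherent σ τ (M.corner (.inl σ) k) (M.corner_mem σ k) ?_ ?_
      · rw [h]; exact M.corner_mem τ l
      · rw [← corner_succ, h', corner_succ, h]
    subst hσ
    rw [M.corner_injective σ h]
  · exact (aux σ j k l h h').elim
  · exact (aux τ i l k h.symm h'.symm).elim
  · have := S.param_injective (a₁ := (i, k)) (a₂ := (j, l)) h
    simp only [Prod.mk.injEq] at this
    rw [this.1, this.2]

lemma exists_side (e : S.Edge) {a b : V} (hab : a ≠ b) (he : e.1 = {a, b}) :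
    ∃ x k, M.corner x k = a ∧ M.corner x (k + 1) = b := by
  obtain ⟨τ, hτ⟩ := S.exists_triangle e.1 e.2.1
  have ha : a ∈ τ.1 := hτ (by simp [he])
  have hb : b ∈ τ.1 := hτ (by simp [he])
  by_cases hex : ∃ σ : S.Triangle, a ∈ σ.1 ∧ S.next σ a = b
  · obtain ⟨σ, hσ, hn⟩ := hex
    obtain ⟨k, hk⟩ := M.exists_corner σ hσ
    exact ⟨.inl σ, k, hk, by rw [corner_succ, hk, hn]⟩
  · have hba : S.next τ b = a := by
      rcases eq_triple S τ hb ha with h | h | h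
      · exact absurd h hab
      · exact h.symm
      · exact absurd ⟨τ, ha, by rw [h]; exact S.next_next_next τ b hb⟩ hex
    obtain ⟨i, k, h1, h2⟩ := (S.param_boundary a b).2 ⟨⟨τ, hb, hba⟩, hex⟩
    exact ⟨.inr i, k, h1, h2⟩

lemma side_bijective : Function.Bijective
    (fun p : (S.Triangle ⊕ Fin B) × Fin 3 => (M.edgeAt p.1 p.2, M.side p.1 p.2)) := by
  constructor
  · rintro ⟨x, k⟩ ⟨y, l⟩ h
    simp only [Prod.mk.injEq] at h
    obtain ⟨he, hs⟩ := h
    have he' : ({M.corner x k, M.corner x (k + 1)} : Finset V) =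
      {M.corner y l, M.corner y (l + 1)} := congrArg Subtype.val he
    have hx : M.source (M.edgeAt x k) ∈ ({M.corner x k, M.corner x (k + 1)} : Finset V) :=
      M.source_mem (M.edgeAt x k)
    have nx := M.corner_ne x k
    have ny := M.corner_ne y l
    have hk : M.corner x k = M.corner y l := by
      unfold side at hs
      rw [← he] at hs
      have m1 : M.corner x k ∈ ({M.corner y l, M.corner y (l + 1)} : Finset V) := by
        rw [← he']; simp
      have m2 : M.corner y l ∈ ({M.corner x k, M.corner x (k + 1)} : Finset V) := by
        rw [he']; simp
      simp only [Finset.mem_insert, Finset.mem_singleton] at hx m1 m2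
      by_cases h1 : M.source (M.edgeAt x k) = M.corner x k
      · by_cases h2 : M.source (M.edgeAt x k) = M.corner y l
        · exact h1.symm.trans h2
        · rw [if_pos h1, if_neg h2] at hs
          exact absurd hs (by decide)
      · by_cases h2 : M.source (M.edgeAt x k) = M.corner y l
        · rw [if_neg h1, if_pos h2] at hs
          exact absurd hs (by decide)
        · rcases m2 with m2 | m2
          · exact m2.symm
          · rcases hx with hx | hx
            · exact absurd hx h1
            · exact absurd (hx.trans m2.symm) h2
    refine M.corner_unique x y k l hk ?_
    have m1 : M.corner x (k + 1) ∈ ({M.corner y l, M.corner y (l + 1)} : Finset V) := by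
      rw [← he']; simp
    simp only [Finset.mem_insert, Finset.mem_singleton] at m1
    rcases m1 with m1 | m1
    · exact absurd (hk.trans m1.symm) nx
    · exact m1
  · rintro ⟨e, j⟩
    obtain ⟨c, d, hcd, hed⟩ := Finset.card_eq_two.1 e.2.2
    have hsrc := M.source_mem e
    obtain ⟨b, hab, he⟩ : ∃ b, M.source e ≠ b ∧ e.1 = {M.source e, b} := by
      rw [hed] at hsrc
      simp only [Finset.mem_insert, Finset.mem_singleton] at hsrc
      rcases hsrc with h | h
      · exact ⟨d, by rw [h]; exact hcd, by rw [h]; exact hed⟩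
      · exact ⟨c, by rw [h]; exact hcd.symm, by rw [h, hed, Finset.pair_comm]⟩
    have hj : j = 0 ∨ j = 1 := by fin_cases j <;> simp
    rcases hj with rfl | rfl
    · obtain ⟨x, k, h1, h2⟩ := M.exists_side e hab he
      have hxe : M.edgeAt x k = e := Subtype.ext (by simp [edgeAt, h1, h2, he])
      exact ⟨(x, k), by simp [side, hxe, h1]⟩
    · obtain ⟨x, k, h1, h2⟩ := M.exists_side e hab.symm (by rw [he, Finset.pair_comm])
      have hxe : M.edgeAt x k = e := Subtype.ext (by
        simp only [edgeAt, h1, h2]; rw [Finset.pair_comm]; exact he.symm)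
      exact ⟨(x, k), by simp [side, hxe, h1, hab]⟩

/-- The connectivity of the dual graph: the two sides (`0` = left, `1` = right) of the edges are
matched with the edge positions of the triangles and of the boundary components. -/
def sideEquiv : (S.Triangle ⊕ Fin B) × Fin 3 ≃ S.Edge × Fin 2 :=
  Equiv.ofBijective _ M.side_bijective

end Marking

end CombinatorialSurface

/-! ## Admissible edge signs -/

/-- The two types of boundary components: Neveu-Schwarz and Ramond. -/
inductive BoundaryType
  | NS
  | R

namespace CombinatorialSurface.Marking

variable {V : Type w} [DecidableEq V] {B : ℕ} {S : CombinatorialSurface V B} (M : S.Marking)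

/-- The number `K` of edges pointing away from `v`. -/
def numOut (v : V) : ℕ := {e : S.Edge | M.source e = v}.ncard

/-- The number `D` of triangles `σ` for which `v` is the vertex `χ_σ(1)`, the initial vertex of the
preferred edge. (Equivalently, a small counterclockwise path around `v` enters `σ` through the
preferred edge.) -/
def numStart (v : V) : ℕ := {σ : S.Triangle | M.start σ = v}.ncard

/-- The product of the signs of all edges which contain `v`. -/
def signProd (S : CombinatorialSurface V B) (s : S.Edge → ℤˣ) (v : V) : ℤˣ := ∏ᶠ e ∈ {e : S.Edge | v ∈ e.1}, s e

/-- The vertex rule for inner vertices. -/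
def InnerRule (s : S.Edge → ℤˣ) (v : V) : Prop :=
  signProd S s v = (-1) ^ (M.numStart v + M.numOut v + 1)

/-- The vertex rule for the boundary vertex `param i k` if the `i`-th boundary component has the
given type.  For type `NS` the number `D` is increased by one at the vertex `param i 0`. -/
def BoundaryRule (s : S.Edge → ℤˣ) (i : Fin B) (k : Fin 3) : BoundaryType → Prop
  | .R => signProd S s (S.param i k) =
      (-1) ^ (M.numStart (S.param i k) + M.numOut (S.param i k) + 1)
  | .NS => signProd S s (S.param i k) =
      (-1) ^ ((M.numStart (S.param i k) + if k = 0 then 1 else 0) + M.numOut (S.param i k) + 1)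

/-- Admissible edge signs: the vertex rule holds at all inner vertices, and on each boundary
component either all three vertices satisfy the rule for type `NS`, or all three satisfy the rule
for type `R`. -/
def Admissible (s : S.Edge → ℤˣ) : Prop :=
  (∀ v : V, (∀ i k, S.param i k ≠ v) → M.InnerRule s v) ∧
    ∀ i : Fin B, (∀ k, M.BoundaryRule s i k .NS) ∨ (∀ k, M.BoundaryRule s i k .R)

/-- The edge signs are admissible, and the boundary component `i` is of type `δ i`. -/
def AdmissibleOfType (s : S.Edge → ℤˣ) (δ : Fin B → BoundaryType) : Prop :=
  (∀ v : V, (∀ i k, S.param i k ≠ v) → M.InnerRule s v) ∧ ∀ i k, M.BoundaryRule s i k (δ i)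

lemma admissible_iff (s : S.Edge → ℤˣ) :
    M.Admissible s ↔ ∃ δ : Fin B → BoundaryType, M.AdmissibleOfType s δ := by
  constructor
  · rintro ⟨h, hb⟩
    have : ∀ i, ∃ d, ∀ k, M.BoundaryRule s i k d := fun i =>
      (hb i).elim (fun h => ⟨.NS, h⟩) (fun h => ⟨.R, h⟩)
    choose δ hδ using this
    exact ⟨δ, h, hδ⟩
  · rintro ⟨δ, h, hδ⟩
    refine ⟨h, fun i => ?_⟩
    have := hδ i
    cases hd : δ i with
    | NS => exact .inl (by rwa [hd] at this)
    | R => exact .inr (by rwa [hd] at this)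

end CombinatorialSurface.Marking

/-! ## Frobenius algebras in a symmetric monoidal category -/

section Frobenius

variable {C : Type u} [Category.{v} C] [MonoidalCategory C]

/-- An algebra and coalgebra object is a Frobenius algebra if the coproduct is a morphism of left
and of right modules. -/
class IsFrobeniusObj (A : C) [MonObj A] [ComonObj A] : Prop where
  left_linear : A ◁ Δ[A] ≫ (α_ A A A).inv ≫ μ[A] ▷ A = μ[A] ≫ Δ[A]
  right_linear : Δ[A] ▷ A ≫ (α_ A A A).hom ≫ A ◁ μ[A] = μ[A] ≫ Δ[A]

variable (A : C) [MonObj A] [ComonObj A]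

/-- The pairing `b`. -/
def frobPairing : A ⊗ A ⟶ 𝟙_ C := μ[A] ≫ ε[A]

/-- The convolution product `f * g = μ ∘ (f ⊗ g) ∘ Δ` of endomorphisms. -/
def frobConv (f g : A ⟶ A) : A ⟶ A := Δ[A] ≫ (f ⊗ₘ g) ≫ μ[A]

/-- The morphism `t = ε ∘ μ ∘ (μ ⊗ id)` assigned to triangles. -/
def frobTriangle : A ⊗ A ⊗ A ⟶ 𝟙_ C := (α_ A A A).inv ≫ μ[A] ▷ A ≫ μ[A] ≫ ε[A]

variable [SymmetricCategory C]

/-- The copairings `c_{-1} = Δ ∘ η` and `c_{+1} = σ_{A,A} ∘ Δ ∘ η` assigned to edges. -/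
def frobCopairing (s : ℤˣ) : 𝟙_ C ⟶ A ⊗ A :=
  if s = -1 then η[A] ≫ Δ[A] else η[A] ≫ Δ[A] ≫ (β_ A A).hom

/-- The Nakayama automorphism `N = (b ⊗ id) ∘ (id ⊗ σ_{A,A}) ∘ (id ⊗ c_{-1})`. -/
def nakayama : A ⟶ A :=
  (ρ_ A).inv ≫ A ◁ frobCopairing A (-1) ≫ A ◁ (β_ A A).hom ≫ (α_ A A A).inv ≫
    frobPairing A ▷ A ≫ (λ_ A).hom

/-- `P^NS = μ ∘ σ_{A,A} ∘ (N ⊗ id) ∘ Δ` and `P^R = μ ∘ σ_{A,A} ∘ Δ`. -/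
def stateProjector : BoundaryType → (A ⟶ A)
  | .NS => Δ[A] ≫ nakayama A ▷ A ≫ (β_ A A).hom ≫ μ[A]
  | .R => Δ[A] ≫ (β_ A A).hom ≫ μ[A]

/-- `ι^{13}`: the iterated coproduct `A → A ⊗ A ⊗ A`, followed by the permutation which reverses the
order of the three tensor factors. -/
def iotaOneThree : A ⟶ A ⊗ A ⊗ A :=
  Δ[A] ≫ A ◁ Δ[A] ≫ (β_ A (A ⊗ A)).hom ≫ (β_ A A).hom ▷ A ≫ (α_ A A A).hom

end Frobenius

/-! ## Tensor powers and permutations of tensor factors -/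

section TensorPower

variable {C : Type u} [Category.{v} C] [MonoidalCategory C] (A : C)

/-- `A^{⊗ n} = A ⊗ (A ⊗ (… ⊗ 𝟙))`, with the factors numbered `0, …, n - 1` from the left. -/
def tensorPow : ℕ → C
  | 0 => 𝟙_ C
  | n + 1 => A ⊗ tensorPow n

/-- The canonical morphism `A^{⊗ n} ⊗ A^{⊗ m} → A^{⊗ (n + m)}`. -/
def tensorPowJoin (m : ℕ) : ∀ n : ℕ, tensorPow A n ⊗ tensorPow A m ⟶ tensorPow A (m + n)
  | 0 => (λ_ (tensorPow A m)).hom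
  | n + 1 => (α_ A (tensorPow A n) (tensorPow A m)).hom ≫ A ◁ tensorPowJoin m n

/-- The tensor product of `n` morphisms `c j : 𝟙 ⟶ A ⊗ A`. -/
def tensorCopairings : ∀ (n : ℕ), (Fin n → (𝟙_ C ⟶ A ⊗ A)) → (𝟙_ C ⟶ tensorPow A (2 * n))
  | 0, _ => 𝟙 (𝟙_ C)
  | n + 1, c => (λ_ (𝟙_ C)).inv ≫ (c 0 ⊗ₘ tensorCopairings n (fun j => c j.succ)) ≫
      (α_ A A (tensorPow A (2 * n))).hom

/-- The morphism `b ⊗ ⋯ ⊗ b`, with `n` factors. -/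
def tensorPairings (b : A ⊗ A ⟶ 𝟙_ C) : ∀ n : ℕ, tensorPow A (2 * n) ⟶ 𝟙_ C
  | 0 => 𝟙 (𝟙_ C)
  | n + 1 => (α_ A A (tensorPow A (2 * n))).inv ≫ b ▷ tensorPow A (2 * n) ≫
      (λ_ (tensorPow A (2 * n))).hom ≫ tensorPairings b n

/-- The morphism `t ⊗ ⋯ ⊗ t ⊗ id`, with `n` factors `t`, which are applied to the first `3 * n` tensor
factors, and with the identity on the last `m` tensor factors. -/
def tensorTriangles (t : A ⊗ A ⊗ A ⟶ 𝟙_ C) (m : ℕ) :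
    ∀ n : ℕ, tensorPow A (m + 3 * n) ⟶ tensorPow A m
  | 0 => 𝟙 (tensorPow A m)
  | n + 1 => A ◁ (α_ A A (tensorPow A (m + 3 * n))).inv ≫
      (α_ A (A ⊗ A) (tensorPow A (m + 3 * n))).inv ≫ t ▷ tensorPow A (m + 3 * n) ≫
      (λ_ (tensorPow A (m + 3 * n))).hom ≫ tensorTriangles t m n

/-- The tensor product of `n` morphisms `g j : A ⟶ A ⊗ A ⊗ A`. -/
def tensorTriples : ∀ n : ℕ, (Fin n → (A ⟶ A ⊗ A ⊗ A)) → (tensorPow A n ⟶ tensorPow A (3 * n))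
  | 0, _ => 𝟙 (𝟙_ C)
  | n + 1, g => (g 0 ⊗ₘ tensorTriples n (fun j => g j.succ)) ≫
      (α_ A (A ⊗ A) (tensorPow A (3 * n))).hom ≫ A ◁ (α_ A A (tensorPow A (3 * n))).hom

variable [SymmetricCategory C]

/-- The morphism `A ⊗ A^{⊗ n} → A^{⊗ (n + 1)}` which moves the first factor to position `k` and keeps
the order of the other factors. -/
def tensorInsert : ∀ n : ℕ, Fin (n + 1) → (A ⊗ tensorPow A n ⟶ tensorPow A (n + 1))
  | 0, _ => 𝟙 _
  | n + 1, k => Fin.cases (motive := fun _ => A ⊗ tensorPow A (n + 1) ⟶ tensorPow A (n + 2)) (𝟙 _)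
      (fun j => (α_ A A (tensorPow A n)).inv ≫ (β_ A A).hom ▷ tensorPow A n ≫
        (α_ A A (tensorPow A n)).hom ≫ A ◁ tensorInsert n j) k

/-- What remains of a bijection `Fin (m + 1) ≃ Fin (n + 1)` after deleting `0` from the source and
its image from the target, and renumbering in the order preserving way. -/
def removeZero {m n : ℕ} (e : Fin (m + 1) ≃ Fin (n + 1)) : Fin m ≃ Fin n :=
  Equiv.removeNone ((finSuccEquiv' 0).symm.trans (e.trans (finSuccEquiv' (e 0))))

/-- The permutation of tensor factors in the symmetric monoidal category which moves the factor in
position `i` to position `e i`. -/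
def tensorPerm : ∀ {m n : ℕ}, (Fin m ≃ Fin n) → (tensorPow A m ⟶ tensorPow A n)
  | 0, 0, _ => 𝟙 _
  | 0, _ + 1, e => (e.symm 0).elim0
  | _ + 1, 0, e => (e 0).elim0
  | _ + 1, n + 1, e => A ◁ tensorPerm (removeZero e) ≫ tensorInsert A n (e 0)

end TensorPower

/-- The numbering of `n` consecutive blocks of length `k`: the pair `(i, j)` has number
`k * i + j`. -/
def blockEquiv (n k : ℕ) : Fin n × Fin k ≃ Fin (k * n) :=
  finProdFinEquiv.trans (finCongr (Nat.mul_comm n k))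

/-! ## The state sum -/

namespace CombinatorialSurface.Marking

variable {V : Type w} [DecidableEq V] {B : ℕ} {S : CombinatorialSurface V B} (M : S.Marking)

/-- The permutation given by the connectivity of the marked surface, once the edges and the
triangles have been enumerated: the left (right) leg of the edge number `m`, which has position
`2 * m` (`2 * m + 1`), is moved to the leg number `k` of the triangle or boundary component which has
this edge as `k`-th edge and lies on this side of it.  The legs of the triangles come first, followed
by those of the boundary components. -/
def legPerm {nE nT : ℕ} (enumE : Fin nE ≃ S.Edge) (enumT : Fin nT ≃ S.Triangle) :
    Fin (2 * nE) ≃ Fin (3 * B + 3 * nT) :=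
  (blockEquiv nE 2).symm.trans <|
  (Equiv.prodCongr enumE (Equiv.refl (Fin 2))).trans <|
  M.sideEquiv.symm.trans <|
  (Equiv.prodCongr (Equiv.sumCongr enumT.symm (Equiv.refl (Fin B))) (Equiv.refl (Fin 3))).trans <|
  (Equiv.sumProdDistrib (Fin nT) (Fin B) (Fin 3)).trans <|
  (Equiv.sumCongr (blockEquiv nT 3) (blockEquiv B 3)).trans <|
  finSumFinEquiv.trans (finCongr (Nat.add_comm (3 * nT) (3 * B)))

variable {C : Type u} [Category.{v} C] [MonoidalCategory C] [SymmetricCategory C]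
  (A : C) [MonObj A] [ComonObj A]

/-- `T_triang : 𝟙 → (A^{⊗ 3})^{⊗ B}`: a copairing `c_{s(e)}` for every edge `e`, followed by the
permutation of tensor factors given by the connectivity of the surface, followed by a morphism `t`
for every triangle. -/
def triangSum (s : S.Edge → ℤˣ) {nE nT : ℕ} (enumE : Fin nE ≃ S.Edge)
    (enumT : Fin nT ≃ S.Triangle) : 𝟙_ C ⟶ tensorPow A (3 * B) :=
  tensorCopairings A nE (fun m => frobCopairing A (s (enumE m))) ≫
    tensorPerm A (M.legPerm enumE enumT) ≫
    tensorTriangles A (frobTriangle A) (3 * B) nT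

end CombinatorialSurface.Marking

/-- The bijection which moves the factor `i` of the first (second) block of length `m` to the first
(second) place in the pair number `i`. -/
def shuffleEquiv (m : ℕ) : Fin (m + m) ≃ Fin (2 * m) :=
  finSumFinEquiv.symm.trans <|
  (Equiv.boolProdEquivSum (Fin m)).symm.trans <|
  (Equiv.prodComm Bool (Fin m)).trans <|
  (Equiv.prodCongr (Equiv.refl (Fin m)) finTwoEquiv.symm).trans (blockEquiv m 2)

namespace CombinatorialSurface.Marking

variable {V : Type w} [DecidableEq V] {B : ℕ} {S : CombinatorialSurface V B} (M : S.Marking)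
  {C : Type u} [Category.{v} C] [MonoidalCategory C] [SymmetricCategory C]
  (A : C) [MonObj A] [ComonObj A]

/-- `T'_A = b^{⊗ 3B} ∘ τ ∘ (id ⊗ T_triang) : (A^{⊗ 3})^{⊗ B} → 𝟙`, where `τ` pairs the `i`-th factor
of the first copy of `A^{⊗ 3B}` with the `i`-th factor of the second copy. -/
def stateSum (s : S.Edge → ℤˣ) {nE nT : ℕ} (enumE : Fin nE ≃ S.Edge)
    (enumT : Fin nT ≃ S.Triangle) : tensorPow A (3 * B) ⟶ 𝟙_ C :=
  (ρ_ (tensorPow A (3 * B))).inv ≫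
    tensorPow A (3 * B) ◁ M.triangSum A s enumE enumT ≫
    tensorPowJoin A (3 * B) (3 * B) ≫
    tensorPerm A (shuffleEquiv (3 * B)) ≫
    tensorPairings A (frobPairing A) (3 * B)

end CombinatorialSurface.Marking

/-- `⨂_i (ι^{13} ∘ P^{δ_i}) : A^{⊗ B} → (A^{⊗ 3})^{⊗ B}`. -/
def boundaryInsertion {C : Type u} [Category.{v} C] [MonoidalCategory C] [SymmetricCategory C]
    (A : C) [MonObj A] [ComonObj A] {B : ℕ} (δ : Fin B → BoundaryType) :
    tensorPow A B ⟶ tensorPow A (3 * B) :=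
  tensorTriples A B (fun i => stateProjector A (δ i) ≫ iotaOneThree A)

end

-- Because Δ is a bimodule map, pairing ι^{13}(a) with z₀ ⊗ z₁ ⊗ z₂ gives ε(a z₀ z₁ z₂)
-- (`iotaOneThree_pairing`). A boundary component is thus one more triangle, glued into the hole and
-- carrying the insertion a = P^δ(x); an honest triangle has a = 1. The surface becomes closed, and
-- the composite is a product of functionals, one for each face, in which every edge contracts two
-- arguments by c_{s(e)}. Read signs as exponents, N^{+1} = id and N^{-1} = N; this is
-- multiplicative since N² = id. The insertions commute up to such a power, a y = N^t(y) a, with t =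
-- 1 for triangles and type NS, and t = -1 for type R (`isTwisted_stateProjector`).
--
-- Fix a vertex v. The identity b(x, y) = b(y, N x) allows the functional of a face to be rotated,
-- so that at its corner at v it reads ε(x g(y) N^p(z)), where x and z belong to the two edges of
-- the face at v (`labelledFace_eq_form`). Here p = -1 at corners 1 and 2, where the rotation moves
-- the argument z across the trace, and p = t at corner 0, where z₀ is moved past a instead.
-- Contracting two adjacent corners by a copairing of sign s is a zigzag contributing N^{-s}; the
-- result has the same shape, with exponents multiplied (`cupFront_twistMul_chain`). After a full
-- turn the last contraction leaves the factor μ(N^k ⊗ N)c_s. If the product of all exponents around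
-- v is 1, this factor is N applied to (N * id)(1), hence zero (`copairing_mul_eq_zero`).
--
-- The product of the exponents is the product of the edge signs at v times (-1)^{D+K}, where D also
-- counts the NS components starting at v (`prod_corners`). The vertex rule says that it equals -1.
-- A single vertex violating the rule therefore makes the whole composite vanish.
--
-- To make "first contract the edges at v" meaningful, tensor factors carry labels. Permutations are
-- tracked only through labels, functionals are taken up to relabelling and form a commutative
-- monoid, and contractions of symmetric families commute (`contract_contract`).
-- `contractPairs_toFamily_faces` identifies the given composite with such a contraction, and
-- `contractEdges_eq_zero` finishes.

attribute [reducible] tensorPow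

noncomputable section

/-! ### Rewriting inside right-associated composites -/

section Reassociation

variable {C : Type u} [Category.{v} C]

lemma comp_eq₂ {X Y Z W : C} {f : X ⟶ Y} {g : Y ⟶ Z} {k : X ⟶ Z} (h : f ≫ g = k) (r : Z ⟶ W) :
    f ≫ g ≫ r = k ≫ r := by
  rw [← h, Category.assoc]

lemma comp_eq₃ {X Y Y' Z W : C} {f : X ⟶ Y} {g : Y ⟶ Y'} {g' : Y' ⟶ Z} {k : X ⟶ Z}
    (h : f ≫ g ≫ g' = k) (r : Z ⟶ W) : f ≫ g ≫ g' ≫ r = k ≫ r := by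
  rw [← h, Category.assoc, Category.assoc]

end Reassociation

/-! ### Exchanging the first two factors in front of a spectator -/

section Exchange

variable {C : Type u} [Category.{v} C] [MonoidalCategory C] [SymmetricCategory C]

/-- The morphism which exchanges the first two factors of a threefold tensor product. -/
def exch (X Y W : C) : X ⊗ (Y ⊗ W) ⟶ Y ⊗ (X ⊗ W) :=
  (α_ X Y W).inv ≫ (β_ X Y).hom ▷ W ≫ (α_ Y X W).hom

@[simp]
lemma exch_exch (X Y W : C) : exch X Y W ≫ exch Y X W = 𝟙 _ := by
  simp [exch, ← comp_whiskerRight_assoc]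

lemma exch_naturality_right (X Y : C) {W W' : C} (h : W ⟶ W') :
    X ◁ Y ◁ h ≫ exch X Y W' = exch X Y W ≫ Y ◁ X ◁ h := by
  simp only [exch, Category.assoc]
  rw [associator_inv_naturality_right_assoc, whisker_exchange_assoc, tensor_whiskerLeft]
  simp

lemma exch_naturality_left {X X' : C} (f : X ⟶ X') (Y W : C) :
    f ▷ (Y ⊗ W) ≫ exch X' Y W = exch X Y W ≫ Y ◁ f ▷ W := by
  simp only [exch, Category.assoc]
  rw [associator_inv_naturality_left_assoc, ← comp_whiskerRight_assoc,
    BraidedCategory.braiding_naturality_left]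
  simp

lemma exch_naturality_middle (X : C) {Y Y' : C} (g : Y ⟶ Y') (W : C) :
    X ◁ g ▷ W ≫ exch X Y' W = exch X Y W ≫ g ▷ (X ⊗ W) := by
  simp only [exch, Category.assoc]
  rw [associator_inv_naturality_middle_assoc, ← comp_whiskerRight_assoc,
    BraidedCategory.braiding_naturality_right]
  simp

/-- The braid relation with a spectator `W`, in the right-nested form that matches `tensorPow`, so
that later arguments need no associators. -/
lemma exch_yang_baxter (X Y Z W : C) :
    exch X Y (Z ⊗ W) ≫ Y ◁ exch X Z W ≫ exch Y Z (X ⊗ W) =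
      X ◁ exch Y Z W ≫ exch X Z (Y ⊗ W) ≫ Z ◁ exch X Y W := by
  have h := congrArg (fun f => (α_ X Y (Z ⊗ W)).inv ≫ (α_ (X ⊗ Y) Z W).inv ≫
    ((α_ X Y Z).hom ▷ W) ≫ f ▷ W ≫ (α_ Z (Y ⊗ X) W).hom ≫ Z ◁ (α_ Y X W).hom)
    (BraidedCategory.yang_baxter X Y Z)
  simp only [exch]
  convert h using 1 <;> monoidal

/-- This and the next lemma are the two hexagons: exchanging with a tensor product means exchanging
with its factors one at a time. -/
lemma exch_tensor_left (X X' Y W : C) :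
    (α_ X X' (Y ⊗ W)).hom ≫ X ◁ exch X' Y W ≫ exch X Y (X' ⊗ W) =
      exch (X ⊗ X') Y W ≫ Y ◁ (α_ X X' W).hom := by
  simp only [exch, BraidedCategory.braiding_tensor_left_hom]
  monoidal

lemma exch_tensor_right (X Y Y' W : C) :
    exch X Y (Y' ⊗ W) ≫ Y ◁ exch X Y' W =
      X ◁ (α_ Y Y' W).inv ≫ exch X (Y ⊗ Y') W ≫ (α_ Y Y' (X ⊗ W)).hom := by
  simp only [exch, BraidedCategory.braiding_tensor_right_hom]
  monoidal

lemma exch_unit_left (Y W : C) :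
    exch (𝟙_ C) Y W = (λ_ (Y ⊗ W)).hom ≫ Y ◁ (λ_ W).inv := by
  simp only [exch, braiding_tensorUnit_left]
  monoidal

lemma exch_unit_middle (X W : C) :
    exch X (𝟙_ C) W = X ◁ (λ_ W).hom ≫ (λ_ (X ⊗ W)).inv := by
  simp only [exch, braiding_tensorUnit_right]
  monoidal

lemma exch_unit_right (X Y : C) :
    exch X Y (𝟙_ C) = X ◁ (ρ_ Y).hom ≫ (β_ X Y).hom ≫ Y ◁ (ρ_ X).inv := by
  have h : (β_ X Y).hom ▷ 𝟙_ C = (ρ_ _).hom ≫ (β_ X Y).hom ≫ (ρ_ _).inv := by simp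
  simp only [exch, h]
  monoidal

end Exchange

/-! ### Functoriality of permutations of tensor factors -/

section Permutations

variable {C : Type u} [Category.{v} C] [MonoidalCategory C] [SymmetricCategory C] (A : C)

lemma tensorInsert_zero (n : ℕ) : tensorInsert A n 0 = 𝟙 _ := by
  cases n <;> rfl

lemma tensorInsert_succ (n : ℕ) (j : Fin (n + 1)) :
    tensorInsert A (n + 1) j.succ = exch A A (tensorPow A n) ≫ A ◁ tensorInsert A n j := by
  simp only [exch, Category.assoc]
  rfl

/-- Two factors can be inserted in either order once the positions are renumbered. If neither goes
to the front, both pass the same front factor, and the braid relation reduces the claim to one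
factor fewer. -/
lemma tensorInsert_exch : ∀ (n : ℕ) (q : Fin (n + 2)) (p : Fin (n + 1)),
    exch A A (tensorPow A n) ≫ A ◁ tensorInsert A n p ≫ tensorInsert A (n + 1) q =
      A ◁ tensorInsert A n (p.predAbove q) ≫ tensorInsert A (n + 1) (q.succAbove p) := by
  intro n q p
  induction q using Fin.cases with
  | zero =>
    have h : p.predAbove (0 : Fin (n + 2)) = 0 := by simp
    rw [h, Fin.zero_succAbove, tensorInsert_zero, tensorInsert_zero, tensorInsert_succ]
    simp [tensorPow]
  | succ q =>
    induction p using Fin.cases with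
    | zero =>
      have h : (0 : Fin (n + 1)).predAbove q.succ = q := by simp
      rw [h, Fin.succ_succAbove_zero, tensorInsert_zero, tensorInsert_zero, tensorInsert_succ,
        MonoidalCategory.whiskerLeft_id, Category.id_comp, comp_eq₂ (exch_exch A A _)]
      simp [tensorPow]
    | succ p =>
      cases n with
      | zero => exact p.elim0
      | succ n =>
        have ih := tensorInsert_exch n q p
        have h : p.succ.predAbove q.succ = (p.predAbove q).succ := by simp
        rw [h, Fin.succ_succAbove_succ]
        simp only [tensorInsert_succ, MonoidalCategory.whiskerLeft_comp, Category.assoc]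
        have e1 := exch_naturality_right A A (tensorInsert A n p)
        have e2 := exch_naturality_right A A (tensorInsert A n (p.predAbove q))
        have e3 := exch_yang_baxter A A A (tensorPow A n)
        have ih' := congrArg (fun f => A ◁ f) ih
        simp only [MonoidalCategory.whiskerLeft_comp] at ih'
        rw [comp_eq₂ e1, comp_eq₂ e2]
        simp only [Category.assoc]
        rw [comp_eq₃ e3]
        simp only [Category.assoc]
        rw [ih']

/-- What remains of a bijection `Fin (m + 1) ≃ Fin (n + 1)` after deleting `k` from the source and
its image from the target, and renumbering in the order preserving way. -/
def removeAt {m n : ℕ} (k : Fin (m + 1)) (e : Fin (m + 1) ≃ Fin (n + 1)) : Fin m ≃ Fin n :=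
  Equiv.removeNone ((finSuccEquiv' k).symm.trans (e.trans (finSuccEquiv' (e k))))

lemma succAbove_removeAt {m n : ℕ} (k : Fin (m + 1)) (e : Fin (m + 1) ≃ Fin (n + 1)) (i : Fin m) :
    (e k).succAbove (removeAt k e i) = e (k.succAbove i) := by
  have hne : e (k.succAbove i) ≠ e k := fun h => Fin.succAbove_ne k i (e.injective h)
  obtain ⟨j, hj⟩ := Fin.exists_succAbove_eq hne
  have h : ((finSuccEquiv' k).symm.trans (e.trans (finSuccEquiv' (e k)))) (some i) = some j := by
    simp [← hj]
  have h1 : some (removeAt k e i) = some j := by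
    rw [← h]
    exact Equiv.removeNone_some _ ⟨j, h⟩
  rw [Option.some.inj h1, hj]

lemma eq_removeAt {m n : ℕ} {k : Fin (m + 1)} {e : Fin (m + 1) ≃ Fin (n + 1)} {f : Fin m ≃ Fin n}
    (h : ∀ i, (e k).succAbove (f i) = e (k.succAbove i)) : removeAt k e = f :=
  Equiv.ext fun i => Fin.succAbove_right_injective ((succAbove_removeAt k e i).trans (h i).symm)

lemma tensorPerm_succ {m n : ℕ} (e : Fin (m + 1) ≃ Fin (n + 1)) :
    tensorPerm A e = A ◁ tensorPerm A (removeAt 0 e) ≫ tensorInsert A n (e 0) := rfl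

/-- Supplies the renumbering required by `tensorInsert_exch` when the images of `0` and `j.succ` are
removed in the two possible orders. -/
lemma predAbove_removeAt {m n : ℕ} (j : Fin (m + 1)) (e : Fin (m + 2) ≃ Fin (n + 2)) :
    (removeAt 0 e j).predAbove (e 0) = removeAt j.succ e 0 := by
  have h1 : (e j.succ).succAbove (removeAt j.succ e 0) = e 0 := by
    rw [succAbove_removeAt, Fin.succ_succAbove_zero]
  have h2 : (e 0).succAbove (removeAt 0 e j) = e j.succ := by
    rw [succAbove_removeAt, Fin.zero_succAbove]
  apply Fin.succAbove_right_injective (p := e j.succ)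
  rw [h1, ← h2]
  exact Fin.succAbove_succAbove_predAbove _ _

lemma removeAt_removeAt {m n : ℕ} (j : Fin (m + 1)) (e : Fin (m + 2) ≃ Fin (n + 2)) :
    removeAt 0 (removeAt j.succ e) = removeAt j (removeAt 0 e) := by
  apply eq_removeAt
  intro i
  have h2 : (e 0).succAbove (removeAt 0 e j) = e j.succ := by
    rw [succAbove_removeAt, Fin.zero_succAbove]
  apply Fin.succAbove_right_injective (p := e j.succ)
  rw [succAbove_removeAt, Fin.zero_succAbove, Fin.succ_succAbove_succ]
  have h3 : e ((j.succAbove i).succ) = (e 0).succAbove (removeAt 0 e (j.succAbove i)) := by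
    rw [succAbove_removeAt, Fin.zero_succAbove]
  have h5 := predAbove_removeAt j e
  rw [h3, ← succAbove_removeAt j (removeAt 0 e), ← h5, ← h2,
    Fin.succAbove_succAbove_succAbove_predAbove]

/-- The recursion defining `tensorPerm` peels off position `0`; this shows that any position may be
peeled off. That is what functoriality needs, since the first factor may already have been moved to
an arbitrary position. -/
lemma tensorInsert_tensorPerm : ∀ {m n : ℕ} (k : Fin (m + 1)) (e : Fin (m + 1) ≃ Fin (n + 1)),
    tensorInsert A m k ≫ tensorPerm A e = A ◁ tensorPerm A (removeAt k e) ≫ tensorInsert A n (e k)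
  | m, n, k, e => by
    induction k using Fin.cases with
    | zero => rw [tensorInsert_zero, tensorPerm_succ, Category.id_comp]
    | succ j =>
      cases m with
      | zero => exact j.elim0
      | succ m =>
        cases n with
        | zero => exact absurd (Fintype.card_congr e) (by simp)
        | succ n =>
          have ih := tensorInsert_tensorPerm j (removeAt 0 e)
          have h2 : (e 0).succAbove (removeAt 0 e j) = e j.succ := by
            rw [succAbove_removeAt, Fin.zero_succAbove]
          have h3 := predAbove_removeAt j e
          have h4 := tensorInsert_exch A n (e 0) (removeAt 0 e j)
          rw [h3, h2] at h4
          have e1 := exch_naturality_right A A (tensorPerm A (removeAt j (removeAt 0 e)))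
          rw [tensorInsert_succ, tensorPerm_succ, tensorPerm_succ A (removeAt j.succ e),
            removeAt_removeAt]
          simp only [Category.assoc, MonoidalCategory.whiskerLeft_comp]
          rw [← h4, comp_eq₂ e1, Category.assoc, ← MonoidalCategory.whiskerLeft_comp_assoc, ih]
          simp

lemma removeAt_trans {m n k : ℕ} (e : Fin (m + 1) ≃ Fin (n + 1)) (f : Fin (n + 1) ≃ Fin (k + 1))
    (j : Fin (m + 1)) : removeAt j (e.trans f) = (removeAt j e).trans (removeAt (e j) f) := by
  apply eq_removeAt
  intro i
  simp [succAbove_removeAt]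

lemma tensorPerm_trans : ∀ {m n k : ℕ} (e : Fin m ≃ Fin n) (f : Fin n ≃ Fin k),
    tensorPerm A (e.trans f) = tensorPerm A e ≫ tensorPerm A f
  | 0, 0, 0, _, _ => (Category.id_comp _).symm
  | 0, _ + 1, _, e, _ => (e.symm 0).elim0
  | _ + 1, 0, _, e, _ => (e 0).elim0
  | _, 0, _ + 1, _, f => (f.symm 0).elim0
  | _, _ + 1, 0, _, f => (f 0).elim0
  | m + 1, n + 1, k + 1, e, f => by
    rw [tensorPerm_succ, tensorPerm_succ A e, Category.assoc, tensorInsert_tensorPerm,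
      removeAt_trans, tensorPerm_trans, MonoidalCategory.whiskerLeft_comp_assoc]
    rfl

lemma tensorPerm_refl : ∀ n : ℕ, tensorPerm A (Equiv.refl (Fin n)) = 𝟙 _
  | 0 => rfl
  | n + 1 => by
    have h : removeAt 0 (Equiv.refl (Fin (n + 1))) = Equiv.refl _ := eq_removeAt fun i => rfl
    rw [tensorPerm_succ, h, tensorPerm_refl n]
    simp [tensorInsert_zero]

end Permutations

/-! ### Labelled factors: permutations tracked by their effect on words -/

section Words

variable {L : Type w}

/-- The concatenation of two words; the length is in the form used by `tensorPowJoin`. -/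
def catWord : ∀ {n m : ℕ}, (Fin n → L) → (Fin m → L) → Fin (m + n) → L
  | 0, _, _, w' => w'
  | n + 1, _, w, w' => Fin.cons (w 0) (catWord (n := n) (Fin.tail w) w')

@[simp]
lemma catWord_cons {n m : ℕ} (a : L) (w : Fin n → L) (w' : Fin m → L) :
    catWord (Fin.cons a w : Fin (n + 1) → L) w' = Fin.cons a (catWord w w') := by
  simp [catWord]

@[simp]
lemma catWord_zero {m : ℕ} (w : Fin 0 → L) (w' : Fin m → L) : catWord w w' = w' := rfl

lemma catWord_succ {n m : ℕ} (w : Fin (n + 1) → L) (w' : Fin m → L) :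
    catWord w w' = Fin.cons (w 0) (catWord (Fin.tail w) w') := rfl

variable {C : Type u} [Category.{v} C] [MonoidalCategory C] [SymmetricCategory C] (A : C)

/-- Two morphisms to tensor powers of `A` whose factors are labelled agree up to the permutation of
tensor factors which is prescribed by the labels. -/
def PermRel {X : C} {n n' : ℕ} (f : X ⟶ tensorPow A n) (w : Fin n → L)
    (f' : X ⟶ tensorPow A n') (w' : Fin n' → L) : Prop :=
  ∃ e : Fin n ≃ Fin n', w = w' ∘ e ∧ f ≫ tensorPerm A e = f'

/-- The bijection which fixes `0` and is given by `e` on the remaining elements. -/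
def consEquiv {m n : ℕ} (e : Fin m ≃ Fin n) : Fin (m + 1) ≃ Fin (n + 1) :=
  (finSuccEquiv m).trans ((Equiv.optionCongr e).trans (finSuccEquiv n).symm)

@[simp]
lemma consEquiv_zero {m n : ℕ} (e : Fin m ≃ Fin n) : consEquiv e 0 = 0 := by
  simp [consEquiv]

@[simp]
lemma consEquiv_succ {m n : ℕ} (e : Fin m ≃ Fin n) (i : Fin m) :
    consEquiv e i.succ = (e i).succ := by
  simp [consEquiv]

lemma tensorPerm_consEquiv {m n : ℕ} (e : Fin m ≃ Fin n) :
    tensorPerm A (consEquiv e) = A ◁ tensorPerm A e := by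
  have h : removeAt 0 (consEquiv e) = e := eq_removeAt fun i => by simp
  rw [tensorPerm_succ, h, consEquiv_zero, tensorInsert_zero, Category.comp_id]

namespace PermRel

variable {A} {X X' : C} {n n' n'' : ℕ} {f : X ⟶ tensorPow A n} {w : Fin n → L}
  {f' : X ⟶ tensorPow A n'} {w' : Fin n' → L} {f'' : X ⟶ tensorPow A n''} {w'' : Fin n'' → L}

lemma refl (f : X ⟶ tensorPow A n) (w : Fin n → L) : PermRel A f w f w :=
  ⟨Equiv.refl _, rfl, by rw [tensorPerm_refl, Category.comp_id]⟩

lemma of_eq {g : X ⟶ tensorPow A n} (h : f = g) : PermRel A f w g w := h ▸ refl _ _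

lemma symm (h : PermRel A f w f' w') : PermRel A f' w' f w := by
  obtain ⟨e, rfl, rfl⟩ := h
  refine ⟨e.symm, by ext; simp, ?_⟩
  rw [Category.assoc, ← tensorPerm_trans, Equiv.self_trans_symm, tensorPerm_refl, Category.comp_id]

lemma trans (h : PermRel A f w f' w') (h' : PermRel A f' w' f'' w'') : PermRel A f w f'' w'' := by
  obtain ⟨e, rfl, rfl⟩ := h
  obtain ⟨e', rfl, rfl⟩ := h'
  exact ⟨e.trans e', by ext; simp, by rw [tensorPerm_trans, Category.assoc]⟩

lemma precomp (h : PermRel A f w f' w') (g : X' ⟶ X) : PermRel A (g ≫ f) w (g ≫ f') w' := by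
  obtain ⟨e, rfl, rfl⟩ := h
  exact ⟨e, rfl, Category.assoc _ _ _⟩

lemma cons (h : PermRel A f w f' w') (a : L) :
    PermRel A (A ◁ f) (Fin.cons a w : Fin (n + 1) → L) (A ◁ f') (Fin.cons a w' : Fin (n' + 1) → L) := by
  obtain ⟨e, rfl, rfl⟩ := h
  refine ⟨consEquiv e, ?_, by rw [tensorPerm_consEquiv, MonoidalCategory.whiskerLeft_comp]⟩
  ext i
  induction i using Fin.cases <;> simp

lemma perm (e : Fin n ≃ Fin n') (w : Fin n' → L) :
    PermRel A (𝟙 _) (w ∘ e) (tensorPerm A e) w := ⟨e, rfl, Category.id_comp _⟩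

/-- The generating instance: the remaining rearrangements below are built from it by `cons`,
`precomp` and `trans`, so that no explicit index permutation is computed again. -/
lemma swap (a b : L) (w : Fin n → L) :
    PermRel A (𝟙 (A ⊗ A ⊗ tensorPow A n)) (Fin.cons a (Fin.cons b w) : Fin (n + 2) → L)
      (exch A A (tensorPow A n)) (Fin.cons b (Fin.cons a w) : Fin (n + 2) → L) := by
  refine ⟨Equiv.swap 0 1, ?_, ?_⟩
  · ext i
    induction i using Fin.cases with
    | zero => simp
    | succ i =>
      induction i using Fin.cases with
      | zero => simp
      | succ i =>
        have h : Equiv.swap (0 : Fin (n + 2)) 1 i.succ.succ = i.succ.succ :=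
          Equiv.swap_apply_of_ne_of_ne (Fin.succ_ne_zero _)
            fun h => Fin.succ_ne_zero i (Fin.succ_injective _ h)
        simp [h]
  · have h : removeAt 0 (Equiv.swap (0 : Fin (n + 2)) 1) = Equiv.refl _ := by
      apply eq_removeAt
      intro i
      rw [Equiv.swap_apply_left]
      induction i using Fin.cases with
      | zero =>
        simp only [Fin.zero_succAbove, Fin.succ_zero_eq_one, Equiv.swap_apply_right]
        rfl
      | succ i =>
        have h : Equiv.swap (0 : Fin (n + 2)) 1 i.succ.succ = i.succ.succ :=
          Equiv.swap_apply_of_ne_of_ne (Fin.succ_ne_zero _)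
            fun h => Fin.succ_ne_zero i (Fin.succ_injective _ h)
        rw [Fin.zero_succAbove, h]
        exact Fin.succ_succAbove_succ 0 i
    rw [tensorPerm_succ, h, tensorPerm_refl, Equiv.swap_apply_left]
    have h2 := tensorInsert_succ A n 0
    rw [tensorInsert_zero] at h2
    simpa using h2

lemma congr {g : X ⟶ tensorPow A n} {v : Fin n → L} {g' : X ⟶ tensorPow A n'} {v' : Fin n' → L}
    (h : PermRel A f w f' w') (hg : g = f) (hv : v = w) (hg' : g' = f') (hv' : v' = w') :
    PermRel A g v g' v' := by
  subst hg hv hg' hv'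
  exact h

/-- One letter passes a block by repeated `swap`; the hexagon `exch_tensor_right` assembles the
individual exchanges. -/
lemma past {k m : ℕ} (a : L) (v : Fin k → L) (w : Fin m → L) :
    PermRel A (A ◁ tensorPowJoin A m k) (Fin.cons a (catWord v w) : Fin (m + k + 1) → L)
      (exch A (tensorPow A k) (tensorPow A m) ≫ tensorPowJoin A (m + 1) k)
      (catWord v (Fin.cons a w : Fin (m + 1) → L)) := by
  induction k with
  | zero =>
    refine of_eq ?_
    simp [tensorPowJoin, exch_unit_middle]
  | succ k ih =>
    obtain ⟨b, v, rfl⟩ := Fin.exists_cons v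
    have h1 := (swap a b (catWord v w)).precomp (A ◁ tensorPowJoin A m (k + 1))
    have h2 := ((ih v).cons b).precomp
      (A ◁ (α_ A (tensorPow A k) (tensorPow A m)).hom ≫ exch A A (tensorPow A k ⊗ tensorPow A m))
    refine (h1.congr (by simp) (by simp) rfl rfl).trans (h2.congr ?_ rfl ?_ (by simp))
    · simp only [tensorPowJoin, MonoidalCategory.whiskerLeft_comp, Category.assoc]
      exact congrArg (_ ≫ ·) (exch_naturality_right A A (tensorPowJoin A m k))
    · simp only [tensorPowJoin, MonoidalCategory.whiskerLeft_comp, Category.assoc]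
      rw [comp_eq₂ (exch_tensor_right A A (tensorPow A k) (tensorPow A m))]
      simp

lemma whiskerLeft {k : ℕ} (h : PermRel A f w f' w') (v : Fin k → L) :
    PermRel A (tensorPow A k ◁ f ≫ tensorPowJoin A n k) (catWord v w)
      (tensorPow A k ◁ f' ≫ tensorPowJoin A n' k) (catWord v w') := by
  induction k with
  | zero =>
    exact (h.precomp (λ_ X).hom).congr (by simp [tensorPowJoin]) rfl (by simp [tensorPowJoin]) rfl
  | succ k ih =>
    obtain ⟨b, v, rfl⟩ := Fin.exists_cons v
    exact (((ih v).cons b).precomp (α_ A (tensorPow A k) X).hom).congr (by simp [tensorPowJoin])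
      (by simp) (by simp [tensorPowJoin]) (by simp)

lemma swapBlocks {k l m : ℕ} (v : Fin k → L) (v' : Fin l → L) (w : Fin m → L) :
    PermRel A (tensorPow A k ◁ tensorPowJoin A m l ≫ tensorPowJoin A (m + l) k)
      (catWord v (catWord v' w))
      (exch (tensorPow A k) (tensorPow A l) (tensorPow A m) ≫
        tensorPow A l ◁ tensorPowJoin A m k ≫ tensorPowJoin A (m + k) l)
      (catWord v' (catWord v w)) := by
  induction k with
  | zero =>
    refine of_eq ?_
    simp [tensorPowJoin, exch_unit_left, ← MonoidalCategory.whiskerLeft_comp_assoc]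
  | succ k ih =>
    obtain ⟨b, v, rfl⟩ := Fin.exists_cons v
    have h := ((ih v).cons b).precomp
      (α_ A (tensorPow A k) (tensorPow A l ⊗ tensorPow A m)).hom
    have h2 := (past (A := A) b v' (catWord v w)).precomp
      ((α_ A (tensorPow A k) (tensorPow A l ⊗ tensorPow A m)).hom ≫
        A ◁ (exch (tensorPow A k) (tensorPow A l) (tensorPow A m) ≫
          tensorPow A l ◁ tensorPowJoin A m k))
    refine (h.congr (by simp [tensorPowJoin]) (by simp) rfl rfl).trans
      (h2.congr (by simp) rfl ?_ (by simp))
    simp only [tensorPowJoin, MonoidalCategory.whiskerLeft_comp, Category.assoc]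
    rw [comp_eq₂ (exch_naturality_right _ _ _), Category.assoc,
      comp_eq₃ (exch_tensor_left _ _ _ _)]
    simp only [Category.assoc]
    rfl

lemma assoc {k l m : ℕ} (v : Fin k → L) (v' : Fin l → L) (w : Fin m → L) :
    PermRel A (tensorPowJoin A l k ▷ tensorPow A m ≫ tensorPowJoin A m (l + k))
      (catWord (catWord v v') w)
      ((α_ _ _ _).hom ≫ tensorPow A k ◁ tensorPowJoin A m l ≫ tensorPowJoin A (m + l) k)
      (catWord v (catWord v' w)) := by
  induction k with
  | zero =>
    refine of_eq ?_
    simp [tensorPowJoin]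
  | succ k ih =>
    obtain ⟨b, v, rfl⟩ := Fin.exists_cons v
    have h := ((ih v).cons b).precomp
      ((α_ A (tensorPow A k) (tensorPow A l)).hom ▷ _ ≫ (α_ A _ _).hom)
    refine h.congr ?_ ?_ ?_ (by simp)
    · simp [tensorPowJoin]
    · rw [catWord_cons]
      exact catWord_cons _ _ _
    · simp [tensorPowJoin]

lemma nil_right {k : ℕ} (v : Fin k → L) (w : Fin 0 → L) :
    PermRel A (tensorPowJoin A 0 k) (catWord v w) (ρ_ _).hom v := by
  induction k with
  | zero =>
    exact (refl (A := A) (tensorPowJoin A 0 0) (catWord v w)).congr rfl rfl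
      (by simp [tensorPowJoin, unitors_equal]) (Subsingleton.elim (α := Fin 0 → L) _ _)
  | succ k ih =>
    obtain ⟨b, v, rfl⟩ := Fin.exists_cons v
    exact (((ih v).cons b).precomp (α_ A (tensorPow A k) (𝟙_ C)).hom).congr rfl (by simp)
      (by simp) rfl

/-- The case of `swapBlocks` with an empty third block, after the unit factor has been removed by
`nil_right`. -/
lemma swapTwo {k m : ℕ} (v : Fin k → L) (w : Fin m → L) :
    PermRel A (tensorPowJoin A m k) (catWord v w) ((β_ _ _).hom ≫ tensorPowJoin A k m)
      (catWord w v) := by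
  let z : Fin 0 → L := Fin.elim0
  have h1 := (((nil_right (A := A) w z).whiskerLeft v).precomp
    (tensorPow A k ◁ (ρ_ (tensorPow A m)).inv)).symm
  have h2 := (swapBlocks (A := A) v w z).precomp (tensorPow A k ◁ (ρ_ (tensorPow A m)).inv)
  have h3 := ((nil_right (A := A) v z).whiskerLeft w).precomp
    (tensorPow A k ◁ (ρ_ (tensorPow A m)).inv ≫ exch _ _ (𝟙_ C))
  refine (h1.congr ?_ rfl rfl rfl).trans (h2.trans (h3.congr ?_ rfl ?_ rfl))
  · simp
  · simp
  · simp [exch_unit_right]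

/-- Conjugate `whiskerLeft` by the block exchange. -/
lemma whiskerRight {k : ℕ} (h : PermRel A f w f' w') (v : Fin k → L) :
    PermRel A (f ▷ tensorPow A k ≫ tensorPowJoin A k n) (catWord w v)
      (f' ▷ tensorPow A k ≫ tensorPowJoin A k n') (catWord w' v) := by
  have h1 := (swapTwo (A := A) w v).precomp (f ▷ tensorPow A k)
  have h2 := (swapTwo (A := A) w' v).precomp (f' ▷ tensorPow A k)
  have h3 := (h.whiskerLeft v).precomp (β_ X _).hom
  refine (h1.trans ?_).trans h2.symm
  exact h3.congr (by simp) rfl (by simp) rfl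

end PermRel

end Words

/-! ### Symmetric families and contractions by copairings -/

section Families

set_option linter.unusedSectionVars false

variable {C : Type u} [Category.{v} C] [MonoidalCategory C] [SymmetricCategory C]

/-- A family of morphisms from tensor powers of `A`, whose factors are labelled by elements of `L`,
with a parameter object `Z`. -/
abbrev TensorFamily (A : C) (L : Type w) (Z Y : C) : Type (max v w) :=
  ∀ n : ℕ, (Fin n → L) → (Z ⊗ tensorPow A n ⟶ Y)

namespace TensorFamily

variable {A : C} {L : Type w} {Z Z' Y : C}

/-- The members of a symmetric family differ by the permutation of tensor factors which is
prescribed by the labels. -/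
def IsSymm (F : TensorFamily A L Z Y) : Prop :=
  ∀ (n n' : ℕ) (e : Fin n ≃ Fin n') (w : Fin n' → L), Z ◁ tensorPerm A e ≫ F n' w = F n (w ∘ e)

/-- Move a factor with the label `a` to the parameter object. -/
def shift (F : TensorFamily A L Z Y) (a : L) : TensorFamily A L (Z ⊗ A) Y := fun n w =>
  (α_ Z A (tensorPow A n)).hom ≫ F (n + 1) (Fin.cons a w : Fin (n + 1) → L)

/-- Move a block of factors to the parameter object. -/
def shiftBlock (F : TensorFamily A L Z Y) {k : ℕ} (v : Fin k → L) :
    TensorFamily A L (Z ⊗ tensorPow A k) Y := fun n w =>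
  (α_ Z (tensorPow A k) (tensorPow A n)).hom ≫ Z ◁ tensorPowJoin A n k ≫ F (n + k) (catWord v w)

/-- Change the parameter object. -/
def comap (f : Z' ⟶ Z) (F : TensorFamily A L Z Y) : TensorFamily A L Z' Y := fun n w =>
  f ▷ tensorPow A n ≫ F n w

variable (A) in
/-- The insertion of a copairing in front of a tensor power. -/
def cupFront (c : 𝟙_ C ⟶ A ⊗ A) (W : C) : W ⟶ A ⊗ (A ⊗ W) :=
  (λ_ W).inv ≫ c ▷ W ≫ (α_ A A W).hom

/-- Contract the factors with the labels `a` and `b` by means of a copairing. -/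
def contract (c : 𝟙_ C ⟶ A ⊗ A) (a b : L) (F : TensorFamily A L Z Y) : TensorFamily A L Z Y :=
  fun n w => Z ◁ cupFront A c (tensorPow A n) ≫
    F (n + 2) (Fin.cons a (Fin.cons b w : Fin (n + 1) → L) : Fin (n + 2) → L)

lemma cupFront_naturality (c : 𝟙_ C ⟶ A ⊗ A) {W W' : C} (f : W ⟶ W') :
    f ≫ cupFront A c W' = cupFront A c W ≫ A ◁ A ◁ f := by
  simp only [cupFront, Category.assoc]
  rw [leftUnitor_inv_naturality_assoc, whisker_exchange_assoc, associator_naturality_right]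

/-- A copairing starts at the unit, so both of its legs can be pulled past `X` to the front. -/
lemma whiskerLeft_cupFront (c : 𝟙_ C ⟶ A ⊗ A) (X W : C) :
    X ◁ cupFront A c W ≫ exch X A (A ⊗ W) ≫ A ◁ exch X A W = cupFront A c (X ⊗ W) := by
  rw [exch_tensor_right]
  have h := exch_naturality_middle X c W
  simp only [cupFront, MonoidalCategory.whiskerLeft_comp, Category.assoc,
    whiskerLeft_hom_inv_assoc]
  rw [comp_eq₂ h, exch_unit_middle]
  simp

lemma cupFront_braiding (c : 𝟙_ C ⟶ A ⊗ A) (W : C) :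
    cupFront A c W ≫ exch A A W = cupFront A (c ≫ (β_ A A).hom) W := by
  simp [cupFront, exch]

namespace IsSymm

variable {F : TensorFamily A L Z Y}

/-- The way in which symmetry is used: a label-respecting rearrangement does not change the value of
the family. -/
lemma eq (hF : F.IsSymm) {X : C} {n n' : ℕ} {f : X ⟶ tensorPow A n} {w : Fin n → L}
    {f' : X ⟶ tensorPow A n'} {w' : Fin n' → L} (h : PermRel A f w f' w') :
    Z ◁ f ≫ F n w = Z ◁ f' ≫ F n' w' := by
  obtain ⟨e, rfl, rfl⟩ := h
  rw [← hF, MonoidalCategory.whiskerLeft_comp, Category.assoc]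

protected lemma shift (hF : F.IsSymm) (a : L) : (F.shift a).IsSymm := by
  intro n n' e w
  have h := hF.eq (((PermRel.perm (A := A) e w).cons a))
  simp only [MonoidalCategory.whiskerLeft_id, Category.id_comp] at h
  simp [shift, h]

protected lemma shiftBlock (hF : F.IsSymm) {k : ℕ} (v : Fin k → L) : (F.shiftBlock v).IsSymm := by
  intro n n' e w
  have h := hF.eq (((PermRel.perm (A := A) e w).whiskerLeft v))
  simp only [MonoidalCategory.whiskerLeft_id, Category.id_comp,
    MonoidalCategory.whiskerLeft_comp, Category.assoc] at h
  simp [shiftBlock, h]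

protected lemma contract (hF : F.IsSymm) (c : 𝟙_ C ⟶ A ⊗ A) (a b : L) :
    (contract c a b F).IsSymm := by
  intro n n' e w
  have h := hF.eq (((PermRel.perm (A := A) e w).cons b).cons a)
  simp only [MonoidalCategory.whiskerLeft_id, Category.id_comp] at h
  simp only [contract, ← MonoidalCategory.whiskerLeft_comp_assoc, cupFront_naturality]
  rw [MonoidalCategory.whiskerLeft_comp_assoc, h]

lemma contract_comm (hF : F.IsSymm) (c : 𝟙_ C ⟶ A ⊗ A) (a b : L) :
    contract c a b F = contract (c ≫ (β_ A A).hom) b a F := by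
  funext n w
  have h := hF.eq ((PermRel.swap (A := A) a b w).precomp (cupFront A c (tensorPow A n)))
  simp only [Category.comp_id, cupFront_braiding] at h
  exact h

/-- The factor `x` can be parked in the parameter object before or after the contraction: symmetry
moves it past both legs, and `whiskerLeft_cupFront` moves the copairing past it. -/
lemma contract_shift (hF : F.IsSymm) (c : 𝟙_ C ⟶ A ⊗ A) (a b x : L) :
    contract c a b (F.shift x) = (contract c a b F).shift x := by
  funext n w
  have h1 := (PermRel.swap (A := A) x a (Fin.cons b w : Fin (n + 1) → L)).precomp
    (A ◁ cupFront A c (tensorPow A n))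
  have h2 := ((PermRel.swap (A := A) x b w).cons a).precomp
    (A ◁ cupFront A c (tensorPow A n) ≫ exch A A _)
  have h3 := hF.eq ((h1.congr (Category.comp_id _).symm rfl rfl rfl).trans (h2.congr (by simp) rfl rfl rfl))
  simp only [Category.assoc, whiskerLeft_cupFront] at h3
  simp only [contract, shift, tensor_whiskerLeft, Category.assoc, Iso.inv_hom_id_assoc]
  rw [h3]

lemma shiftBlock_cons (F : TensorFamily A L Z Y) {k : ℕ} (a : L) (v : Fin k → L) :
    F.shiftBlock (Fin.cons a v : Fin (k + 1) → L) =
      comap (α_ Z A (tensorPow A k)).inv ((F.shift a).shiftBlock v) := by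
  funext n w
  simp only [shiftBlock, comap, shift, tensorPowJoin, catWord_cons]
  simp
  rfl

lemma shiftBlock_zero (F : TensorFamily A L Z Y) (v : Fin 0 → L) :
    F.shiftBlock v = comap (ρ_ Z).hom F := by
  funext n w
  simp [shiftBlock, comap, tensorPowJoin]

lemma contract_comap (F : TensorFamily A L Z Y) (f : Z' ⟶ Z) (c : 𝟙_ C ⟶ A ⊗ A) (a b : L) :
    contract c a b (comap f F) = comap f (contract c a b F) := by
  funext n w
  simp only [contract, comap]
  rw [whisker_exchange_assoc]

lemma contract_shiftBlock (hF : F.IsSymm) (c : 𝟙_ C ⟶ A ⊗ A) (a b : L) {k : ℕ} (v : Fin k → L) :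
    contract c a b (F.shiftBlock v) = (contract c a b F).shiftBlock v := by
  induction k generalizing Z with
  | zero => rw [shiftBlock_zero, shiftBlock_zero, contract_comap]
  | succ k ih =>
    obtain ⟨x, v, rfl⟩ := Fin.exists_cons v
    rw [shiftBlock_cons, shiftBlock_cons, contract_comap, ih (hF.shift x), hF.contract_shift]

/-- A contraction along `a`, `b` is two shifts followed by inserting the copairing, so the
commutation follows from two applications of `contract_shift`. -/
lemma contract_contract (hF : F.IsSymm) (c c' : 𝟙_ C ⟶ A ⊗ A) (a b a' b' : L) :
    contract c a b (contract c' a' b' F) = contract c' a' b' (contract c a b F) := by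
  funext n w
  have h := congrFun (congrFun ((hF.shift a).contract_shift c' a' b' b) n) w
  rw [hF.contract_shift] at h
  have h2 := congrArg (fun f => Z ◁ cupFront A c (tensorPow A n) ≫ (α_ _ _ _).inv ≫
    (α_ _ _ _).inv ≫ f) h
  simp only [shift, contract, tensor_whiskerLeft, Category.assoc, Iso.inv_hom_id_assoc] at h2
  simp only [contract]
  rw [← h2, ← MonoidalCategory.whiskerLeft_comp_assoc, ← MonoidalCategory.whiskerLeft_comp_assoc,
    cupFront_naturality]

end IsSymm

end TensorFamily

end Families

/-! ### Copairings, pairing and the Nakayama automorphism -/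

section FrobeniusAlgebra

set_option linter.unusedSectionVars false

open TensorFamily

variable {C : Type u} [Category.{v} C] [MonoidalCategory C] [SymmetricCategory C]
  (A : C) [MonObj A] [ComonObj A] [IsFrobeniusObj A]

lemma frobCopairing_neg_one : frobCopairing A (-1) = η[A] ≫ Δ[A] := by
  simp [frobCopairing]

lemma frobCopairing_one : frobCopairing A 1 = frobCopairing A (-1) ≫ (β_ A A).hom := by
  rw [frobCopairing, frobCopairing, if_neg (by decide), if_pos rfl, Category.assoc]

lemma frobCopairing_braiding (s : ℤˣ) :
    frobCopairing A s ≫ (β_ A A).hom = frobCopairing A (-s) := by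
  rcases Int.units_eq_one_or s with rfl | rfl
  · rw [frobCopairing_one, Category.assoc, SymmetricCategory.symmetry, Category.comp_id]
  · rw [neg_neg, frobCopairing_one]

/-- Left linearity of Δ evaluated at the unit: Δ(x) = x·Δ(1). The next lemma is the right-handed
version Δ(x) = Δ(1)·x. -/
lemma comul_eq_left : (ρ_ A).inv ≫ A ◁ frobCopairing A (-1) ≫ (α_ A A A).inv ≫ μ[A] ▷ A = Δ[A] := by
  rw [frobCopairing_neg_one, MonoidalCategory.whiskerLeft_comp, Category.assoc,
    IsFrobeniusObj.left_linear, MonObj.mul_one_assoc, Iso.inv_hom_id_assoc]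

lemma comul_eq_right : (λ_ A).inv ≫ frobCopairing A (-1) ▷ A ≫ (α_ A A A).hom ≫ A ◁ μ[A] = Δ[A] := by
  rw [frobCopairing_neg_one, comp_whiskerRight, Category.assoc,
    IsFrobeniusObj.right_linear, MonObj.one_mul_assoc, Iso.inv_hom_id_assoc]

/-- Apply the counit to the first factor of Δ(x) = x·Δ(1). -/
lemma snake_left :
    (ρ_ A).inv ≫ A ◁ frobCopairing A (-1) ≫ (α_ A A A).inv ≫ frobPairing A ▷ A ≫ (λ_ A).hom =
      𝟙 A := by
  have h := comul_eq_left A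
  have h2 := congrArg (fun f => f ≫ ε[A] ▷ A ≫ (λ_ A).hom) h
  simpa [frobPairing] using h2

lemma snake_right : cupFront A (frobCopairing A (-1)) A ≫ A ◁ frobPairing A ≫ (ρ_ A).hom = 𝟙 A := by
  have h := comul_eq_right A
  have h2 := congrArg (fun f => f ≫ A ◁ ε[A] ≫ (ρ_ A).hom) h
  simpa [frobPairing, cupFront] using h2

lemma braiding_comp_braiding (X Y Z : C) :
    (β_ X (Y ⊗ Z)).hom ≫ (β_ Y Z).hom ▷ X ≫ (α_ Z Y X).hom ≫ Z ◁ (β_ Y X).hom =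
      (α_ X Y Z).inv ≫ (β_ (X ⊗ Y) Z).hom := by
  rw [← BraidedCategory.braiding_naturality_right_assoc]
  simp [← MonoidalCategory.whiskerLeft_comp]

lemma unit_braiding {X Y : C} (c : 𝟙_ C ⟶ Y) :
    (λ_ X).inv ≫ c ▷ X = (ρ_ X).inv ≫ X ◁ c ≫ (β_ X Y).hom := by
  rw [BraidedCategory.braiding_naturality_right, braiding_tensorUnit_right]
  simp

lemma snake_right_braided :
    cupFront A (frobCopairing A 1) A ≫ A ◁ ((β_ A A).hom ≫ frobPairing A) ≫ (ρ_ A).hom = 𝟙 A := by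
  rw [frobCopairing_one, cupFront, comp_whiskerRight, ← snake_left A]
  simp only [Category.assoc, MonoidalCategory.whiskerLeft_comp]
  rw [comp_eq₂ (unit_braiding _)]
  simp only [Category.assoc]
  have h3 := congrArg (fun f => f ≫ A ◁ frobPairing A ≫ (ρ_ A).hom) (braiding_comp_braiding A A A)
  simp only [Category.assoc] at h3
  rw [h3, ← BraidedCategory.braiding_naturality_left_assoc, braiding_tensorUnit_left]
  simp

/-- This is b(y, N x) = b(x, y). By definition N x = Σ b(x, c') c'' for c_{+1} = Σ c' ⊗ c''; pairing
with y and applying `snake_right_braided` to the second leg leaves b(x, y). -/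
lemma nakayama_whiskerRight_pairing :
    nakayama A ▷ A ≫ (β_ A A).hom ≫ frobPairing A = frobPairing A := by
  have h := congrArg (fun f => A ◁ f ≫ frobPairing A) (snake_right_braided A)
  simp only [MonoidalCategory.whiskerLeft_id, Category.id_comp] at h
  conv_rhs => rw [← h]
  have e := whisker_exchange (frobPairing A) ((β_ A A).hom ≫ frobPairing A)
  have h2 : nakayama A = (ρ_ A).inv ≫ A ◁ frobCopairing A 1 ≫ (α_ A A A).inv ≫
      frobPairing A ▷ A ≫ (λ_ A).hom := by
    rw [nakayama, frobCopairing_one, MonoidalCategory.whiskerLeft_comp, Category.assoc]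
  rw [h2]
  generalize frobPairing A = b at *
  generalize (β_ A A).hom ≫ b = b' at *
  generalize frobCopairing A 1 = c at *
  calc _ = ((ρ_ A).inv ≫ A ◁ c ≫ (α_ A A A).inv) ▷ A ≫ (α_ _ _ _).hom ≫
        (b ▷ (A ⊗ A) ≫ (𝟙_ C) ◁ b') ≫ (λ_ _).hom := by monoidal
    _ = ((ρ_ A).inv ≫ A ◁ c ≫ (α_ A A A).inv) ▷ A ≫ (α_ _ _ _).hom ≫
        ((A ⊗ A) ◁ b' ≫ b ▷ (𝟙_ C)) ≫ (λ_ _).hom := by rw [e]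
    _ = _ := by rw [cupFront]; monoidal

/-- The Nakayama automorphism measures the failure of the pairing to be symmetric. -/
lemma braiding_nakayama_pairing :
    (β_ A A).hom ≫ A ◁ nakayama A ≫ frobPairing A = frobPairing A := by
  rw [← BraidedCategory.braiding_naturality_left_assoc, nakayama_whiskerRight_pairing]

/-- A morphism to `A` is determined by its pairings. -/
lemma eq_of_pairing {X : C} {f g : X ⟶ A} (h : A ◁ f ≫ frobPairing A = A ◁ g ≫ frobPairing A) :
    f = g := by
  have key : ∀ f : X ⟶ A, f = cupFront A (frobCopairing A (-1)) X ≫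
      A ◁ (A ◁ f ≫ frobPairing A) ≫ (ρ_ A).hom := by
    intro f
    have h1 := snake_right A
    have h2 := cupFront_naturality (frobCopairing A (-1)) f
    rw [MonoidalCategory.whiskerLeft_comp, Category.assoc, comp_eq₂ h2.symm, Category.assoc, h1,
      Category.comp_id]
  rw [key f, key g, h]

/-- The pairing of a product of two morphisms to `A`, cyclically rotated. -/
lemma tensorHom_pairing {X Y : C} (f : X ⟶ A) (g : Y ⟶ A) :
    (f ⊗ₘ g) ≫ frobPairing A = (β_ X Y).hom ≫ (g ⊗ₘ f ≫ nakayama A) ≫ frobPairing A := by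
  conv_lhs => rw [← braiding_nakayama_pairing]
  rw [BraidedCategory.braiding_naturality_assoc, ← id_tensorHom, tensorHom_comp_tensorHom_assoc,
    Category.comp_id]

lemma tensorHom_nakayama_pairing {X Y : C} (f : X ⟶ A) (g : Y ⟶ A) :
    (f ⊗ₘ g ≫ nakayama A) ≫ frobPairing A = (β_ X Y).hom ≫ (g ⊗ₘ f) ≫ frobPairing A := by
  rw [tensorHom_pairing A g f, SymmetricCategory.symmetry_assoc]

lemma mul_pairing : μ[A] ▷ A ≫ frobPairing A = (α_ A A A).hom ≫ A ◁ μ[A] ≫ frobPairing A := by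
  simp [frobPairing]

lemma one_pairing : η[A] ▷ A ≫ frobPairing A = (λ_ A).hom ≫ ε[A] := by
  simp [frobPairing]

lemma pairing_one : A ◁ η[A] ≫ frobPairing A = (ρ_ A).hom ≫ ε[A] := by
  simp [frobPairing]

/-- ε(x) = b(x, 1) = b(1, N x) = ε(N x). -/
lemma nakayama_counit : nakayama A ≫ ε[A] = ε[A] := by
  have h := tensorHom_pairing A (𝟙 A) η[A]
  have h2 := congrArg (fun f => (ρ_ A).inv ≫ f) h
  simp only [id_tensorHom, Category.id_comp, pairing_one, braiding_tensorUnit_right,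
    Iso.inv_hom_id_assoc] at h2
  simp only [tensorHom_def', Category.assoc, one_pairing] at h2
  simpa using h2.symm

/-- Two cyclic rotations of three factors make one rotation in the other direction; the comparison
comes down to the Yang–Baxter equation. -/
lemma rotate_twice (X Y Z : C) :
    (α_ X Y Z).inv ≫ (β_ (X ⊗ Y) Z).hom ≫ (α_ Z X Y).inv ≫ (β_ (Z ⊗ X) Y).hom =
      (β_ X (Y ⊗ Z)).hom ≫ (α_ Y Z X).hom := by
  have h := congrArg (fun f => f ≫ (α_ Z Y X).inv ≫ (β_ Z Y).hom ▷ X ≫ (α_ Y Z X).hom)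
    (BraidedCategory.yang_baxter X Y Z)
  simp only [Category.assoc, Iso.hom_inv_id_assoc, ← comp_whiskerRight_assoc,
    SymmetricCategory.symmetry, id_whiskerRight, Category.id_comp, Iso.inv_hom_id,
    Category.comp_id] at h
  simp only [BraidedCategory.braiding_tensor_left_hom, BraidedCategory.braiding_tensor_right_hom,
    Category.assoc, Iso.inv_hom_id_assoc, Iso.inv_hom_id, Category.comp_id]
  exact h.symm

lemma whiskerLeft_mul_pairing {W X Y : C} (e : W ⟶ A) (f : X ⟶ A) (g : Y ⟶ A) :
    (e ⊗ₘ ((f ⊗ₘ g) ≫ μ[A])) ≫ frobPairing A =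
      (α_ W X Y).inv ≫ (((e ⊗ₘ f) ≫ μ[A]) ⊗ₘ g) ≫ frobPairing A := by
  have h := mul_pairing A
  rw [← cancel_epi (α_ A A A).inv, Iso.inv_hom_id_assoc] at h
  have h1 : (e ⊗ₘ ((f ⊗ₘ g) ≫ μ[A])) = (e ⊗ₘ (f ⊗ₘ g)) ≫ A ◁ μ[A] := by
    rw [← id_tensorHom, tensorHom_comp_tensorHom, Category.comp_id]
  have h2 : (((e ⊗ₘ f) ≫ μ[A]) ⊗ₘ g) = ((e ⊗ₘ f) ⊗ₘ g) ≫ μ[A] ▷ A := by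
    rw [← tensorHom_id, tensorHom_comp_tensorHom, Category.comp_id]
  rw [h1, h2, Category.assoc, Category.assoc, ← h, associator_inv_naturality_assoc]

/-- By nondegeneracy it suffices to pair with x: both b(x, N(yz)) and b(x, N(y)N(z)) equal ε(yzx),
the first after one cyclic rotation and the second after two. -/
lemma mul_nakayama : μ[A] ≫ nakayama A = (nakayama A ⊗ₘ nakayama A) ≫ μ[A] := by
  apply eq_of_pairing
  have h1 := tensorHom_nakayama_pairing A (𝟙 A) μ[A]
  have h2 := whiskerLeft_mul_pairing A (𝟙 A) (nakayama A) (𝟙 A ≫ nakayama A)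
  rw [tensorHom_nakayama_pairing, Category.id_comp] at h2
  have h3 := whiskerLeft_mul_pairing A (𝟙 A) (𝟙 A) (𝟙 A ≫ nakayama A)
  rw [tensorHom_nakayama_pairing, Category.id_comp] at h3
  rw [← id_tensorHom, ← id_tensorHom, h1, h2, h3]
  have h4 := whiskerLeft_mul_pairing A (𝟙 A) (𝟙 A) (𝟙 A)
  have h5 := congrArg (fun f => f ≫ (α_ A A A).inv ≫ μ[A] ▷ A ≫ frobPairing A)
    (rotate_twice A A A)
  simp only [Category.assoc, Iso.hom_inv_id_assoc] at h5
  simp only [tensorHom_id, id_tensorHom, id_whiskerRight, Category.id_comp] at h4 ⊢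
  rw [h4, h5]

lemma tensorHom_mul_assoc {W X Y : C} (e : W ⟶ A) (f : X ⟶ A) (g : Y ⟶ A) :
    (e ⊗ₘ ((f ⊗ₘ g) ≫ μ[A])) ≫ μ[A] = (α_ W X Y).inv ≫ (((e ⊗ₘ f) ≫ μ[A]) ⊗ₘ g) ≫ μ[A] := by
  have h1 : (e ⊗ₘ ((f ⊗ₘ g) ≫ μ[A])) = (e ⊗ₘ (f ⊗ₘ g)) ≫ A ◁ μ[A] := by
    rw [← id_tensorHom, tensorHom_comp_tensorHom, Category.comp_id]
  have h2 : (((e ⊗ₘ f) ≫ μ[A]) ⊗ₘ g) = ((e ⊗ₘ f) ⊗ₘ g) ≫ μ[A] ▷ A := by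
    rw [← tensorHom_id, tensorHom_comp_tensorHom, Category.comp_id]
  rw [h1, h2, Category.assoc, Category.assoc, MonObj.mul_assoc, associator_naturality_assoc,
    Iso.inv_hom_id_assoc]

/-- The power of the Nakayama automorphism with the given sign. -/
def nakayamaSign (s : ℤˣ) : A ⟶ A := if s = -1 then nakayama A else 𝟙 A

@[simp]
lemma nakayamaSign_one : nakayamaSign A 1 = 𝟙 A := if_neg (by decide)

@[simp]
lemma nakayamaSign_neg_one : nakayamaSign A (-1) = nakayama A := if_pos rfl

lemma mul_nakayamaSign (s : ℤˣ) :
    μ[A] ≫ nakayamaSign A s = (nakayamaSign A s ⊗ₘ nakayamaSign A s) ≫ μ[A] := by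
  rcases Int.units_eq_one_or s with rfl | rfl
  · simp
  · simp [mul_nakayama]

lemma nakayamaSign_counit (s : ℤˣ) : nakayamaSign A s ≫ ε[A] = ε[A] := by
  rcases Int.units_eq_one_or s with rfl | rfl
  · simp
  · simp [nakayama_counit]

variable {A}

lemma nakayamaSign_comp (hN : nakayama A ≫ nakayama A = 𝟙 A) (s t : ℤˣ) :
    nakayamaSign A s ≫ nakayamaSign A t = nakayamaSign A (s * t) := by
  rcases Int.units_eq_one_or s with rfl | rfl <;> rcases Int.units_eq_one_or t with rfl | rfl <;>
    simp [hN]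

lemma whiskerLeft_nakayama_braided_pairing (hN : nakayama A ≫ nakayama A = 𝟙 A) :
    A ◁ nakayama A ≫ (β_ A A).hom ≫ frobPairing A = frobPairing A := by
  have h := congrArg (fun f => A ◁ nakayama A ≫ (β_ A A).hom ≫ f) (braiding_nakayama_pairing A)
  rw [← h, SymmetricCategory.symmetry_assoc, ← MonoidalCategory.whiskerLeft_comp_assoc, hN]
  simp

/-- The zigzag of a copairing and the pairing. -/
lemma snake_sign (hN : nakayama A ≫ nakayama A = 𝟙 A) (s : ℤˣ) :
    cupFront A (frobCopairing A s) A ≫ A ◁ frobPairing A ≫ (ρ_ A).hom = nakayamaSign A (-s) := by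
  rcases Int.units_eq_one_or s with rfl | rfl
  -- Replacing b(x, y) by b(N y, x) turns the zigzag of c_{+1} into the braided one, which is
  -- trivial, at the price of one N.
  · have h := cupFront_naturality (frobCopairing A 1) (nakayama A)
    rw [← whiskerLeft_nakayama_braided_pairing hN, MonoidalCategory.whiskerLeft_comp,
      Category.assoc, comp_eq₂ h.symm, Category.assoc, snake_right_braided]
    simp
  · rw [snake_right]
    simp

/-- Nondegeneracy: expanding the second leg of `c` by the zigzag recovers `c` from its endomorphism
x ↦ Σ c' b(c'', x). Used to obtain c_{+1} = (N ⊗ id) c_{-1}. -/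
lemma copairing_eq (c : 𝟙_ C ⟶ A ⊗ A) : c = frobCopairing A (-1) ≫
    (cupFront A c A ≫ A ◁ frobPairing A ≫ (ρ_ A).hom) ▷ A := by
  have h := congrArg (fun f => c ≫ A ◁ f) (snake_left A)
  simp only [MonoidalCategory.whiskerLeft_id, Category.comp_id] at h
  conv_lhs => rw [← h]
  generalize frobPairing A = b at *
  generalize frobCopairing A (-1) = d at *
  have e := whisker_exchange c d
  calc _ = (ρ_ _).inv ≫ (c ▷ 𝟙_ C ≫ (A ⊗ A) ◁ d) ≫ (α_ A A _).hom ≫ A ◁ (α_ A A A).inv ≫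
          A ◁ (b ▷ A ≫ (λ_ A).hom) := by monoidal
    _ = (ρ_ _).inv ≫ (𝟙_ C ◁ d ≫ c ▷ (A ⊗ A)) ≫ (α_ A A _).hom ≫ A ◁ (α_ A A A).inv ≫
          A ◁ (b ▷ A ≫ (λ_ A).hom) := by rw [e]
    _ = _ := by rw [cupFront]; monoidal

lemma frobCopairing_one_eq (hN : nakayama A ≫ nakayama A = 𝟙 A) :
    frobCopairing A 1 = frobCopairing A (-1) ≫ nakayama A ▷ A := by
  have h := copairing_eq (frobCopairing A 1)
  rw [snake_sign hN, nakayamaSign_neg_one] at h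
  exact h

lemma cupFront_one_eq (hN : nakayama A ≫ nakayama A = 𝟙 A) (W : C) :
    cupFront A (frobCopairing A 1) W =
      cupFront A (frobCopairing A (-1)) W ≫ nakayama A ▷ (A ⊗ W) := by
  rw [frobCopairing_one_eq hN]
  simp [cupFront]

/-- The source of all vanishing. The condition means k = -s, and in both cases the composite is μ(id
⊗ N)Δ(1), using c_{+1} = (N ⊗ id)c_{-1} and N² = id. As N is an involutive algebra morphism, this is
N applied to (N * id)(1). -/
lemma copairing_mul_eq_zero [Preadditive C] [MonoidalPreadditive C]
    (hN : nakayama A ≫ nakayama A = 𝟙 A) (hconv : frobConv A (nakayama A) (𝟙 A) = 0)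
    {k s : ℤˣ} (h : k * -s = 1) :
    frobCopairing A s ≫ (nakayamaSign A k ⊗ₘ nakayama A) ≫ μ[A] = 0 := by
  have h0 : frobCopairing A (-1) ≫ (𝟙 A ⊗ₘ nakayama A) ≫ μ[A] = 0 := by
    have h1 := congrArg (fun f => η[A] ≫ f ≫ nakayama A) hconv
    simp only [frobConv, Category.assoc, mul_nakayama, Limits.zero_comp, Limits.comp_zero,
      tensorHom_comp_tensorHom_assoc, hN, Category.id_comp] at h1
    rw [frobCopairing_neg_one, Category.assoc, h1]
  rcases Int.units_eq_one_or s with rfl | rfl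
  · have hk : k = -1 := neg_eq_iff_eq_neg.1 (by simpa using h)
    subst hk
    rw [frobCopairing_one_eq hN, Category.assoc, ← tensorHom_id, tensorHom_comp_tensorHom_assoc,
      nakayamaSign_neg_one, hN, Category.id_comp, h0]
  · have hk : k = 1 := by simpa using h
    subst hk
    rw [nakayamaSign_one, h0]

end FrobeniusAlgebra

/-! ### Images of the projectors commute up to the Nakayama automorphism -/

section Twisted

set_option linter.unusedSectionVars false

open TensorFamily

variable {C : Type u} [Category.{v} C] [MonoidalCategory C] [SymmetricCategory C]
  {A : C} [MonObj A] [ComonObj A] [IsFrobeniusObj A]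

/-- For c_{+1} = Σ c' ⊗ c'' this is Σ c' ⊗ x c'' = Σ c' x ⊗ c'': the braiding of Δ(1)·x = x·Δ(1). -/
lemma copairing_mul_second :
    cupFront A (frobCopairing A 1) A ≫ A ◁ ((β_ A A).hom ≫ μ[A]) =
      cupFront A (frobCopairing A 1) A ≫ A ◁ (β_ A A).hom ≫ (α_ A A A).inv ≫ μ[A] ▷ A := by
  have h := congrArg (fun f => f ≫ (β_ A A).hom) ((comul_eq_left A).trans (comul_eq_right A).symm)
  have e1 : cupFront A (frobCopairing A 1) A =
      (ρ_ A).inv ≫ A ◁ frobCopairing A (-1) ≫ (α_ A A A).inv ≫ (β_ (A ⊗ A) A).hom ≫ A ◁ (β_ A A).hom := by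
    have h2 := congrArg (fun f => f ≫ A ◁ (β_ A A).hom) (braiding_comp_braiding A A A)
    simp only [Category.assoc, ← MonoidalCategory.whiskerLeft_comp, SymmetricCategory.symmetry,
      MonoidalCategory.whiskerLeft_id, Category.comp_id] at h2
    rw [← h2, comp_eq₃ (unit_braiding _).symm, cupFront, frobCopairing_one]
    simp
  have e2 : cupFront A (frobCopairing A 1) A ≫ A ◁ (β_ A A).hom ≫ (α_ A A A).inv =
      (λ_ A).inv ≫ frobCopairing A (-1) ▷ A ≫ (α_ A A A).hom ≫ (β_ A (A ⊗ A)).hom := by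
    rw [cupFront, frobCopairing_one]
    simp
  simp only [Category.assoc, BraidedCategory.braiding_naturality_left,
    BraidedCategory.braiding_naturality_right] at h
  rw [comp_eq₃ e2]
  simp only [Category.assoc]
  rw [← h, e1]
  simp only [Category.assoc, ← MonoidalCategory.whiskerLeft_comp,
    SymmetricCategory.symmetry_assoc]

/-- Multiplying the first factor of the copairing from the right amounts to multiplying the second
one from the left. -/
lemma copairing_mul_first (hN : nakayama A ≫ nakayama A = 𝟙 A) :
    cupFront A (frobCopairing A (-1)) A ≫ A ◁ (β_ A A).hom ≫ (α_ A A A).inv ≫ μ[A] ▷ A =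
      cupFront A (frobCopairing A (-1)) A ≫ A ◁ ((β_ A A).hom ≫ nakayama A ▷ A ≫ μ[A]) := by
  -- Passing from c_{+1} to c_{-1} = (N ⊗ id) c_{+1}: evaluate at N(x) and apply N to the first leg,
  -- which converts multiplication by N(x) there into multiplication by x.
  have h := congrArg (fun f => nakayama A ≫ f ≫ nakayama A ▷ A) (copairing_mul_second (A := A))
  have e := cupFront_naturality (frobCopairing A 1) (nakayama A)
  simp only [Category.assoc] at h
  rw [comp_eq₂ e, comp_eq₂ e, cupFront_one_eq hN] at h
  have e1 : nakayama A ▷ (A ⊗ A) ≫ A ◁ (A ◁ nakayama A ≫ (β_ A A).hom ≫ μ[A]) ≫ nakayama A ▷ A =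
      A ◁ ((β_ A A).hom ≫ nakayama A ▷ A ≫ μ[A]) := by
    rw [whisker_exchange, ← comp_whiskerRight_assoc, hN, BraidedCategory.braiding_naturality_right_assoc]
    simp
  have e2 : nakayama A ▷ (A ⊗ A) ≫ A ◁ A ◁ nakayama A ≫ A ◁ (β_ A A).hom ≫ (α_ A A A).inv ≫
      μ[A] ▷ A ≫ nakayama A ▷ A = A ◁ (β_ A A).hom ≫ (α_ A A A).inv ≫ μ[A] ▷ A := by
    have e3 : nakayama A ▷ A ≫ A ◁ nakayama A ≫ (nakayama A ⊗ₘ nakayama A) = 𝟙 _ := by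
      rw [← tensorHom_id, ← id_tensorHom, tensorHom_comp_tensorHom, tensorHom_comp_tensorHom]
      simp [hN]
    have e4 := congrArg (fun f => A ◁ (β_ A A).hom ≫ (α_ A A A).inv ≫ f ▷ A ≫ μ[A] ▷ A) e3
    simp only [comp_whiskerRight, Category.assoc, id_whiskerRight, Category.id_comp] at e4
    rw [← e4, ← MonoidalCategory.whiskerLeft_comp_assoc, BraidedCategory.braiding_naturality_right,
      MonoidalCategory.whiskerLeft_comp_assoc, ← comp_whiskerRight μ[A],
      mul_nakayama, comp_whiskerRight, ← associator_inv_naturality_left_assoc,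
      ← associator_inv_naturality_middle_assoc, ← whisker_exchange_assoc]
  simp only [Category.assoc, MonoidalCategory.whiskerLeft_comp] at h e1 e2 ⊢
  rw [e2, e1] at h
  exact h.symm

/-- Δ(y) is c_{-1} with its first leg multiplied by y from the left. This commutes with the right
multiplication in `copairing_mul_first` by associativity, so y' x ⊗ y'' = y' ⊗ N(x) y''. -/
lemma comul_mul_first (hN : nakayama A ≫ nakayama A = 𝟙 A) :
    Δ[A] ▷ A ≫ (α_ A A A).hom ≫ A ◁ (β_ A A).hom ≫ (α_ A A A).inv ≫ μ[A] ▷ A =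
      Δ[A] ▷ A ≫ (α_ A A A).hom ≫ A ◁ ((β_ A A).hom ≫ nakayama A ▷ A ≫ μ[A]) := by
  have h := congrArg (fun f => A ◁ f ≫ (α_ A A A).inv ≫ μ[A] ▷ A) (copairing_mul_first hN)
  have e : Δ[A] ▷ A ≫ (α_ A A A).hom =
      A ◁ cupFront A (frobCopairing A (-1)) A ≫ (α_ A A (A ⊗ A)).inv ≫ μ[A] ▷ (A ⊗ A) := by
    rw [← comul_eq_left, cupFront]
    monoidal
  have e' := MonObj.mul_assoc A
  rw [comp_eq₂ e, comp_eq₂ e]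
  simp only [Category.assoc, MonoidalCategory.whiskerLeft_comp] at h ⊢
  have e1 : μ[A] ▷ (A ⊗ A) ≫ A ◁ (β_ A A).hom ≫ (α_ A A A).inv ≫ μ[A] ▷ A =
      (A ⊗ A) ◁ (β_ A A).hom ≫ (α_ (A ⊗ A) A A).inv ≫ (μ[A] ▷ A ≫ μ[A]) ▷ A := by
    rw [← whisker_exchange_assoc, associator_inv_naturality_left_assoc, comp_whiskerRight]
  have e2 : μ[A] ▷ (A ⊗ A) ≫ A ◁ (β_ A A).hom ≫ A ◁ nakayama A ▷ A ≫ A ◁ μ[A] =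
      (A ⊗ A) ◁ ((β_ A A).hom ≫ nakayama A ▷ A ≫ μ[A]) ≫ μ[A] ▷ A := by
    rw [whisker_exchange]
    simp
  rw [e1, e2, e', tensor_whiskerLeft, tensor_whiskerLeft]
  simp only [Category.assoc, Iso.inv_hom_id_assoc, MonoidalCategory.whiskerLeft_comp,
    comp_whiskerRight]
  rw [← h]
  monoidal

/-- A morphism to `A` whose image commutes with all elements up to the given power of the Nakayama
automorphism. -/
def IsTwisted {X : C} (a : X ⟶ A) (t : ℤˣ) : Prop :=
  (a ⊗ₘ 𝟙 A) ≫ μ[A] = (β_ X A).hom ≫ (nakayamaSign A t ⊗ₘ a) ≫ μ[A]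

lemma isTwisted_one : IsTwisted η[A] 1 := by
  simp [IsTwisted, MonoidalCategory.tensorHom_def]

/-- With Δ(a) = Σ a' ⊗ a'': a'' N^q(a') y = a'' N^q(a' N^q(y)), and `comul_mul_first` at x = N^q(y)
turns this into N(N^q(y)) a'' N^q(a'). The extra N explains the sign `-q`. -/
lemma isTwisted_comul (hN : nakayama A ≫ nakayama A = 𝟙 A) (q : ℤˣ) :
    IsTwisted (Δ[A] ≫ nakayamaSign A q ▷ A ≫ (β_ A A).hom ≫ μ[A]) (-q) := by
  have h := congrArg (fun f => A ◁ nakayamaSign A q ≫ f ≫ (β_ A A).hom ≫ A ◁ nakayamaSign A q ≫ μ[A])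
    (comul_mul_first hN)
  have hq : nakayamaSign A q ≫ nakayamaSign A q = 𝟙 A := by
    rw [nakayamaSign_comp hN, Int.units_mul_self, nakayamaSign_one]
  have hq' : nakayamaSign A q ≫ nakayama A = nakayamaSign A (-q) := by
    rw [← nakayamaSign_neg_one, nakayamaSign_comp hN, mul_neg_one]
  have e1 : A ◁ nakayamaSign A q ≫ (Δ[A] ▷ A ≫ (α_ A A A).hom ≫ A ◁ (β_ A A).hom ≫
      (α_ A A A).inv ≫ μ[A] ▷ A) ≫ (β_ A A).hom ≫ A ◁ nakayamaSign A q ≫ μ[A] =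
      ((Δ[A] ≫ nakayamaSign A q ▷ A ≫ (β_ A A).hom ≫ μ[A]) ⊗ₘ 𝟙 A) ≫ μ[A] := by
    have e3 : A ◁ nakayamaSign A q ≫ (nakayamaSign A q ⊗ₘ nakayamaSign A q) =
        nakayamaSign A q ▷ A := by
      rw [← id_tensorHom, tensorHom_comp_tensorHom, hq, Category.id_comp, tensorHom_id]
    have e4 : (α_ A A A).hom ≫ A ◁ (β_ A A).hom ≫ (α_ A A A).inv ≫ (β_ (A ⊗ A) A).hom =
        (β_ A A).hom ▷ A ≫ (α_ A A A).hom := by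
      simp [← MonoidalCategory.whiskerLeft_comp_assoc]
    simp only [Category.assoc]
    rw [whisker_exchange_assoc, BraidedCategory.braiding_naturality_left_assoc,
      ← MonoidalCategory.whiskerLeft_comp_assoc A μ[A], mul_nakayamaSign]
    simp only [tensor_whiskerLeft, Category.assoc, Iso.inv_hom_id_assoc,
      ← MonoidalCategory.whiskerLeft_comp_assoc, BraidedCategory.braiding_naturality_right]
    rw [MonoidalCategory.whiskerLeft_comp_assoc, associator_inv_naturality_middle_assoc,
      BraidedCategory.braiding_naturality_left_assoc, ← MonoidalCategory.whiskerLeft_comp_assoc,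
      ← Category.assoc (A ◁ nakayamaSign A q), e3]
    have e5 := congrArg (fun f => Δ[A] ▷ A ≫ f ≫ A ◁ (nakayamaSign A q ▷ A ≫ μ[A]) ≫ μ[A]) e4
    simp only [Category.assoc] at e5 ⊢
    rw [e5]
    simp only [tensorHom_id, comp_whiskerRight, Category.assoc, MonObj.mul_assoc,
      MonoidalCategory.whiskerLeft_comp]
    rw [← associator_naturality_middle_assoc, ← comp_whiskerRight_assoc (β_ A A).hom,
      ← BraidedCategory.braiding_naturality_left, comp_whiskerRight_assoc]
  have e2 : A ◁ nakayamaSign A q ≫ (Δ[A] ▷ A ≫ (α_ A A A).hom ≫ A ◁ ((β_ A A).hom ≫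
      nakayama A ▷ A ≫ μ[A])) ≫ (β_ A A).hom ≫ A ◁ nakayamaSign A q ≫ μ[A] =
      (β_ A A).hom ≫ (nakayamaSign A (-q) ⊗ₘ (Δ[A] ≫ nakayamaSign A q ▷ A ≫ (β_ A A).hom ≫ μ[A])) ≫
        μ[A] := by
    have e3 : A ◁ nakayamaSign A q ≫ (β_ A A).hom ≫ nakayama A ▷ A =
        (β_ A A).hom ≫ nakayamaSign A (-q) ▷ A := by
      rw [BraidedCategory.braiding_naturality_right_assoc, ← comp_whiskerRight, hq']
    have e4 := congrArg (fun f => Δ[A] ▷ A ≫ (α_ A A A).hom ≫ A ◁ f ≫ A ◁ μ[A] ≫ (β_ A A).hom ≫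
      A ◁ nakayamaSign A q ≫ μ[A]) e3
    simp only [Category.assoc, MonoidalCategory.whiskerLeft_comp] at e4 ⊢
    rw [whisker_exchange_assoc, tensor_whiskerLeft, Category.assoc, Category.assoc,
      Iso.inv_hom_id_assoc, e4, BraidedCategory.braiding_naturality_right_assoc,
      ← whisker_exchange_assoc, MonObj.mul_assoc]
    simp only [MonoidalCategory.tensorHom_def', Category.assoc]
    rw [← BraidedCategory.braiding_naturality_left_assoc]
    have e5 : (α_ A A A).hom ≫ A ◁ (β_ A A).hom ≫ (β_ A (A ⊗ A)).hom ≫ (α_ A A A).hom =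
        (β_ (A ⊗ A) A).hom ≫ A ◁ (β_ A A).hom := by
      simp
    have e6 := congrArg (fun f => Δ[A] ▷ A ≫ nakayamaSign A q ▷ A ▷ A ≫ f ≫
      nakayamaSign A (-q) ▷ (A ⊗ A) ≫ A ◁ μ[A] ≫ μ[A]) e5
    rw [whisker_exchange_assoc, BraidedCategory.braiding_naturality_right_assoc,
      associator_naturality_left_assoc, whisker_exchange_assoc, ← associator_naturality_left_assoc]
    simp only [Category.assoc, MonoidalCategory.whiskerLeft_comp] at e6 ⊢
    rw [e6]
    simp only [BraidedCategory.braiding_naturality_left_assoc, ← whisker_exchange_assoc]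
  rw [IsTwisted, ← e1, ← e2]
  exact h

/-- The power of the Nakayama automorphism by which the image of a projector is twisted. -/
def projectorSign : BoundaryType → ℤˣ
  | .NS => 1
  | .R => -1

lemma isTwisted_stateProjector (hN : nakayama A ≫ nakayama A = 𝟙 A) (d : BoundaryType) :
    IsTwisted (stateProjector A d) (projectorSign d) := by
  cases d with
  | NS =>
    have h := isTwisted_comul hN (-1)
    rwa [neg_neg, nakayamaSign_neg_one] at h
  | R =>
    have h := isTwisted_comul hN 1
    rwa [nakayamaSign_one, id_whiskerRight, Category.id_comp] at h

end Twisted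

/-! ### The functional of a face, rewritten at each of its three corners -/

section Forms

variable {C : Type u} [Category.{v} C] [MonoidalCategory C] [SymmetricCategory C]
  {A : C} [MonObj A] [ComonObj A] 

/-- The functional `ε(a z₀ z₁ z₂)`. -/
def faceForm {X : C} (a : X ⟶ A) : X ⊗ (A ⊗ (A ⊗ A)) ⟶ 𝟙_ C :=
  (a ⊗ₘ (A ◁ μ[A] ≫ μ[A])) ≫ frobPairing A

/-- The functional `ε(x g(y) f(z))`. -/
def cornerForm {H : C} (g : H ⟶ A) (f : A ⟶ A) : A ⊗ (H ⊗ A) ⟶ 𝟙_ C :=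
  A ◁ ((g ⊗ₘ f) ≫ μ[A]) ≫ frobPairing A

variable [IsFrobeniusObj A]

/-- ε(a z₀ · z₁ z₂) = ε(z₁ z₂ N(a z₀)) = ε(z₁ · z₂ N(a) · N(z₀)). -/
lemma faceForm_corner_one {X : C} (a : X ⟶ A) :
    faceForm a = (α_ X A (A ⊗ A)).inv ≫ (β_ (X ⊗ A) (A ⊗ A)).hom ≫ (α_ A A (X ⊗ A)).hom ≫
      A ◁ (α_ A X A).inv ≫
        cornerForm ((𝟙 A ⊗ₘ (a ≫ nakayama A)) ≫ μ[A]) (nakayama A) := by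
  have h1 := whiskerLeft_mul_pairing A a (𝟙 A) μ[A]
  have h2 := whiskerLeft_mul_pairing A (𝟙 A) (𝟙 A) ((a ≫ nakayama A ⊗ₘ nakayama A) ≫ μ[A])
  rw [← cancel_epi (α_ A A (X ⊗ A)).hom, Iso.hom_inv_id_assoc] at h2
  rw [faceForm, ← id_tensorHom, h1, tensorHom_pairing, Category.assoc, mul_nakayama,
    tensorHom_comp_tensorHom_assoc, Category.id_comp]
  simp only [id_tensorHom, MonoidalCategory.whiskerLeft_id, Category.id_comp] at h2
  rw [← h2, ← id_tensorHom A, ← id_tensorHom A, tensorHom_mul_assoc, cornerForm]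
  simp

/-- ε(a z₀ z₁ · z₂) = ε(z₂ · N(a z₀) · N(z₁)). -/
lemma faceForm_corner_two {X : C} (a : X ⟶ A) :
    faceForm a = X ◁ (α_ A A A).inv ≫ (α_ X (A ⊗ A) A).inv ≫ (α_ X A A).inv ▷ A ≫
      (β_ ((X ⊗ A) ⊗ A) A).hom ≫
        cornerForm ((a ⊗ₘ 𝟙 A) ≫ μ[A] ≫ nakayama A) (nakayama A) := by
  have h1 : faceForm a = X ◁ (α_ A A A).inv ≫ (a ⊗ₘ ((μ[A] ⊗ₘ 𝟙 A) ≫ μ[A])) ≫ frobPairing A := by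
    have h := MonObj.mul_assoc A
    rw [← cancel_epi (α_ A A A).inv, Iso.inv_hom_id_assoc] at h
    rw [faceForm, ← h, tensorHom_id, ← id_tensorHom X, tensorHom_comp_tensorHom_assoc,
      Category.id_comp]
  have h2 := tensorHom_mul_assoc A a (𝟙 A) (𝟙 A)
  rw [id_tensorHom_id, Category.id_comp] at h2
  rw [h1, whiskerLeft_mul_pairing, h2, ← Category.id_comp (𝟙 A), ← tensorHom_comp_tensorHom,
    Category.id_comp, tensorHom_id, Category.assoc, tensorHom_pairing, Category.assoc, mul_nakayama,
    tensorHom_comp_tensorHom_assoc, Category.id_comp, id_tensorHom, cornerForm, Category.assoc,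
    mul_nakayama]

/-- Here z₀ passes the insertion instead of going around the trace: ε(a z₀ z₁ z₂) = ε(N^t(z₀) a z₁
z₂) = ε(z₀ · N^t(a z₁) · N^t(z₂)). This is the origin of the special role of the preferred edge and
of the boundary type. -/
lemma faceForm_corner_zero (hN : nakayama A ≫ nakayama A = 𝟙 A) {X : C} (a : X ⟶ A) (t : ℤˣ)
    (ha : IsTwisted a t) :
    faceForm a = exch X A (A ⊗ A) ≫ A ◁ (α_ X A A).inv ≫
      cornerForm ((a ⊗ₘ 𝟙 A) ≫ μ[A] ≫ nakayamaSign A t) (nakayamaSign A t) := by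
  have h1 := whiskerLeft_mul_pairing A a (𝟙 A) μ[A]
  have h2 := whiskerLeft_mul_pairing A (nakayamaSign A t) a μ[A]
  rw [← cancel_epi (α_ A X (A ⊗ A)).hom, Iso.hom_inv_id_assoc] at h2
  -- The pairing is invariant under N^t, so applying N^t to both arguments frees z₀ of its twist.
  have h3 : (nakayamaSign A t ⊗ₘ nakayamaSign A t) ≫ frobPairing A = frobPairing A := by
    rw [frobPairing, ← Category.assoc, ← mul_nakayamaSign, Category.assoc, nakayamaSign_counit]
  have h4 := tensorHom_mul_assoc A a (𝟙 A) (𝟙 A)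
  rw [id_tensorHom_id, Category.id_comp] at h4
  have h5 : ((β_ X A).hom ≫ (nakayamaSign A t ⊗ₘ a) ≫ μ[A] ⊗ₘ μ[A]) =
      (β_ X A).hom ▷ (A ⊗ A) ≫ ((nakayamaSign A t ⊗ₘ a) ≫ μ[A] ⊗ₘ μ[A]) := by
    rw [← tensorHom_id, tensorHom_comp_tensorHom, Category.id_comp]
  rw [faceForm, ← id_tensorHom, h1, ha, exch, h5, Category.assoc, ← h2, ← h3,
    tensorHom_comp_tensorHom_assoc, nakayamaSign_comp hN, h4, Int.units_mul_self, nakayamaSign_one,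
    Category.assoc, Category.assoc, mul_nakayamaSign, tensorHom_comp_tensorHom_assoc, cornerForm]
  simp [mul_nakayamaSign]

end Forms

/-! ### Pairing with the reversed iterated coproduct -/

section IteratedCoproduct

set_option linter.unusedSectionVars false

variable {C : Type u} [Category.{v} C] [MonoidalCategory C] [SymmetricCategory C]
  {A : C}

/-- Combine a pairing of the first factors with a pairing of the remaining ones. -/
def pairStep (b : A ⊗ A ⟶ 𝟙_ C) {Y W : C} (θ : Y ⊗ W ⟶ 𝟙_ C) : (A ⊗ Y) ⊗ (A ⊗ W) ⟶ 𝟙_ C :=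
  (α_ A Y (A ⊗ W)).hom ≫ A ◁ exch Y A W ≫ (α_ A A (Y ⊗ W)).inv ≫ b ▷ (Y ⊗ W) ≫ (λ_ _).hom ≫ θ

/-- Undoing one step of the reversal makes the two factors to be paired adjacent, so the pairings
become nested. -/
lemma braiding_pairStep (b : A ⊗ A ⟶ 𝟙_ C) {Y W : C} (θ : Y ⊗ W ⟶ 𝟙_ C) :
    (β_ Y A).hom ▷ (A ⊗ W) ≫ pairStep b θ =
      (α_ Y A (A ⊗ W)).hom ≫ Y ◁ ((α_ A A W).inv ≫ b ▷ W ≫ (λ_ W).hom) ≫ θ := by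
  have h1 := exch_naturality_middle Y b W
  have h2 := exch_tensor_right Y A A W
  have h3 : (β_ Y A).hom ▷ (A ⊗ W) ≫ (α_ A Y (A ⊗ W)).hom ≫ A ◁ exch Y A W ≫
      (α_ A A (Y ⊗ W)).inv = (α_ Y A (A ⊗ W)).hom ≫ Y ◁ (α_ A A W).inv ≫ exch Y (A ⊗ A) W := by
    rw [← cancel_mono (α_ A A (Y ⊗ W)).hom]
    simp only [Category.assoc, Iso.inv_hom_id, Category.comp_id]
    have h5 : (α_ Y A (A ⊗ W)).hom ≫ exch Y A (A ⊗ W) =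
        (β_ Y A).hom ▷ (A ⊗ W) ≫ (α_ A Y (A ⊗ W)).hom := by
      simp only [exch, Iso.hom_inv_id_assoc]
    rw [← h2, comp_eq₂ h5, Category.assoc]
  have h4 := congrArg (fun f => f ≫ b ▷ (Y ⊗ W) ≫ (λ_ _).hom ≫ θ) h3
  simp only [Category.assoc] at h4
  rw [pairStep, h4, comp_eq₂ h1.symm, exch_unit_middle]
  simp

variable [MonObj A] [ComonObj A] [IsFrobeniusObj A]

lemma comul_pairing : Δ[A] ▷ A ≫ (α_ A A A).hom ≫ A ◁ frobPairing A ≫ (ρ_ A).hom = μ[A] := by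
  have h := congrArg (fun f => f ≫ A ◁ ε[A] ≫ (ρ_ A).hom) (IsFrobeniusObj.right_linear (A := A))
  simpa [frobPairing] using h

lemma comul_pairing_tensor (W : C) :
    Δ[A] ▷ (A ⊗ W) ≫ (α_ A A (A ⊗ W)).hom ≫
      A ◁ ((α_ A A W).inv ≫ frobPairing A ▷ W ≫ (λ_ W).hom) = (α_ A A W).inv ≫ μ[A] ▷ W := by
  rw [← comul_pairing]
  monoidal

/-- The reversal nests the pairings, so (id ⊗ b)(Δ ⊗ id) = μ absorbs them from the inside: pairing
the innermost factor with z₀ multiplies by z₀, the next pairing brings in z₁, and b(a z₀ z₁, z₂)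
remains. -/
lemma iotaOneThree_pairing :
    iotaOneThree A ▷ (A ⊗ (A ⊗ A)) ≫
      pairStep (frobPairing A) (pairStep (frobPairing A) (frobPairing A)) =
    A ◁ (A ◁ μ[A] ≫ μ[A]) ≫ frobPairing A := by
  have h1 : iotaOneThree A = Δ[A] ≫ A ◁ Δ[A] ≫ (α_ A A A).inv ≫ (β_ A A).hom ▷ A ≫
      (β_ (A ⊗ A) A).hom := by
    rw [iotaOneThree, BraidedCategory.braiding_naturality_left,
      ← BraidedCategory.braiding_naturality_left]
    simp
  have h2 := braiding_pairStep (frobPairing A) (Y := A ⊗ A) (W := A ⊗ A)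
    (pairStep (frobPairing A) (frobPairing A))
  have h3 := braiding_pairStep (frobPairing A) (Y := A) (W := A) (frobPairing A)
  have h4 := comul_pairing_tensor (A := A) (A ⊗ A)
  have h5 := comul_pairing_tensor (A := A) A
  have h6 : (A ◁ Δ[A] ≫ (α_ A A A).inv) ▷ (A ⊗ (A ⊗ A)) ≫ (α_ (A ⊗ A) A (A ⊗ (A ⊗ A))).hom ≫
      (A ⊗ A) ◁ ((α_ A A (A ⊗ A)).inv ≫ frobPairing A ▷ (A ⊗ A) ≫ (λ_ (A ⊗ A)).hom) =
      (α_ A A _).hom ≫ A ◁ ((α_ A A (A ⊗ A)).inv ≫ μ[A] ▷ (A ⊗ A)) ≫ (α_ A A (A ⊗ A)).inv := by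
    rw [← h4]
    monoidal
  have h7 : (α_ A A (A ⊗ A)).inv ≫ μ[A] ▷ (A ⊗ A) ≫ (α_ A A A).inv ≫ frobPairing A ▷ A ≫
      (λ_ A).hom = A ◁ ((α_ A A A).inv ≫ μ[A] ▷ A) ≫ (α_ A A A).inv ≫ frobPairing A ▷ A ≫
        (λ_ A).hom := by
    have h := mul_pairing A
    have h' : μ[A] ▷ (A ⊗ A) ≫ (α_ A A A).inv ≫ frobPairing A ▷ A =
        (α_ _ _ _).inv ≫ (μ[A] ▷ A ≫ frobPairing A) ▷ A := by
      monoidal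
    rw [comp_eq₃ h', h]
    monoidal
  rw [h1]
  simp only [comp_whiskerRight, Category.assoc] at h6 ⊢
  have h8 := congrArg (fun f => Δ[A] ▷ (A ⊗ (A ⊗ A)) ≫ f ≫ (α_ A A (A ⊗ A)).hom ≫
    A ◁ ((α_ A A A).inv ≫ frobPairing A ▷ A ≫ (λ_ A).hom) ≫ frobPairing A) h6
  have h9 := congrArg (fun f => A ◁ ((α_ A A A).inv ≫ μ[A] ▷ A) ≫ f ≫ frobPairing A) h5
  simp only [Category.assoc, Iso.inv_hom_id_assoc] at h8 h9
  rw [h2, associator_naturality_left_assoc, ← whisker_exchange_assoc, h3, h8,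
    ← MonoidalCategory.whiskerLeft_comp_assoc]
  simp only [Category.assoc]
  rw [h7, MonoidalCategory.whiskerLeft_comp, Category.assoc, ← associator_naturality_right_assoc,
    ← whisker_exchange_assoc, h9, mul_pairing, Iso.inv_hom_id_assoc,
    ← MonoidalCategory.whiskerLeft_comp_assoc, Category.assoc, MonObj.mul_assoc,
    Iso.inv_hom_id_assoc]

end IteratedCoproduct

/-! ### Multisets of labels -/

section Letters

variable {L : Type w}

/-- The letters of a word, with multiplicities. -/
def letters {n : ℕ} (w : Fin n → L) : Multiset L := Finset.univ.val.map w

@[simp]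
lemma letters_cons {n : ℕ} (a : L) (w : Fin n → L) :
    letters (Fin.cons a w : Fin (n + 1) → L) = a ::ₘ letters w := by
  simp only [letters, Fin.univ_val_map, List.ofFn_cons]
  rfl

@[simp]
lemma letters_zero (w : Fin 0 → L) : letters w = 0 := by
  simp [letters]

@[simp]
lemma letters_catWord {n m : ℕ} (w : Fin n → L) (w' : Fin m → L) :
    letters (catWord w w') = letters w + letters w' := by
  induction n with
  | zero => simp
  | succ n ih =>
    obtain ⟨a, w, rfl⟩ := Fin.exists_cons w
    rw [catWord_cons, letters_cons a w, Multiset.cons_add, ← ih]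
    exact letters_cons _ _

lemma letters_comp {n m : ℕ} (e : Fin n ≃ Fin m) (w : Fin m → L) : letters (w ∘ e) = letters w := by
  rw [letters, ← Multiset.map_map]
  congr 1
  have h := Finset.map_univ_equiv e
  exact congrArg Finset.val h

/-- Equal multiplicities give fibres of equal size over every label; bijections of the fibres glue.
-/
lemma exists_equiv_of_letters_eq {n m : ℕ} {w : Fin n → L} {w' : Fin m → L}
    (h : letters w = letters w') : ∃ e : Fin n ≃ Fin m, w = w' ∘ e := by
  classical
  have hc : ∀ c : L, Nonempty ({i // w i = c} ≃ {i // w' i = c}) := by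
    intro c
    refine ⟨Fintype.equivOfCardEq ?_⟩
    have h2 := congrArg (Multiset.count c) h
    simp only [letters, Multiset.count_map] at h2
    rw [Fintype.card_subtype, Fintype.card_subtype, Finset.card_def, Finset.card_def,
      Finset.filter_val, Finset.filter_val]
    simpa only [eq_comm] using h2
  refine ⟨Equiv.ofFiberEquiv (fun c => (hc c).some), ?_⟩
  ext i
  exact (Equiv.ofFiberEquiv_map (fun c => (hc c).some) i).symm

end Letters

/-! ### The commutative monoid of labelled functionals -/

section Functionals

set_option linter.unusedSectionVars false

variable {C : Type u} [Category.{v} C] [MonoidalCategory C] [SymmetricCategory C]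

instance isIso_tensorPowJoin (A : C) (m n : ℕ) : IsIso (tensorPowJoin A m n) := by
  induction n with
  | zero => exact inferInstanceAs (IsIso (λ_ _).hom)
  | succ n ih => exact inferInstanceAs (IsIso ((α_ _ _ _).hom ≫ A ◁ tensorPowJoin A m n))

variable (A : C) (L : Type w)

variable {A L} in
/-- Two functionals on tensor powers of `A` whose factors are labelled differ by a permutation of
factors which respects the labels. -/
def LabelledRel {n n' : ℕ} (w : Fin n → L) (φ : tensorPow A n ⟶ 𝟙_ C) (w' : Fin n' → L)
    (φ' : tensorPow A n' ⟶ 𝟙_ C) : Prop :=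
  ∃ e : Fin n ≃ Fin n', w = w' ∘ e ∧ tensorPerm A e ≫ φ' = φ

/-- Equivalence of functionals with labelled arguments. -/
def labelledSetoid : Setoid (Σ n : ℕ, (Fin n → L) × (tensorPow A n ⟶ 𝟙_ C)) where
  r p q := LabelledRel p.2.1 p.2.2 q.2.1 q.2.2
  iseqv :=
    { refl p := ⟨Equiv.refl _, rfl, by rw [tensorPerm_refl, Category.id_comp]⟩
      symm := by
        rintro ⟨n, w, φ⟩ ⟨n', w', φ'⟩ h
        obtain ⟨e, rfl, rfl⟩ : LabelledRel w φ w' φ' := h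
        refine ⟨e.symm, by ext; simp, ?_⟩
        rw [← Category.assoc, ← tensorPerm_trans, Equiv.symm_trans_self, tensorPerm_refl,
          Category.id_comp]
      trans := by
        rintro ⟨n, w, φ⟩ ⟨n', w', φ'⟩ ⟨n'', w'', φ''⟩ h h'
        obtain ⟨e, rfl, rfl⟩ : LabelledRel w φ w' φ' := h
        obtain ⟨e', rfl, rfl⟩ : LabelledRel w' φ' w'' φ'' := h'
        exact ⟨e.trans e', by ext; simp, by rw [tensorPerm_trans, Category.assoc]⟩ }

/-- Functionals on tensor powers of `A` whose factors are labelled, up to permutation. -/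
def LabelledForm : Type (max v w) := Quotient (labelledSetoid A L)

namespace LabelledForm

variable {A L}

/-- The class of a functional with labelled arguments. -/
def mk {n : ℕ} (w : Fin n → L) (φ : tensorPow A n ⟶ 𝟙_ C) : LabelledForm A L :=
  Quotient.mk (labelledSetoid A L) ⟨n, w, φ⟩

lemma ind {P : LabelledForm A L → Prop} (h : ∀ (n : ℕ) (w : Fin n → L) (φ : tensorPow A n ⟶ 𝟙_ C),
    P (mk w φ)) (q : LabelledForm A L) : P q :=
  Quotient.ind (fun p => h p.1 p.2.1 p.2.2) q

lemma mk_eq_iff {n n' : ℕ} {w : Fin n → L} {φ : tensorPow A n ⟶ 𝟙_ C} {w' : Fin n' → L}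
    {φ' : tensorPow A n' ⟶ 𝟙_ C} :
    mk w φ = mk w' φ' ↔ LabelledRel w φ w' φ' :=
  ⟨fun h => Quotient.exact h, fun h => Quotient.sound h⟩

lemma mk_comp {n n' : ℕ} (e : Fin n ≃ Fin n') (w : Fin n' → L) (φ : tensorPow A n' ⟶ 𝟙_ C) :
    mk (w ∘ e) (tensorPerm A e ≫ φ) = mk w φ :=
  mk_eq_iff.2 ⟨e, rfl, rfl⟩

lemma mk_eq_of_permRel {X : C} {n n' : ℕ} {f : X ⟶ tensorPow A n} [Epi f] {w : Fin n → L}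
    {φ : tensorPow A n ⟶ 𝟙_ C} {f' : X ⟶ tensorPow A n'} {w' : Fin n' → L}
    {φ' : tensorPow A n' ⟶ 𝟙_ C} (h : PermRel A f w f' w') (hφ : f ≫ φ = f' ≫ φ') :
    mk w φ = mk w' φ' := by
  obtain ⟨e, h1, rfl⟩ := h
  rw [Category.assoc, cancel_epi] at hφ
  exact mk_eq_iff.2 ⟨e, h1, hφ.symm⟩

/-- The tensor product of two functionals. -/
def tensorForm {n m : ℕ} (φ : tensorPow A n ⟶ 𝟙_ C) (ψ : tensorPow A m ⟶ 𝟙_ C) :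
    tensorPow A (m + n) ⟶ 𝟙_ C :=
  inv (tensorPowJoin A m n) ≫ (φ ⊗ₘ ψ) ≫ (λ_ (𝟙_ C)).hom

@[simp]
lemma join_tensorForm {n m : ℕ} (φ : tensorPow A n ⟶ 𝟙_ C) (ψ : tensorPow A m ⟶ 𝟙_ C) :
    tensorPowJoin A m n ≫ tensorForm φ ψ = (φ ⊗ₘ ψ) ≫ (λ_ (𝟙_ C)).hom := by
  simp [tensorForm]

instance : Mul (LabelledForm A L) where
  mul := Quotient.map₂ (fun p q => ⟨_, catWord p.2.1 q.2.1, tensorForm p.2.2 q.2.2⟩) (by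
    rintro ⟨n, w, φ⟩ ⟨n', w', φ'⟩ h ⟨m, v, ψ⟩ ⟨m', v', ψ'⟩ h'
    obtain ⟨e, rfl, rfl⟩ : LabelledRel w φ w' φ' := h
    obtain ⟨e', rfl, rfl⟩ : LabelledRel v ψ v' ψ' := h'
    refine Quotient.exact (mk_eq_of_permRel (f := tensorPowJoin A m n)
      (f' := (tensorPerm A e ⊗ₘ tensorPerm A e') ≫ tensorPowJoin A m' n') ?_ ?_)
    · have h3 := (PermRel.perm (A := A) e w').whiskerRight (v' ∘ e')
      have h4 := ((PermRel.perm (A := A) e' v').whiskerLeft w').precomp (tensorPerm A e ▷ _)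
      refine (h3.congr (by simp) rfl rfl rfl).trans (h4.congr (by simp) rfl ?_ rfl)
      rw [MonoidalCategory.tensorHom_def, Category.assoc]
    · rw [join_tensorForm, Category.assoc, join_tensorForm, tensorHom_comp_tensorHom_assoc])

lemma mk_mul_mk {n m : ℕ} (w : Fin n → L) (φ : tensorPow A n ⟶ 𝟙_ C) (v : Fin m → L)
    (ψ : tensorPow A m ⟶ 𝟙_ C) : mk w φ * mk v ψ = mk (catWord w v) (tensorForm φ ψ) := rfl

lemma mk_mul_mk_eq {n m k : ℕ} {w : Fin n → L} {φ : tensorPow A n ⟶ 𝟙_ C} {v : Fin m → L}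
    {ψ : tensorPow A m ⟶ 𝟙_ C} {u : Fin k → L} {χ : tensorPow A k ⟶ 𝟙_ C}
    {f : tensorPow A n ⊗ tensorPow A m ⟶ tensorPow A k}
    (h : PermRel A (tensorPowJoin A m n) (catWord w v) f u)
    (hχ : f ≫ χ = (φ ⊗ₘ ψ) ≫ (λ_ (𝟙_ C)).hom) : mk w φ * mk v ψ = mk u χ := by
  rw [mk_mul_mk]
  exact mk_eq_of_permRel h (by rw [join_tensorForm, hχ])

instance : One (LabelledForm A L) where
  one := mk (Fin.elim0 : Fin 0 → L) (𝟙 _)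

lemma one_def : (1 : LabelledForm A L) = mk (Fin.elim0 : Fin 0 → L) (𝟙 _) := rfl

instance : CommMonoid (LabelledForm A L) where
  mul_assoc p q r := by
    induction p using ind with | _ n w φ
    induction q using ind with | _ m v ψ
    induction r using ind with | _ k u χ
    rw [mk_mul_mk, mk_mul_mk, mk_mul_mk, mk_mul_mk]
    refine mk_eq_of_permRel (PermRel.assoc w v u) ?_
    rw [Category.assoc, join_tensorForm, Category.assoc, Category.assoc, join_tensorForm,
      ← tensorHom_id, ← id_tensorHom, tensorHom_comp_tensorHom_assoc,
      tensorHom_comp_tensorHom_assoc, join_tensorForm, join_tensorForm]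
    simp only [Category.id_comp, MonoidalCategory.tensorHom_def]
    simp
  mul_comm p q := by
    induction p using ind with | _ n w φ
    induction q using ind with | _ m v ψ
    refine mk_mul_mk_eq (PermRel.swapTwo w v) ?_
    rw [Category.assoc, join_tensorForm, ← BraidedCategory.braiding_naturality_assoc,
      braiding_tensorUnit_left, Category.assoc, ← unitors_inv_equal, Iso.inv_hom_id, Category.comp_id]
  one_mul p := by
    induction p using ind with | _ n w φ
    refine mk_mul_mk_eq (PermRel.refl _ _) ?_
    simp [tensorPowJoin]
  mul_one p := by
    induction p using ind with | _ n w φ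
    refine mk_mul_mk_eq (PermRel.nil_right w _) ?_
    simp [unitors_equal]

/-- The labels of the arguments of a functional. -/
def labels : LabelledForm A L → Multiset L :=
  Quotient.lift (fun p => letters p.2.1) (by
    rintro ⟨n, w, φ⟩ ⟨n', w', φ'⟩ h
    obtain ⟨e, rfl, rfl⟩ : LabelledRel w φ w' φ' := h
    exact letters_comp e w')

@[simp]
lemma labels_mk {n : ℕ} (w : Fin n → L) (φ : tensorPow A n ⟶ 𝟙_ C) :
    labels (mk w φ) = letters w := rfl

section Family

variable [Preadditive C]

open Classical in
/-- The symmetric family which is given by a functional whose labels are distinct. -/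
def toFamily (q : LabelledForm A L) : TensorFamily A L (𝟙_ C) (𝟙_ C) := fun n w =>
  if h : (letters w).Nodup ∧ ∃ φ, q = mk w φ then (λ_ (tensorPow A n)).hom ≫ h.2.choose else 0

/-- With distinct labels only the identity permutation preserves a word. So the representative over
a given word is unique, and the choice in `toFamily` is harmless. -/
lemma mk_injective {n : ℕ} {w : Fin n → L} (hw : (letters w).Nodup)
    {φ φ' : tensorPow A n ⟶ 𝟙_ C} (h : mk w φ = mk w φ') : φ = φ' := by
  obtain ⟨e, h1, h2⟩ := mk_eq_iff.1 h
  have hinj : Function.Injective w := by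
    intro i j hij
    exact Multiset.inj_on_of_nodup_map hw i (Finset.mem_univ i) j (Finset.mem_univ j) hij
  have he : e = Equiv.refl _ := Equiv.ext fun i => (hinj (congrFun h1 i)).symm
  rw [← h2, he, tensorPerm_refl, Category.id_comp]

lemma toFamily_mk {n : ℕ} {w : Fin n → L} (hw : (letters w).Nodup) (φ : tensorPow A n ⟶ 𝟙_ C) :
    toFamily (mk w φ) n w = (λ_ (tensorPow A n)).hom ≫ φ := by
  have h : (letters w).Nodup ∧ ∃ φ', mk w φ = mk w φ' := ⟨hw, φ, rfl⟩
  rw [toFamily, dif_pos h, ← mk_injective hw h.2.choose_spec]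

lemma toFamily_eq_zero {q : LabelledForm A L} {n : ℕ} {w : Fin n → L} (h : labels q ≠ letters w) :
    toFamily q n w = 0 := by
  rw [toFamily, dif_neg]
  rintro ⟨-, φ, rfl⟩
  exact h rfl

lemma isSymm_toFamily (q : LabelledForm A L) : (toFamily q).IsSymm := by
  intro n n' e w
  by_cases h : (letters w).Nodup ∧ ∃ φ, q = mk w φ
  · obtain ⟨hw, φ, rfl⟩ := h
    rw [toFamily_mk hw, ← mk_comp e, toFamily_mk (by rwa [letters_comp])]
    simp
  · have h' : ¬ ((letters (w ∘ e)).Nodup ∧ ∃ φ, q = mk (w ∘ e) φ) := by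
      rintro ⟨hw, φ, hφ⟩
      refine h ⟨by rwa [letters_comp] at hw, tensorPerm A e.symm ≫ φ, ?_⟩
      rw [hφ, ← mk_comp e w, ← Category.assoc, ← tensorPerm_trans, Equiv.self_trans_symm,
        tensorPerm_refl, Category.id_comp]
    rw [toFamily, dif_neg h, toFamily, dif_neg h', Limits.comp_zero]

end Family

end LabelledForm

end Functionals

/-! ### Contractions of twisted products -/

section TwistedProducts

set_option linter.unusedSectionVars false

open TensorFamily

variable {C : Type u} [Category.{v} C] [MonoidalCategory C] [SymmetricCategory C]
  {A : C} [MonObj A] [ComonObj A]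

/-- The morphism `x ⊗ y ↦ U(y) N^k(x)`. -/
def twistMul {T : C} (U : T ⟶ A) (k : ℤˣ) : A ⊗ T ⟶ A :=
  (β_ A T).hom ≫ (U ⊗ₘ nakayamaSign A k) ≫ μ[A]

lemma whiskerLeft_twistMul {T T' : C} (j : T' ⟶ T) (U : T ⟶ A) (k : ℤˣ) :
    A ◁ j ≫ twistMul U k = twistMul (j ≫ U) k := by
  rw [twistMul, BraidedCategory.braiding_naturality_right_assoc, ← tensorHom_id,
    tensorHom_comp_tensorHom_assoc, Category.id_comp, twistMul]

variable [IsFrobeniusObj A]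

lemma twistMul_nakayamaSign (hN : nakayama A ≫ nakayama A = 𝟙 A) {T : C} (U : T ⟶ A) (k l : ℤˣ) :
    twistMul U k ≫ nakayamaSign A l = twistMul (U ≫ nakayamaSign A l) (k * l) := by
  rw [twistMul, Category.assoc, Category.assoc, mul_nakayamaSign, tensorHom_comp_tensorHom_assoc,
    nakayamaSign_comp hN, twistMul]

lemma exch_mul_twistMul {T H : C} (U : T ⟶ A) (g : H ⟶ A) (k : ℤˣ) :
    exch A T H ≫ (U ⊗ₘ twistMul g k) ≫ μ[A] = twistMul ((U ⊗ₘ g) ≫ μ[A]) k := by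
  have h := tensorHom_mul_assoc A U g (nakayamaSign A k)
  have h2 : (U ⊗ₘ twistMul g k) =
      T ◁ (β_ A H).hom ≫ (U ⊗ₘ ((g ⊗ₘ nakayamaSign A k) ≫ μ[A])) := by
    rw [← id_tensorHom, tensorHom_comp_tensorHom, Category.id_comp, twistMul]
  rw [h2, Category.assoc, h, twistMul, exch]
  simp

/-- The zigzag `snake_sign` with a spectator `T` standing between the copairing and the pairing. -/
lemma cupFront_exch_pairing (hN : nakayama A ≫ nakayama A = 𝟙 A) (s : ℤˣ) (T : C) :
    cupFront A (frobCopairing A s) (T ⊗ A) ≫ A ◁ (exch A T A ≫ T ◁ frobPairing A ≫ (ρ_ T).hom) =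
      T ◁ nakayamaSign A (-s) ≫ (β_ T A).hom := by
  have h := whiskerLeft_cupFront (frobCopairing A s) T A
  have h1 := congrArg (fun f => A ◁ f ≫ A ◁ (T ◁ frobPairing A ≫ (ρ_ T).hom)) (exch_exch T A A)
  have h2 := exch_naturality_right T A (frobPairing A)
  simp only [MonoidalCategory.whiskerLeft_comp, Category.assoc, MonoidalCategory.whiskerLeft_id,
    Category.id_comp] at h1 ⊢
  rw [← h, Category.assoc, Category.assoc, h1, comp_eq₂ h2.symm, exch_unit_right, ← snake_sign hN s]
  simp

/-- In U(y) N^k(x), the leg inserted for x is replaced by N^{-s} of whatever the other leg is paired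
with, here `D`. The exponents k and -s multiply. -/
lemma cupFront_twistMul_pairing (hN : nakayama A ≫ nakayama A = 𝟙 A) (s : ℤˣ) {T M : C}
    (U : T ⟶ A) (k : ℤˣ) (D : A ⊗ M ⟶ A) :
    cupFront A (frobCopairing A s) (A ⊗ (T ⊗ M)) ≫
      A ◁ (A ◁ exch A T M ≫ exch A T (A ⊗ M)) ≫ (α_ A T _).inv ≫
        (twistMul U k ⊗ₘ (A ◁ D ≫ frobPairing A)) ≫ (ρ_ A).hom =
      exch A T M ≫ (U ⊗ₘ (D ≫ nakayamaSign A (-s * k))) ≫ μ[A] := by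
  have h1 := exch_naturality_right A T D
  have h2 := cupFront_naturality (frobCopairing A s) (exch A T M ≫ T ◁ D)
  have h3 : (α_ A T (A ⊗ (A ⊗ M))).inv ≫ (twistMul U k ⊗ₘ (A ◁ D ≫ frobPairing A)) ≫ (ρ_ A).hom =
      A ◁ T ◁ A ◁ D ≫ A ◁ (T ◁ frobPairing A ≫ (ρ_ T).hom) ≫ twistMul U k := by
    rw [MonoidalCategory.tensorHom_def']
    simp
  have h4 := congrArg (fun f => A ◁ f) h1
  have h5 := cupFront_exch_pairing hN s T
  simp only [MonoidalCategory.whiskerLeft_comp, Category.assoc] at h2 h3 h4 h5 ⊢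
  rw [h3, comp_eq₂ h4.symm, Category.assoc, comp_eq₃ h2.symm]
  simp only [Category.assoc]
  have h6 := congrArg (fun f => exch A T M ≫ T ◁ D ≫ f ≫ twistMul U k) h5
  simp only [Category.assoc] at h6
  rw [h6, twistMul, SymmetricCategory.symmetry_assoc, ← id_tensorHom, ← id_tensorHom,
    tensorHom_comp_tensorHom_assoc, tensorHom_comp_tensorHom_assoc]
  simp only [Category.assoc, nakayamaSign_comp hN, Category.id_comp]

/-- Contracting a product with the next factor of a chain of products. -/
lemma cupFront_twistMul_chain (hN : nakayama A ≫ nakayama A = 𝟙 A) (s : ℤˣ) {T H M : C}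
    (U : T ⟶ A) (k : ℤˣ) (g : H ⟶ A) (p : ℤˣ) (S : M ⟶ 𝟙_ C) :
    cupFront A (frobCopairing A s) (A ⊗ ((T ⊗ H) ⊗ M)) ≫
      A ◁ (A ◁ (A ◁ (α_ T H M).hom ≫ exch A T (H ⊗ M)) ≫ exch A T (A ⊗ (H ⊗ M))) ≫
        (α_ A T _).inv ≫ (twistMul U k ⊗ₘ
          (A ◁ ((α_ A H M).inv ≫ (twistMul g p ⊗ₘ S) ≫ (ρ_ A).hom) ≫ frobPairing A)) ≫ (ρ_ A).hom =
      (α_ A (T ⊗ H) M).inv ≫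
        (twistMul ((U ⊗ₘ (g ≫ nakayamaSign A (-s * k))) ≫ μ[A]) (p * (-s * k)) ⊗ₘ S) ≫
          (ρ_ A).hom := by
  have h1 := cupFront_twistMul_pairing hN s U k
    ((α_ A H M).inv ≫ (twistMul g p ⊗ₘ S) ≫ (ρ_ A).hom)
  have h2 := cupFront_naturality (frobCopairing A s) (A ◁ (α_ T H M).hom)
  have h3 := congrArg (fun f => A ◁ (α_ T H M).hom ≫ f) h1
  simp only [MonoidalCategory.whiskerLeft_comp, Category.assoc] at h3 ⊢
  rw [comp_eq₂ h2] at h3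
  simp only [Category.assoc] at h3
  rw [h3]
  have h4 := exch_mul_twistMul U (g ≫ nakayamaSign A (-s * k)) (p * (-s * k))
  have h5 : (twistMul g p ⊗ₘ S) ≫ (ρ_ A).hom ≫ nakayamaSign A (-s * k) =
      (twistMul (g ≫ nakayamaSign A (-s * k)) (p * (-s * k)) ⊗ₘ S) ≫ (ρ_ A).hom := by
    rw [← twistMul_nakayamaSign hN, MonoidalCategory.tensorHom_def', MonoidalCategory.tensorHom_def']
    simp
  rw [h5, ← h4]
  generalize twistMul (g ≫ nakayamaSign A (-s * k)) (p * (-s * k)) = D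
  have h6 : A ◁ (α_ T H M).hom ≫ exch A T (H ⊗ M) ≫ T ◁ (α_ A H M).inv =
      (α_ A (T ⊗ H) M).inv ≫ exch A T H ▷ M ≫ (α_ T (A ⊗ H) M).hom := by
    simp only [exch]
    monoidal
  have h7 : (U ⊗ₘ ((α_ A H M).inv ≫ (D ⊗ₘ S) ≫ (ρ_ A).hom)) =
      T ◁ (α_ A H M).inv ≫ (U ⊗ₘ ((D ⊗ₘ S) ≫ (ρ_ A).hom)) := by
    rw [← id_tensorHom, tensorHom_comp_tensorHom, Category.id_comp]
  have h8 : (α_ T (A ⊗ H) M).hom ≫ (U ⊗ₘ ((D ⊗ₘ S) ≫ (ρ_ A).hom)) =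
      ((U ⊗ₘ D) ⊗ₘ S) ≫ (ρ_ (A ⊗ A)).hom := by
    have e : (U ⊗ₘ ((D ⊗ₘ S) ≫ (ρ_ A).hom)) = (U ⊗ₘ (D ⊗ₘ S)) ≫ A ◁ (ρ_ A).hom := by
      rw [← id_tensorHom, tensorHom_comp_tensorHom, Category.comp_id]
    rw [e, ← associator_naturality_assoc]
    simp
  have h9 : (exch A T H ≫ (U ⊗ₘ D) ≫ μ[A] ⊗ₘ S) =
      exch A T H ▷ M ≫ ((U ⊗ₘ D) ⊗ₘ S) ≫ μ[A] ▷ 𝟙_ C := by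
    rw [← tensorHom_id, ← tensorHom_id, tensorHom_comp_tensorHom, tensorHom_comp_tensorHom]
    simp
  rw [h7, Category.assoc, comp_eq₃ h6, h9]
  simp only [Category.assoc]
  rw [comp_eq₂ h8, Category.assoc, rightUnitor_naturality]

/-- Closing a cycle of products. -/
lemma cupFront_twistMul_eq_zero [Preadditive C] [MonoidalPreadditive C]
    (hN : nakayama A ≫ nakayama A = 𝟙 A) (hconv : frobConv A (nakayama A) (𝟙 A) = 0)
    {k s : ℤˣ} (h : k * -s = 1) {T : C} (U : T ⟶ A) :
    cupFront A (frobCopairing A (-s)) T ≫ A ◁ twistMul U k ≫ frobPairing A = 0 := by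
  have h1 := cupFront_naturality (frobCopairing A (-s)) U
  have h2 : twistMul U k = A ◁ U ≫ twistMul (𝟙 A) k := by
    rw [whiskerLeft_twistMul, Category.comp_id]
  rw [h2, MonoidalCategory.whiskerLeft_comp, Category.assoc, comp_eq₂ h1.symm, Category.assoc]
  -- Rotating ε(c' U(y) N^k(c'')) to ε(U(y) N^k(c'') N(c')) brings the two legs together. The legs
  -- of c_{-s} now stand in the opposite order, which is c_s, so the factor μ(N^k ⊗ N)c_s splits
  -- off.
  have h3 := copairing_mul_eq_zero hN hconv h
  have h4 := tensorHom_pairing A (𝟙 A) (twistMul (𝟙 A) k)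
  have h5 := tensorHom_mul_assoc A (𝟙 A) (nakayamaSign A k) (nakayama A)
  have h6 : (twistMul (𝟙 A) k ⊗ₘ nakayama A) ≫ μ[A] = (β_ A A).hom ▷ A ≫ (α_ A A A).hom ≫
      (𝟙 A ⊗ₘ (nakayamaSign A k ⊗ₘ nakayama A) ≫ μ[A]) ≫ μ[A] := by
    rw [h5, Iso.hom_inv_id_assoc, ← tensorHom_id, tensorHom_comp_tensorHom_assoc, Category.id_comp,
      twistMul]
  have h7 : cupFront A (frobCopairing A (-s)) A ≫ (β_ A (A ⊗ A)).hom ≫ (β_ A A).hom ▷ A ≫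
      (α_ A A A).hom = (ρ_ A).inv ≫ A ◁ frobCopairing A s := by
    have e1 : (α_ A A A).hom ≫ (β_ A (A ⊗ A)).hom ≫ (β_ A A).hom ▷ A ≫ (α_ A A A).hom =
        (β_ (A ⊗ A) A).hom ≫ A ◁ (β_ A A).hom := by
      have e := congrArg (fun f => (α_ A A A).hom ≫ f ≫ A ◁ (β_ A A).hom)
        (braiding_comp_braiding A A A)
      simpa [← MonoidalCategory.whiskerLeft_comp] using e
    have e2 := unit_braiding (X := A) (frobCopairing A (-s))
    rw [cupFront, Category.assoc, Category.assoc, e1, comp_eq₂ e2, Category.assoc, Category.assoc,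
      SymmetricCategory.symmetry_assoc, ← MonoidalCategory.whiskerLeft_comp, frobCopairing_braiding,
      neg_neg]
  have h8 := congrArg (fun f => f ≫ (𝟙 A ⊗ₘ (nakayamaSign A k ⊗ₘ nakayama A) ≫ μ[A]) ≫ μ[A] ≫ ε[A])
    h7
  simp only [Category.assoc] at h8
  rw [← id_tensorHom, h4, Category.id_comp, frobPairing, ← Category.assoc (_ ⊗ₘ _) μ[A], h6]
  simp only [Category.assoc]
  rw [h8, id_tensorHom, ← MonoidalCategory.whiskerLeft_comp_assoc, h3]
  simp

end TwistedProducts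

/-! ### Chains of corners contracted around a vertex -/

section Chains

set_option linter.unusedSectionVars false

open TensorFamily LabelledForm

variable {C : Type u} [Category.{v} C] [MonoidalCategory C] [SymmetricCategory C]
  (A : C) [MonObj A] [ComonObj A] (L : Type w)

/-- The data of a functional `ε(x g(y) N^p(z))` with labelled arguments, together with the sign of
a copairing whose second factor is to be inserted for `x`. -/
structure Corner where
  /-- The label of `x`. -/
  out : L
  /-- The label of `z`. -/
  inn : L
  /-- The number of the other arguments. -/
  len : ℕ
  /-- The labels of the other arguments. -/
  word : Fin len → L
  /-- The dependence on the other arguments. -/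
  coeff : tensorPow A len ⟶ A
  /-- The twist of `z`. -/
  twist : ℤˣ
  /-- The sign of the copairing. -/
  sign : ℤˣ

variable {A L}

/-- The functional of a corner. -/
def Corner.form (f : Corner A L) : LabelledForm A L :=
  LabelledForm.mk (Fin.cons f.out (Fin.cons f.inn f.word : Fin (f.len + 1) → L) : Fin (f.len + 2) → L)
    (A ◁ twistMul f.coeff f.twist ≫ frobPairing A)

lemma whiskerLeft_effect {Z W W' : C} (κ : Z ⟶ 𝟙_ C) (x : W ⟶ W') :
    Z ◁ x ≫ κ ▷ W' ≫ (λ_ W').hom = κ ▷ W ≫ (λ_ W).hom ≫ x := by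
  rw [whisker_exchange_assoc, leftUnitor_naturality]

/-- The number of arguments of a chain of corners. -/
@[reducible]
def chainLen : List (Corner A L) → ℕ
  | [] => 0
  | f :: fs => chainLen fs + f.len + 2

/-- The labels of the arguments of a chain of corners. -/
def chainWord : ∀ fs : List (Corner A L), Fin (chainLen fs) → L
  | [] => Fin.elim0
  | f :: fs => (Fin.cons f.out (Fin.cons f.inn (catWord f.word (chainWord fs)) :
      Fin (chainLen fs + f.len + 1) → L) : Fin (chainLen fs + f.len + 2) → L)

/-- The product of the functionals of a chain of corners. -/
def chainForm : ∀ fs : List (Corner A L), tensorPow A (chainLen fs) ⟶ 𝟙_ C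
  | [] => 𝟙 _
  | f :: fs => A ◁ (A ◁ inv (tensorPowJoin A (chainLen fs) f.len) ≫
      (α_ A (tensorPow A f.len) (tensorPow A (chainLen fs))).inv ≫
        (twistMul f.coeff f.twist ⊗ₘ chainForm fs) ≫ (ρ_ A).hom) ≫ frobPairing A

/-- `chainForm` keeps the tail of the chain inside the argument of the pairing, as the zigzag lemma
requires; up to a permutation of factors it is nevertheless just the product. -/
lemma mk_chainForm (fs : List (Corner A L)) :
    mk (chainWord fs) (chainForm fs) = (fs.map Corner.form).prod := by
  induction fs with
  | nil => rfl
  | cons f fs ih =>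
    rw [List.map_cons, List.prod_cons, ← ih, Corner.form]
    symm
    refine mk_mul_mk_eq (u := chainWord (f :: fs)) (χ := chainForm (f :: fs))
      ((PermRel.refl (A := A) _ _).congr rfl rfl rfl ?_) ?_
    · rw [catWord_cons, catWord_cons]
      rfl
    · have h : tensorPowJoin A (chainLen fs) (f.len + 2) ≫
          A ◁ (A ◁ inv (tensorPowJoin A (chainLen fs) f.len)) =
          (α_ A (A ⊗ tensorPow A f.len) (tensorPow A (chainLen fs))).hom ≫
            A ◁ (α_ A (tensorPow A f.len) (tensorPow A (chainLen fs))).hom := by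
        simp [tensorPowJoin, ← MonoidalCategory.whiskerLeft_comp]
      rw [chainForm, MonoidalCategory.whiskerLeft_comp, Category.assoc, comp_eq₂ h]
      simp [MonoidalCategory.tensorHom_def', unitors_equal]

/-- The label of the last argument of a chain. -/
def lastInn (a : L) : List (Corner A L) → L
  | [] => a
  | f :: fs => lastInn f.inn fs

/-- The labels which are contracted along a chain. -/
def chainLabels (a : L) : List (Corner A L) → Multiset L
  | [] => 0
  | f :: fs => a ::ₘ f.out ::ₘ chainLabels f.inn fs

/-- The sign of a chain. -/
def chainSign : List (Corner A L) → ℤˣ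
  | [] => 1
  | f :: fs => f.twist * -f.sign * chainSign fs

/-- The contractions along a chain. -/
def contractChain {Z Y : C} (a : L) : List (Corner A L) → TensorFamily A L Z Y → TensorFamily A L Z Y
  | [], F => F
  | f :: fs, F => contractChain f.inn fs (contract (frobCopairing A f.sign) a f.out F)

variable {Z Y : C}

lemma isSymm_contractChain {F : TensorFamily A L Z Y} (hF : F.IsSymm) (a : L)
    (fs : List (Corner A L)) : (contractChain a fs F).IsSymm := by
  induction fs generalizing a F with
  | nil => exact hF
  | cons f fs ih => exact ih (hF.contract _ _ _) _

lemma contractChain_shift {F : TensorFamily A L Z Y} (hF : F.IsSymm) (a : L)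
    (fs : List (Corner A L)) (x : L) :
    contractChain a fs (F.shift x) = (contractChain a fs F).shift x := by
  induction fs generalizing a F with
  | nil => rfl
  | cons f fs ih => rw [contractChain, hF.contract_shift, ih (hF.contract _ _ _), contractChain]

lemma contractChain_shiftBlock {F : TensorFamily A L Z Y} (hF : F.IsSymm) (a : L)
    (fs : List (Corner A L)) {k : ℕ} (x : Fin k → L) :
    contractChain a fs (F.shiftBlock x) = (contractChain a fs F).shiftBlock x := by
  induction fs generalizing a F with
  | nil => rfl
  | cons f fs ih => rw [contractChain, hF.contract_shiftBlock, ih (hF.contract _ _ _), contractChain]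

variable [IsFrobeniusObj A]

/-- A value of a family is the product of a functional with a twisted product which is inserted into
a further functional. -/
def IsTwistMul (F : TensorFamily A L Z Y) (y : Z ⊗ A ⟶ Y) (a : L) {k : ℕ} (v : Fin k → L)
    (U : tensorPow A k ⟶ A) (t : ℤˣ) {m : ℕ} (w : Fin m → L) (S : tensorPow A m ⟶ 𝟙_ C) : Prop :=
  Z ◁ A ◁ tensorPowJoin A m k ≫ F (m + k + 1) (Fin.cons a (catWord v w) : Fin (m + k + 1) → L) =
    Z ◁ ((α_ A (tensorPow A k) (tensorPow A m)).inv ≫ (twistMul U t ⊗ₘ S) ≫ (ρ_ A).hom) ≫ y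

/-- One contraction absorbs the head of the chain into the coefficient `U` and leaves a twisted
product in the argument `f.inn`. The exponent changes by the factor `f.twist * -f.sign`, the
contribution of `f` to `chainSign`. -/
lemma IsTwistMul.contract (hN : nakayama A ≫ nakayama A = 𝟙 A) {F : TensorFamily A L Z Y}
    (hF : F.IsSymm) {y : Z ⊗ A ⟶ Y} {a : L} {k : ℕ} {v : Fin k → L} {U : tensorPow A k ⟶ A} {t : ℤˣ}
    {f : Corner A L} {fs : List (Corner A L)}
    (h : IsTwistMul F y a v U t (chainWord (f :: fs)) (chainForm (f :: fs))) :
    IsTwistMul (contract (frobCopairing A f.sign) a f.out F) y f.inn (catWord v f.word)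
      (inv (tensorPowJoin A f.len k) ≫ (U ⊗ₘ (f.coeff ≫ nakayamaSign A (-f.sign * t))) ≫ μ[A])
      (f.twist * (-f.sign * t)) (chainWord fs) (chainForm fs) := by
  have h1 := (((PermRel.assoc (A := A) v f.word (chainWord fs)).cons f.inn).cons f.out)
  have h2 := ((PermRel.past (A := A) f.inn v (catWord f.word (chainWord fs))).precomp
    (A ◁ ((α_ _ _ _).hom ≫ tensorPow A k ◁ tensorPowJoin A (chainLen fs) f.len))).cons f.out
  have h3 := (PermRel.past (A := A) f.out v
    (Fin.cons f.inn (catWord f.word (chainWord fs)) : Fin (chainLen fs + f.len + 1) → L)).precomp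
    (A ◁ (A ◁ ((α_ _ _ _).hom ≫ tensorPow A k ◁ tensorPowJoin A (chainLen fs) f.len) ≫
      exch A (tensorPow A k) (tensorPow A (chainLen fs + f.len))))
  have h4 := (h1.trans (h2.congr (by simp) rfl rfl rfl)).trans
    (h3.congr (by simp only [MonoidalCategory.whiskerLeft_comp, Category.assoc]) rfl rfl rfl)
  have h5 := hF.eq ((h4.cons a).precomp (cupFront A (frobCopairing A f.sign) _))
  rw [IsTwistMul] at h ⊢
  rw [← cancel_epi (Z ◁ A ◁ (tensorPowJoin A f.len k ▷ tensorPow A (chainLen fs)))]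
  have h6 := cupFront_twistMul_chain hN f.sign U t f.coeff f.twist (chainForm fs)
  have h8 : Z ◁ A ◁ (tensorPowJoin A f.len k ▷ tensorPow A (chainLen fs)) ≫
      Z ◁ A ◁ tensorPowJoin A (chainLen fs) (f.len + k) ≫
        TensorFamily.contract (frobCopairing A f.sign) a f.out F _
          (Fin.cons f.inn (catWord (catWord v f.word) (chainWord fs)) :
            Fin (chainLen fs + (f.len + k) + 1) → L) =
      Z ◁ (cupFront A (frobCopairing A f.sign)
        (A ⊗ ((tensorPow A k ⊗ tensorPow A f.len) ⊗ tensorPow A (chainLen fs))) ≫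
          A ◁ (A ◁ (A ◁ ((α_ _ _ _).hom ≫ tensorPow A k ◁ tensorPowJoin A (chainLen fs) f.len) ≫
            exch A (tensorPow A k) (tensorPow A (chainLen fs + f.len))) ≫
              exch A (tensorPow A k) (tensorPow A (chainLen fs + f.len + 1)))) ≫
        Z ◁ ((α_ A (tensorPow A k) (tensorPow A (chainLen (f :: fs)))).inv ≫
          (twistMul U t ⊗ₘ chainForm (f :: fs)) ≫ (ρ_ A).hom) ≫ y := by
    rw [← h]
    have e := cupFront_naturality (frobCopairing A f.sign)
      (A ◁ (tensorPowJoin A f.len k ▷ tensorPow A (chainLen fs) ≫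
        tensorPowJoin A (chainLen fs) (f.len + k)))
    have e2 := congrArg (fun x => Z ◁ x ≫ F (chainLen fs + (f.len + k) + 3)
      (Fin.cons a (Fin.cons f.out (Fin.cons f.inn
        (catWord (catWord v f.word) (chainWord fs)) : Fin (chainLen fs + (f.len + k) + 1) → L) :
          Fin (chainLen fs + (f.len + k) + 2) → L) : Fin (chainLen fs + (f.len + k) + 3) → L)) e
    simp only [MonoidalCategory.whiskerLeft_comp, Category.assoc] at e2 h5 ⊢
    rw [TensorFamily.contract]
    exact e2.trans h5
  have h9 := exch_naturality_right A (tensorPow A k) (tensorPowJoin A (chainLen fs) f.len)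
  have h10 := exch_naturality_right A (tensorPow A k) (A ◁ tensorPowJoin A (chainLen fs) f.len)
  have h11 : A ◁ (A ◁ (A ◁ ((α_ _ _ _).hom ≫ tensorPow A k ◁ tensorPowJoin A (chainLen fs) f.len) ≫
      exch A (tensorPow A k) (tensorPow A (chainLen fs + f.len))) ≫
        exch A (tensorPow A k) (tensorPow A (chainLen fs + f.len + 1))) =
      A ◁ (A ◁ (A ◁ (α_ _ _ _).hom ≫ exch A (tensorPow A k) _) ≫ exch A (tensorPow A k) _) ≫
        A ◁ tensorPow A k ◁ A ◁ A ◁ tensorPowJoin A (chainLen fs) f.len := by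
    have e := congrArg (fun x => A ◁ A ◁ A ◁ (α_ _ _ _).hom ≫ A ◁ A ◁ x ≫
      A ◁ exch A (tensorPow A k) (tensorPow A (chainLen fs + f.len + 1))) h9
    have e2 := congrArg (fun x => A ◁ A ◁ (A ◁ (α_ _ _ _).hom ≫ exch A (tensorPow A k) _) ≫
      A ◁ x) h10
    simp only [MonoidalCategory.whiskerLeft_comp, Category.assoc] at e e2 ⊢
    exact e.trans e2
  have h12 : A ◁ tensorPow A k ◁ A ◁ A ◁ tensorPowJoin A (chainLen fs) f.len ≫
      (α_ A (tensorPow A k) (tensorPow A (chainLen (f :: fs)))).inv ≫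
          (twistMul U t ⊗ₘ chainForm (f :: fs)) ≫ (ρ_ A).hom =
      (α_ A (tensorPow A k) _).inv ≫ (twistMul U t ⊗ₘ (A ◁ ((α_ _ _ _).inv ≫
        (twistMul f.coeff f.twist ⊗ₘ chainForm fs) ≫ (ρ_ A).hom) ≫ frobPairing A)) ≫ (ρ_ A).hom := by
    rw [associator_inv_naturality_right_assoc, ← id_tensorHom, tensorHom_comp_tensorHom_assoc,
      Category.id_comp, chainForm, ← MonoidalCategory.whiskerLeft_comp_assoc,
      ← MonoidalCategory.whiskerLeft_comp_assoc, IsIso.hom_inv_id, MonoidalCategory.whiskerLeft_id,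
      Category.id_comp]
  have h13 : A ◁ (tensorPowJoin A f.len k ▷ tensorPow A (chainLen fs)) ≫
      (α_ A (tensorPow A (f.len + k)) (tensorPow A (chainLen fs))).inv ≫
        (twistMul (inv (tensorPowJoin A f.len k) ≫
          (U ⊗ₘ (f.coeff ≫ nakayamaSign A (-f.sign * t))) ≫ μ[A]) (f.twist * (-f.sign * t)) ⊗ₘ
            chainForm fs) ≫ (ρ_ A).hom =
      (α_ _ _ _).inv ≫ (twistMul ((U ⊗ₘ (f.coeff ≫ nakayamaSign A (-f.sign * t))) ≫ μ[A])
        (f.twist * (-f.sign * t)) ⊗ₘ chainForm fs) ≫ (ρ_ A).hom := by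
    rw [associator_inv_naturality_middle_assoc, ← tensorHom_id, tensorHom_comp_tensorHom_assoc,
      Category.id_comp, whiskerLeft_twistMul, IsIso.hom_inv_id_assoc]
  rw [h8, h11, ← MonoidalCategory.whiskerLeft_comp_assoc, ← MonoidalCategory.whiskerLeft_comp_assoc]
  simp only [Category.assoc]
  rw [h12, h13, h6]

/-- Only the total exponent matters, so the accumulated coefficient is left existential. The
identity of multisets records which labels survive, so that the resulting word can later be
recognised up to order. -/
lemma exists_contractChain (hN : nakayama A ≫ nakayama A = 𝟙 A) {F : TensorFamily A L Z Y}
    (hF : F.IsSymm) {y : Z ⊗ A ⟶ Y} (fs : List (Corner A L)) {a : L} {k : ℕ} {v : Fin k → L}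
    {U : tensorPow A k ⟶ A} {t : ℤˣ}
    (h : IsTwistMul F y a v U t (chainWord fs) (chainForm fs)) :
    ∃ (l : ℕ) (u : Fin l → L) (U' : tensorPow A l ⟶ A),
      contractChain a fs F (l + 1) (Fin.cons (lastInn a fs) u : Fin (l + 1) → L) =
        Z ◁ twistMul U' (t * chainSign fs) ≫ y ∧
      chainLabels a fs + lastInn a fs ::ₘ letters u =
        a ::ₘ (letters v + letters (chainWord fs)) := by
  induction fs generalizing F a k v U t with
  | nil =>
    refine ⟨k, v, U, ?_, ?_⟩
    · have h1 := hF.eq ((PermRel.nil_right (A := A) v (Fin.elim0 : Fin 0 → L)).cons a)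
      have h2 := congrArg (fun f => Z ◁ A ◁ (ρ_ (tensorPow A k)).inv ≫ f) (h1.symm.trans h)
      have h3 : chainForm ([] : List (Corner A L)) = 𝟙 _ := rfl
      simp only [h3, tensorHom_id, ← MonoidalCategory.whiskerLeft_comp_assoc,
        ← MonoidalCategory.whiskerLeft_comp, Iso.inv_hom_id, MonoidalCategory.whiskerLeft_id,
        Category.id_comp] at h2
      rw [chainSign, mul_one]
      refine h2.trans ?_
      congr 2
      simp
    · simp [chainLabels, lastInn]
  | cons f fs ih =>
    obtain ⟨l, u, U', h1, h2⟩ := ih (hF.contract _ _ _) (h.contract hN hF)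
    refine ⟨l, u, U', ?_, ?_⟩
    · rw [contractChain, lastInn, h1, chainSign]
      congr 3
      ac_rfl
    · have h3 : letters (chainWord (f :: fs)) =
          f.out ::ₘ f.inn ::ₘ (letters f.word + letters (chainWord fs)) := by
        rw [← letters_catWord, ← letters_cons, ← letters_cons]
        rfl
      rw [letters_catWord] at h2
      rw [chainLabels, lastInn, Multiset.cons_add, Multiset.cons_add, h2, h3]
      simp only [← Multiset.singleton_add]
      ac_rfl

/-- The members of a family vanish unless their labels together with `T` are the labels in `m`. -/
def IsSupported [Preadditive C] (F : TensorFamily A L Z Y) (T m : Multiset L) : Prop :=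
  ∀ (n : ℕ) (w : Fin n → L), T + letters w ≠ m → F n w = 0

lemma IsSupported.contract [Preadditive C] {F : TensorFamily A L Z Y} {T m : Multiset L}
    (h : IsSupported F T m) (c : 𝟙_ C ⟶ A ⊗ A) (a b : L) :
    IsSupported (contract c a b F) (a ::ₘ b ::ₘ T) m := by
  intro n w hw
  rw [TensorFamily.contract, h, Limits.comp_zero]
  intro h2
  apply hw
  rw [← h2, letters_cons, letters_cons]
  simp only [← Multiset.singleton_add]
  ac_rfl

lemma isSupported_contractChain [Preadditive C] {F : TensorFamily A L Z Y} {T m : Multiset L}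
    (h : IsSupported F T m) (a : L) (fs : List (Corner A L)) :
    IsSupported (contractChain a fs F) (chainLabels a fs + T) m := by
  induction fs generalizing F a T with
  | nil => simpa [chainLabels, contractChain] using h
  | cons f fs ih =>
    have h2 := ih (h.contract (frobCopairing A f.sign) a f.out) f.inn
    refine (congrArg (fun t => IsSupported _ t m) ?_).mpr h2
    change a ::ₘ f.out ::ₘ chainLabels f.inn fs + T = _
    simp only [← Multiset.singleton_add]
    ac_rfl

/-- The contraction of a closed chain of corners vanishes if the total sign is `1`. -/
lemma contract_contractChain_eq_zero [Preadditive C] [MonoidalPreadditive C]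
    (hN : nakayama A ≫ nakayama A = 𝟙 A) (hconv : frobConv A (nakayama A) (𝟙 A) = 0)
    (f : Corner A L) (fs : List (Corner A L)) (q : LabelledForm A L)
    (hq : (q * ((f :: fs).map Corner.form).prod).labels.Nodup)
    (hsign : chainSign (f :: fs) = 1) :
    contract (frobCopairing A f.sign) (lastInn f.inn fs) f.out (contractChain f.inn fs
      (toFamily (q * ((f :: fs).map Corner.form).prod))) = fun _ _ => 0 := by
  set p := q * ((f :: fs).map Corner.form).prod with hp
  have hsymm := isSymm_toFamily p
  have hsupp : IsSupported (toFamily p) 0 p.labels := by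
    intro n w hw
    exact toFamily_eq_zero (by rwa [zero_add, ne_comm] at hw)
  have hsupp' := (isSupported_contractChain hsupp f.inn fs).contract (frobCopairing A f.sign)
    (lastInn f.inn fs) f.out
  have hsymm' := (isSymm_contractChain hsymm f.inn fs).contract (frobCopairing A f.sign)
    (lastInn f.inn fs) f.out
  obtain ⟨r, v, θ, rfl⟩ : ∃ (r : ℕ) (v : Fin r → L) (θ : tensorPow A r ⟶ 𝟙_ C),
      q = LabelledForm.mk v θ := by
    induction q using LabelledForm.ind with | _ n w φ => exact ⟨n, w, φ, rfl⟩
  have hp2 : p = LabelledForm.mk (catWord v (chainWord (f :: fs)))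
      (tensorForm θ (chainForm (f :: fs))) := by
    rw [hp, ← mk_chainForm, mk_mul_mk]
  -- The factors of `q` and the still open argument `f.out` of the first corner are parked in the
  -- parameter object. What remains is the twisted product of the first corner followed by the rest
  -- of the chain.
  have h1 : IsTwistMul (((toFamily p).shiftBlock v).shift f.out)
      ((α_ _ _ _).hom ≫ ((λ_ _).hom ≫ θ) ▷ (A ⊗ A) ≫ (λ_ (A ⊗ A)).hom ≫ frobPairing A)
      f.inn f.word f.coeff f.twist (chainWord fs) (chainForm fs) := by
    have h2 := toFamily_mk (w := catWord v (chainWord (f :: fs))) (by rwa [hp2] at hq)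
      (tensorForm θ (chainForm (f :: fs)))
    have h3 : (toFamily p).shiftBlock v _ (chainWord (f :: fs)) =
        (α_ _ _ _).hom ≫ (λ_ _).hom ≫ (θ ⊗ₘ chainForm (f :: fs)) ≫ (λ_ (𝟙_ C)).hom := by
      rw [shiftBlock, hp2, h2, leftUnitor_naturality_assoc, join_tensorForm]
    have h4 : ((toFamily p).shiftBlock v).shift f.out _
        (Fin.cons f.inn (catWord f.word (chainWord fs)) : Fin (chainLen fs + f.len + 1) → L) =
        (α_ _ _ _).hom ≫ (α_ _ _ _).hom ≫ (λ_ _).hom ≫ (θ ⊗ₘ chainForm (f :: fs)) ≫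
          (λ_ (𝟙_ C)).hom := by
      rw [shift]
      exact congrArg (fun x => (α_ _ _ _).hom ≫ x) h3
    rw [IsTwistMul, h4, chainForm]
    have h5 : ∀ W : C, (α_ _ _ _).hom ≫ (λ_ (tensorPow A r ⊗ W)).hom ≫ θ ▷ W =
        ((λ_ (tensorPow A r)).hom ≫ θ) ▷ W := by
      intro W
      simp
    simp only [MonoidalCategory.tensorHom_def, Category.assoc, leftUnitor_naturality]
    rw [comp_eq₃ (h5 _)]
    generalize (λ_ (tensorPow A r)).hom ≫ θ = κ
    rw [associator_naturality_right_assoc, associator_naturality_right_assoc,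
      comp_eq₃ (whiskerLeft_effect _ _), comp_eq₃ (whiskerLeft_effect _ _)]
    simp only [Category.assoc, MonoidalCategory.whiskerLeft_comp]
    rw [← MonoidalCategory.whiskerLeft_comp_assoc A, ← MonoidalCategory.whiskerLeft_comp A,
      IsIso.hom_inv_id]
    simp only [MonoidalCategory.whiskerLeft_id, Category.id_comp]
  obtain ⟨l, u, U, h2, h3⟩ := exists_contractChain hN ((hsymm.shiftBlock v).shift f.out) fs h1
  rw [contractChain_shift (hsymm.shiftBlock v), contractChain_shiftBlock hsymm] at h2
  have h4 : contract (frobCopairing A f.sign) (lastInn f.inn fs) f.out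
      ((contractChain f.inn fs (toFamily p)).shiftBlock v) l u = 0 := by
    -- Putting `f.out` first turns c_s into c_{-s}, the form in which the cycle closes. The
    -- accumulated exponent is `f.twist * chainSign fs`, so the condition k = -s is `chainSign (f ::
    -- fs) = 1`.
    rw [((isSymm_contractChain hsymm f.inn fs).shiftBlock v).contract_comm, frobCopairing_braiding]
    have h5 := cupFront_twistMul_eq_zero hN hconv (k := f.twist * chainSign fs) (s := f.sign)
      (by rw [← hsign, chainSign]; ac_rfl) U
    rw [shift, ← cancel_epi (α_ _ _ _).inv, Iso.inv_hom_id_assoc] at h2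
    rw [TensorFamily.contract, h2]
    have h6 := congrArg (fun x => (𝟙_ C ⊗ tensorPow A r) ◁ x ≫
      ((λ_ (tensorPow A r)).hom ≫ θ) ▷ 𝟙_ C ≫ (λ_ _).hom) h5
    simp only [MonoidalPreadditive.whiskerLeft_zero, Limits.zero_comp] at h6
    rw [← h6]
    generalize (λ_ (tensorPow A r)).hom ≫ θ = κ
    rw [associator_naturality_right_assoc, Iso.inv_hom_id_assoc, comp_eq₃ (whiskerLeft_effect _ _),
      Category.assoc, Category.assoc, comp_eq₃ (whiskerLeft_effect _ _), whiskerLeft_effect]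
    simp only [Category.assoc]
  rw [(isSymm_contractChain hsymm f.inn fs).contract_shiftBlock] at h4
  funext n w
  -- A word with the right letters is a rearrangement of `catWord v u`, so symmetry reduces it to
  -- `h4`; on any other word the family vanishes by its support.
  by_cases hw : lastInn f.inn fs ::ₘ f.out ::ₘ (chainLabels f.inn fs + 0) + letters w = p.labels
  · obtain ⟨e, rfl⟩ : ∃ e : Fin n ≃ Fin _, w = catWord v u ∘ e := by
      apply exists_equiv_of_letters_eq
      rw [hp2, labels_mk, letters_catWord, chainWord, letters_cons, letters_cons, letters_catWord,
        ← h3] at hw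
      rw [letters_catWord]
      simp only [← Multiset.singleton_add] at hw
      refine add_left_cancel (a := {lastInn f.inn fs} + {f.out} + chainLabels f.inn fs) ?_
      refine Eq.trans ?_ (hw.trans ?_)
      · abel
      · abel
    rw [← hsymm']
    have h5 : contract (frobCopairing A f.sign) (lastInn f.inn fs) f.out
        (contractChain f.inn fs (toFamily p)) (l + r) (catWord v u) = 0 := by
      rw [shiftBlock, ← cancel_epi (α_ _ _ _).inv, Iso.inv_hom_id_assoc,
        ← cancel_epi (inv (𝟙_ C ◁ tensorPowJoin A l r)), IsIso.inv_hom_id_assoc] at h4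
      simpa using h4
    rw [h5, Limits.comp_zero]
  · exact hsupp' n w hw

end Chains

/-! ### Faces with labelled edges and their corners -/

section Faces

set_option linter.unusedSectionVars false

open TensorFamily LabelledForm

variable {C : Type u} [Category.{v} C] [MonoidalCategory C] [SymmetricCategory C]

lemma associator_braiding (X Y Z : C) :
    (α_ X Y Z).inv ≫ (β_ (X ⊗ Y) Z).hom = X ◁ (β_ Y Z).hom ≫ exch X Z Y := by
  simp [exch]

lemma corner_zero_perm (X A : C) :
    exch X A (A ⊗ A) ≫ A ◁ (α_ X A A).inv ≫ A ◁ (β_ (X ⊗ A) A).hom =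
      X ◁ A ◁ (β_ A A).hom ≫ exch X A (A ⊗ A) ≫ A ◁ exch X A A := by
  rw [← MonoidalCategory.whiskerLeft_comp, associator_braiding, comp_eq₂ (exch_naturality_right _ _ _)]
  simp

lemma corner_one_perm (X A : C) :
    (α_ X A (A ⊗ A)).inv ≫ (β_ (X ⊗ A) (A ⊗ A)).hom ≫ (α_ A A (X ⊗ A)).hom ≫
      A ◁ (α_ A X A).inv ≫ A ◁ (β_ (A ⊗ X) A).hom =
    X ◁ exch A A A ≫ exch X A (A ⊗ A) ≫ A ◁ exch X A A ≫ A ◁ A ◁ (β_ X A).hom := by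
  have h := congrArg (fun f => X ◁ exch A A A ≫ (α_ X A (A ⊗ A)).inv ≫ (β_ X A).hom ▷ (A ⊗ A) ≫
    (α_ A X (A ⊗ A)).hom ≫ A ◁ (X ◁ (β_ A A).hom ≫ f)) (BraidedCategory.yang_baxter X A A)
  rw [← MonoidalCategory.whiskerLeft_comp_assoc X, SymmetricCategory.symmetry] at h
  simpa [exch] using h

lemma corner_two_perm (X A : C) :
    X ◁ (α_ A A A).inv ≫ (α_ X (A ⊗ A) A).inv ≫ (α_ X A A).inv ▷ A ≫
      (β_ ((X ⊗ A) ⊗ A) A).hom ≫ A ◁ (β_ (X ⊗ A) A).hom =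
    X ◁ A ◁ (β_ A A).hom ≫ X ◁ exch A A A ≫ X ◁ A ◁ (β_ A A).hom ≫ exch X A (A ⊗ A) ≫
      A ◁ exch X A A := by
  rw [comp_eq₂ (exch_naturality_right _ _ _)]
  simp [exch]

variable {L : Type w}

/-- A word with three letters. -/
def tripleWord (x y z : L) : Fin 3 → L :=
  (Fin.cons x (Fin.cons y (Fin.cons z Fin.elim0 : Fin 1 → L) : Fin 2 → L) : Fin 3 → L)

/-- A word with one letter. -/
def singleWord (x : L) : Fin 1 → L := Fin.cons x Fin.elim0

variable (A : C)

/-- Append three factors to a tensor power. -/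
def joinTriple (r : ℕ) : tensorPow A r ⊗ (A ⊗ (A ⊗ A)) ⟶ tensorPow A (3 + r) :=
  tensorPow A r ◁ A ◁ A ◁ (ρ_ A).inv ≫ tensorPowJoin A 3 r

/-- Append one factor to a tensor power. -/
def joinSingle (r : ℕ) : tensorPow A r ⊗ A ⟶ tensorPow A (1 + r) :=
  tensorPow A r ◁ (ρ_ A).inv ≫ tensorPowJoin A 1 r

instance (r : ℕ) : IsIso (joinTriple A r) := by
  unfold joinTriple
  exact inferInstanceAs (IsIso (tensorPow A r ◁ A ◁ A ◁ (ρ_ A).inv ≫ tensorPowJoin A 3 r))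

instance (r : ℕ) : IsIso (joinSingle A r) := by
  unfold joinSingle
  exact inferInstanceAs (IsIso (tensorPow A r ◁ (ρ_ A).inv ≫ tensorPowJoin A 1 r))

variable {A}

lemma permRel_joinTriple_swap_left {r : ℕ} (v : Fin r → L) (x y z : L) :
    PermRel A (joinTriple A r) (catWord v (tripleWord x y z))
      (tensorPow A r ◁ exch A A A ≫ joinTriple A r) (catWord v (tripleWord y x z)) := by
  have h := ((PermRel.swap (A := A) x y (singleWord z)).whiskerLeft v).precomp
    (tensorPow A r ◁ A ◁ A ◁ (ρ_ A).inv)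
  refine h.congr ?_ rfl ?_ rfl
  · simp [joinTriple]
  · have e := congrArg (fun f => tensorPow A r ◁ f) (exch_naturality_right A A (ρ_ A).inv)
    simp only [MonoidalCategory.whiskerLeft_comp] at e
    rw [joinTriple, comp_eq₂ e, Category.assoc]

lemma permRel_joinTriple_swap_right {r : ℕ} (v : Fin r → L) (x y z : L) :
    PermRel A (joinTriple A r) (catWord v (tripleWord x y z))
      (tensorPow A r ◁ A ◁ (β_ A A).hom ≫ joinTriple A r) (catWord v (tripleWord x z y)) := by
  have h := (((PermRel.swap (A := A) y z (Fin.elim0 : Fin 0 → L)).cons x).whiskerLeft v).precomp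
    (tensorPow A r ◁ A ◁ A ◁ (ρ_ A).inv)
  refine h.congr ?_ rfl ?_ rfl
  · simp [joinTriple]
  · have e : A ◁ (ρ_ A).inv ≫ exch A A (𝟙_ C) = (β_ A A).hom ≫ A ◁ (ρ_ A).inv := by
      rw [exch_unit_right]
      simp
    have e2 := congrArg (fun f => tensorPow A r ◁ A ◁ f) e
    simp only [MonoidalCategory.whiskerLeft_comp] at e2
    rw [joinTriple, comp_eq₂ e2, Category.assoc]

lemma PermRel.past_symm {k m : ℕ} (a : L) (v : Fin k → L) (w : Fin m → L) :
    PermRel A (n' := m + k + 1) (tensorPowJoin A (m + 1) k)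
      (catWord v (Fin.cons a w : Fin (m + 1) → L)) (exch (tensorPow A k) A (tensorPow A m) ≫ A ◁ tensorPowJoin A m k)
      (Fin.cons a (catWord v w) : Fin (m + k + 1) → L) := by
  have h := ((PermRel.past (A := A) a v w).precomp (exch (tensorPow A k) A (tensorPow A m))).symm
  refine h.congr ?_ rfl rfl rfl
  rw [comp_eq₂ (exch_exch _ _ _), Category.id_comp]

lemma permRel_joinTriple_front {r : ℕ} (v : Fin r → L) (x y z : L) :
    PermRel A (n' := 1 + r + 2) (joinTriple A r) (catWord v (tripleWord x y z))
      (exch (tensorPow A r) A (A ⊗ A) ≫ A ◁ exch (tensorPow A r) A A ≫ A ◁ A ◁ joinSingle A r)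
      (Fin.cons x (Fin.cons y (catWord v (singleWord z)) : Fin (1 + r + 1) → L) :
        Fin (1 + r + 2) → L) := by
  have h1 := (PermRel.past_symm (A := A) x v
    (Fin.cons y (singleWord z) : Fin 2 → L)).precomp (tensorPow A r ◁ A ◁ A ◁ (ρ_ A).inv)
  have h2 := ((PermRel.past_symm (A := A) y v (singleWord z)).cons x).precomp
    (tensorPow A r ◁ A ◁ A ◁ (ρ_ A).inv ≫ exch (tensorPow A r) A _)
  refine (h1.trans (h2.congr (by simp) rfl rfl rfl)).congr rfl rfl ?_ rfl
  have e1 := exch_naturality_right (tensorPow A r) A (A ◁ (ρ_ A).inv)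
  have e2 := congrArg (fun f => A ◁ f) (exch_naturality_right (tensorPow A r) A (ρ_ A).inv)
  simp only [MonoidalCategory.whiskerLeft_comp] at e1 e2
  simp only [joinSingle, MonoidalCategory.whiskerLeft_comp, Category.assoc]
  rw [comp_eq₂ e1, Category.assoc, comp_eq₂ e2, Category.assoc]

variable [MonObj A] [ComonObj A]

/-- The functional `ε(a z₀ z₁ z₂)` with labelled arguments. -/
def labelledFace {r : ℕ} (v : Fin r → L) (a : tensorPow A r ⟶ A) (z : Fin 3 → L) :
    LabelledForm A L :=
  mk (catWord v (tripleWord (z 0) (z 1) (z 2))) (inv (joinTriple A r) ≫ faceForm a)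

/-- The dependence of the functional of a face on the arguments which do not belong to the two edges
at a corner. -/
def cornerCoeff {X : C} (a : X ⟶ A) (t : ℤˣ) : Fin 3 → (X ⊗ A ⟶ A)
  | 0 => (a ⊗ₘ 𝟙 A) ≫ μ[A] ≫ nakayamaSign A t
  | 1 => (β_ X A).hom ≫ (𝟙 A ⊗ₘ (a ≫ nakayama A)) ≫ μ[A]
  | 2 => (a ⊗ₘ 𝟙 A) ≫ μ[A] ≫ nakayama A

/-- The corner with the number `k` of a face. -/
def faceCorner {r : ℕ} (v : Fin r → L) (a : tensorPow A r ⟶ A) (t : ℤˣ) (z : Fin 3 → L) (s : ℤˣ)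
    (k : Fin 3) : Corner A L where
  out := z k
  inn := z (k + 2)
  len := 1 + r
  word := catWord v (singleWord (z (k + 1)))
  coeff := inv (joinSingle A r) ≫ cornerCoeff a t k
  twist := if k = 0 then t else -1
  sign := s

variable [IsFrobeniusObj A]

/-- Separates bookkeeping from algebra: `π` reorders the three edge factors so that the two
belonging to the corner come first, and only an identity between unlabelled functionals is left to
check. -/
lemma labelledFace_eq_form_aux {r : ℕ} {v : Fin r → L} {a : tensorPow A r ⟶ A} {z : Fin 3 → L}
    {x y x' : L} {π : tensorPow A r ⊗ (A ⊗ (A ⊗ A)) ⟶ tensorPow A r ⊗ (A ⊗ (A ⊗ A))}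
    (h : PermRel A (joinTriple A r) (catWord v (tripleWord (z 0) (z 1) (z 2))) (π ≫ joinTriple A r)
      (catWord v (tripleWord x y x'))) (g : tensorPow A r ⊗ A ⟶ A) (t s : ℤˣ)
    (hf : faceForm a = π ≫ exch (tensorPow A r) A (A ⊗ A) ≫ A ◁ exch (tensorPow A r) A A ≫
      A ◁ twistMul g t ≫ frobPairing A) :
    labelledFace v a z = Corner.form (L := L)
      { out := x, inn := y, len := 1 + r, word := catWord v (singleWord x'),
        coeff := inv (joinSingle A r) ≫ g, twist := t, sign := s } := by
  refine mk_eq_of_permRel (h.trans ((permRel_joinTriple_front v x y x').precomp π)) ?_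
  rw [IsIso.hom_inv_id_assoc, hf]
  simp only [Category.assoc]
  rw [← whiskerLeft_twistMul, ← MonoidalCategory.whiskerLeft_comp_assoc A (A ◁ _),
    ← MonoidalCategory.whiskerLeft_comp_assoc A (joinSingle A r), IsIso.hom_inv_id,
    MonoidalCategory.whiskerLeft_id, Category.id_comp]

lemma labelledFace_eq_form (hN : nakayama A ≫ nakayama A = 𝟙 A) {r : ℕ} (v : Fin r → L)
    (a : tensorPow A r ⟶ A) (t : ℤˣ) (ha : IsTwisted a t) (z : Fin 3 → L) (s : ℤˣ) (k : Fin 3) :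
    labelledFace v a z = (faceCorner v a t z s k).form := by
  have h0 : ∀ {H : C} (g : H ⟶ A) (p : ℤˣ), cornerForm g (nakayamaSign A p) =
      A ◁ (β_ H A).hom ≫ A ◁ twistMul g p ≫ frobPairing A := by
    intro H g p
    rw [twistMul, cornerForm, ← MonoidalCategory.whiskerLeft_comp_assoc,
      SymmetricCategory.symmetry_assoc]
  fin_cases k
  · refine labelledFace_eq_form_aux (permRel_joinTriple_swap_right v (z 0) (z 1) (z 2)) _ _ _ ?_
    have h := congrArg (fun f => f ≫ A ◁ twistMul (cornerCoeff a t 0) t ≫ frobPairing A)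
      (corner_zero_perm (tensorPow A r) A)
    simp only [Category.assoc] at h
    rw [faceForm_corner_zero hN a t ha, h0]
    exact h
  · refine labelledFace_eq_form_aux (permRel_joinTriple_swap_left v (z 0) (z 1) (z 2)) _ _ _ ?_
    have h := congrArg (fun f => f ≫ A ◁ twistMul ((𝟙 A ⊗ₘ (a ≫ nakayama A)) ≫ μ[A]) (-1) ≫
      frobPairing A) (corner_one_perm (tensorPow A r) A)
    simp only [Category.assoc] at h
    have e : A ◁ A ◁ (β_ (tensorPow A r) A).hom ≫
        A ◁ twistMul ((𝟙 A ⊗ₘ (a ≫ nakayama A)) ≫ μ[A]) (-1) =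
        A ◁ twistMul (cornerCoeff a t 1) (-1) := by
      rw [← MonoidalCategory.whiskerLeft_comp, whiskerLeft_twistMul]
      rfl
    rw [comp_eq₂ e] at h
    rw [faceForm_corner_one a, ← nakayamaSign_neg_one, h0]
    exact h
  -- The word z₀z₁z₂ is reversed in three adjacent transpositions, via z₀z₂z₁ and z₂z₀z₁.
  · refine labelledFace_eq_form_aux (x := z 2) (y := z 1) (x' := z 0)
      (π := tensorPow A r ◁ A ◁ (β_ A A).hom ≫ tensorPow A r ◁ exch A A A ≫
        tensorPow A r ◁ A ◁ (β_ A A).hom) ?_ _ _ _ ?_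
    · have h1 := permRel_joinTriple_swap_right (A := A) v (z 0) (z 1) (z 2)
      have h2 := (permRel_joinTriple_swap_left (A := A) v (z 0) (z 2) (z 1)).precomp
        (tensorPow A r ◁ A ◁ (β_ A A).hom)
      have h3 := (permRel_joinTriple_swap_right (A := A) v (z 2) (z 0) (z 1)).precomp
        (tensorPow A r ◁ A ◁ (β_ A A).hom ≫ tensorPow A r ◁ exch A A A)
      refine (h1.trans (h2.trans (h3.congr (by simp) rfl rfl rfl))).congr rfl rfl (by simp) rfl
    · have h := congrArg (fun f => f ≫ A ◁ twistMul (cornerCoeff a t 2) (-1) ≫ frobPairing A)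
        (corner_two_perm (tensorPow A r) A)
      simp only [Category.assoc] at h ⊢
      rw [faceForm_corner_two a, ← nakayamaSign_neg_one, h0]
      exact h

end Faces

/-! ### Products of functionals on objects identified with tensor powers -/

section Forms

set_option linter.unusedSectionVars false

open TensorFamily LabelledForm

variable {C : Type u} [Category.{v} C] [MonoidalCategory C] [SymmetricCategory C]
  {A : C} {L : Type w}

namespace LabelledForm

/-- The labelled functional which is given by a functional on an object that is identified with a
tensor power of `A`. -/
def ofIso {X : C} {n : ℕ} (f : X ⟶ tensorPow A n) [IsIso f] (w : Fin n → L) (φ : X ⟶ 𝟙_ C) :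
    LabelledForm A L := mk w (inv f ≫ φ)

lemma ofIso_eq_of_permRel {X : C} {n n' : ℕ} {f : X ⟶ tensorPow A n} [IsIso f] {w : Fin n → L}
    {f' : X ⟶ tensorPow A n'} [IsIso f'] {w' : Fin n' → L} (h : PermRel A f w f' w')
    (φ : X ⟶ 𝟙_ C) : ofIso f w φ = ofIso f' w' φ :=
  mk_eq_of_permRel h (by simp)

lemma ofIso_precomp {X Y : C} (g : X ⟶ Y) [IsIso g] {n : ℕ} (f : Y ⟶ tensorPow A n) [IsIso f]
    (w : Fin n → L) (φ : Y ⟶ 𝟙_ C) : ofIso (g ≫ f) w (g ≫ φ) = ofIso f w φ := by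
  simp [ofIso]

lemma ofIso_precomp_eq {X Y : C} (g : X ⟶ Y) [IsIso g] {n : ℕ} (f : Y ⟶ tensorPow A n) [IsIso f]
    (f' : X ⟶ tensorPow A n) [IsIso f'] (w : Fin n → L) (φ : X ⟶ 𝟙_ C) (ψ : Y ⟶ 𝟙_ C)
    (hf : f' = g ≫ f) (hφ : φ = g ≫ ψ) : ofIso f' w φ = ofIso f w ψ := by
  subst hf hφ
  exact ofIso_precomp g f w ψ

lemma ofIso_mul_ofIso {X Y : C} {n m : ℕ} (f : X ⟶ tensorPow A n) [IsIso f] (w : Fin n → L)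
    (φ : X ⟶ 𝟙_ C) (g : Y ⟶ tensorPow A m) [IsIso g] (v : Fin m → L) (ψ : Y ⟶ 𝟙_ C) :
    ofIso f w φ * ofIso g v ψ =
      ofIso ((f ⊗ₘ g) ≫ tensorPowJoin A m n) (catWord w v) ((φ ⊗ₘ ψ) ≫ (λ_ (𝟙_ C)).hom) := by
  rw [ofIso, ofIso, mk_mul_mk, ofIso, tensorForm]
  congr 1
  rw [eq_comm, IsIso.inv_comp_eq, Category.assoc, IsIso.hom_inv_id_assoc,
    tensorHom_comp_tensorHom_assoc, IsIso.hom_inv_id_assoc, IsIso.hom_inv_id_assoc]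

end LabelledForm

/-- Combine a pairing of the first factors with a pairing of the remaining ones. -/
def pairMul {P Q : C} (κ : P ⊗ Q ⟶ 𝟙_ C) {Y W : C} (θ : Y ⊗ W ⟶ 𝟙_ C) :
    (P ⊗ Y) ⊗ (Q ⊗ W) ⟶ 𝟙_ C :=
  (α_ P Y (Q ⊗ W)).hom ≫ P ◁ exch Y Q W ≫ (α_ P Q (Y ⊗ W)).inv ≫ (κ ⊗ₘ θ) ≫ (λ_ _).hom

lemma pairMul_eq_tensorμ {P Q : C} (κ : P ⊗ Q ⟶ 𝟙_ C) {Y W : C} (θ : Y ⊗ W ⟶ 𝟙_ C) :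
    pairMul κ θ = tensorμ P Y Q W ≫ (κ ⊗ₘ θ) ≫ (λ_ _).hom := by
  simp [pairMul, tensorμ, exch]

lemma pairStep_eq_pairMul (b : A ⊗ A ⟶ 𝟙_ C) {Y W : C} (θ : Y ⊗ W ⟶ 𝟙_ C) :
    pairStep b θ = pairMul b θ := by
  simp [pairStep, pairMul, MonoidalCategory.tensorHom_def]

lemma pairMul_naturality {P Q P' Q' Y W Y' W' : C} (κ : P ⊗ Q ⟶ 𝟙_ C) (θ : Y ⊗ W ⟶ 𝟙_ C)
    (f : P' ⟶ P) (f' : Q' ⟶ Q) (g : Y' ⟶ Y) (g' : W' ⟶ W) :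
    ((f ⊗ₘ g) ⊗ₘ (f' ⊗ₘ g')) ≫ pairMul κ θ = pairMul ((f ⊗ₘ f') ≫ κ) ((g ⊗ₘ g') ≫ θ) := by
  rw [pairMul_eq_tensorμ, pairMul_eq_tensorμ, tensorμ_natural_assoc, tensorHom_comp_tensorHom_assoc]

/-- Associativity of the middle exchange `tensorμ`, postcomposed with the functionals. -/
lemma pairMul_assoc {P Q P' Q' Y W : C} (κ : P ⊗ Q ⟶ 𝟙_ C) (κ' : P' ⊗ Q' ⟶ 𝟙_ C)
    (θ : Y ⊗ W ⟶ 𝟙_ C) :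
    ((α_ P P' Y).hom ⊗ₘ (α_ Q Q' W).hom) ≫ pairMul κ (pairMul κ' θ) =
      pairMul (pairMul κ κ') θ := by
  simp only [pairMul_eq_tensorμ]
  have h := congrArg (fun f => f ≫ (κ ⊗ₘ (κ' ⊗ₘ θ)) ≫ (𝟙_ C) ◁ (λ_ _).hom ≫ (λ_ _).hom)
    (associator_monoidal P P' Y Q Q' W)
  simp only [Category.assoc] at h
  have e1 : (κ ⊗ₘ (tensorμ P' Y Q' W ≫ (κ' ⊗ₘ θ) ≫ (λ_ (𝟙_ C)).hom)) =
      (P ⊗ Q) ◁ tensorμ P' Y Q' W ≫ (κ ⊗ₘ (κ' ⊗ₘ θ)) ≫ (𝟙_ C) ◁ (λ_ _).hom := by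
    rw [← id_tensorHom, ← id_tensorHom, tensorHom_comp_tensorHom, tensorHom_comp_tensorHom,
      Category.id_comp, Category.comp_id]
  have e2 : (tensorμ P P' Q Q' ≫ (κ ⊗ₘ κ') ≫ (λ_ (𝟙_ C)).hom) ⊗ₘ θ =
      tensorμ P P' Q Q' ▷ (Y ⊗ W) ≫ (α_ _ _ _).hom ≫ (κ ⊗ₘ (κ' ⊗ₘ θ)) ≫ (λ_ _).hom := by
    rw [← associator_naturality_assoc]
    have e3 : (α_ (𝟙_ C) (𝟙_ C) (𝟙_ C)).hom ≫ (λ_ _).hom = (λ_ (𝟙_ C)).hom ▷ 𝟙_ C := by monoidal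
    rw [e3, ← tensorHom_id, ← tensorHom_id, tensorHom_comp_tensorHom, tensorHom_comp_tensorHom,
      Category.id_comp, Category.comp_id]
  rw [e1, e2]
  simp only [Category.assoc]
  rw [← h, leftUnitor_naturality]

namespace LabelledForm

/-- The middle exchange of words. -/
lemma permRel_middle {k l m n : ℕ} (v : Fin k → L) (v' : Fin l → L) (w : Fin m → L)
    (w' : Fin n → L) :
    PermRel A ((tensorPowJoin A l k ⊗ₘ tensorPowJoin A n m) ≫ tensorPowJoin A (n + m) (l + k))
      (catWord (catWord v v') (catWord w w'))
      ((α_ _ _ _).hom ≫ tensorPow A k ◁ exch _ _ _ ≫ (α_ _ _ _).inv ≫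
        (tensorPowJoin A m k ⊗ₘ tensorPowJoin A n l) ≫ tensorPowJoin A (n + l) (m + k))
      (catWord (catWord v w) (catWord v' w')) := by
  have h1 := (PermRel.assoc (A := A) v v' (catWord w w')).precomp (_ ◁ tensorPowJoin A n m)
  have h2 := ((PermRel.swapBlocks (A := A) v' w w').whiskerLeft v).precomp (α_ _ _ _).hom
  have h3 := (PermRel.assoc (A := A) v w (catWord v' w')).precomp
    ((α_ _ _ _).hom ≫ tensorPow A k ◁ exch _ _ _ ≫ (α_ _ _ _).inv ≫
      _ ◁ tensorPowJoin A n l)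
  refine ((h1.trans (h2.congr ?_ rfl rfl rfl)).trans (h3.symm.congr ?_ rfl rfl rfl)).congr ?_ rfl ?_ rfl
  · simp
  · simp
  · simp [MonoidalCategory.tensorHom_def']
  · simp [MonoidalCategory.tensorHom_def']

/-- `pairMul` differs from the plain tensor product by a middle exchange only, which labelled
functionals do not see. -/
lemma ofIso_pairMul {P Q Y W : C} {k l m n : ℕ} (f : P ⟶ tensorPow A k) [IsIso f]
    (f' : Y ⟶ tensorPow A l) [IsIso f'] (g : Q ⟶ tensorPow A m) [IsIso g]
    (g' : W ⟶ tensorPow A n) [IsIso g'] (v : Fin k → L) (v' : Fin l → L) (w : Fin m → L)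
    (w' : Fin n → L) (κ : P ⊗ Q ⟶ 𝟙_ C) (θ : Y ⊗ W ⟶ 𝟙_ C) :
    ofIso ((((f ⊗ₘ f') ≫ tensorPowJoin A l k) ⊗ₘ ((g ⊗ₘ g') ≫ tensorPowJoin A n m)) ≫
      tensorPowJoin A (n + m) (l + k)) (catWord (catWord v v') (catWord w w')) (pairMul κ θ) =
    ofIso ((f ⊗ₘ g) ≫ tensorPowJoin A m k) (catWord v w) κ *
      ofIso ((f' ⊗ₘ g') ≫ tensorPowJoin A n l) (catWord v' w') θ := by
  have h := (permRel_middle (A := A) v v' w w').precomp ((f ⊗ₘ f') ⊗ₘ (g ⊗ₘ g'))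
  rw [ofIso_mul_ofIso]
  have e : ((f ⊗ₘ f') ⊗ₘ (g ⊗ₘ g')) ≫ (α_ _ _ _).hom ≫ tensorPow A k ◁ exch _ _ _ ≫
      (α_ _ _ _).inv = tensorμ P Y Q W ≫ ((f ⊗ₘ g) ⊗ₘ (f' ⊗ₘ g')) := by
    rw [← tensorμ_natural]
    simp [tensorμ, exch]
  have e2 := congrArg (fun x => x ≫ (tensorPowJoin A m k ⊗ₘ tensorPowJoin A n l) ≫
    tensorPowJoin A (n + l) (m + k)) e
  simp only [Category.assoc] at e2
  rw [e2, tensorHom_comp_tensorHom_assoc, tensorHom_comp_tensorHom_assoc] at h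
  have : IsIso (tensorμ P Y Q W) := by
    unfold tensorμ
    infer_instance
  rw [ofIso_eq_of_permRel h, pairMul_eq_tensorμ, ofIso_precomp]

end LabelledForm

end Forms

/-! ### Block words and the pairing of two tensor powers -/

section Unrolling

set_option linter.unusedSectionVars false

open TensorFamily LabelledForm

variable {L : Type w}

lemma catWord_left {n m : ℕ} (v : Fin n → L) (w : Fin m → L) (p : Fin (m + n)) (i : Fin n)
    (h : (p : ℕ) = i) : catWord v w p = v i := by
  induction n with
  | zero => exact i.elim0
  | succ n ih =>
    rw [catWord_succ]
    cases i using Fin.cases with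
    | zero =>
      obtain rfl : p = (0 : Fin (m + n + 1)) := Fin.ext h
      rfl
    | succ i =>
      obtain ⟨q, rfl⟩ : ∃ q : Fin (m + n), p = (q.succ : Fin (m + n + 1)) := by
        refine ⟨⟨i, by omega⟩, Fin.ext ?_⟩
        simpa using h
      exact ih (Fin.tail v) q i (by simpa using h)

lemma catWord_right {n m : ℕ} (v : Fin n → L) (w : Fin m → L) (p : Fin (m + n)) (j : Fin m)
    (h : (p : ℕ) = n + j) : catWord v w p = w j := by
  induction n with
  | zero =>
    obtain rfl : p = j := Fin.ext (by simpa using h)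
    rfl
  | succ n ih =>
    rw [catWord_succ]
    obtain ⟨q, rfl⟩ : ∃ q : Fin (m + n), p = (q.succ : Fin (m + n + 1)) := by
      refine ⟨⟨n + j, by omega⟩, Fin.ext ?_⟩
      simp only [Fin.val_succ]
      omega
    refine ih (Fin.tail v) q ?_
    simp only [Fin.val_succ] at h
    omega

/-- The word which consists of `n` blocks of three letters. -/
def tripleBlocks : ∀ n : ℕ, (Fin n → Fin 3 → L) → Fin (3 * n) → L
  | 0, _ => Fin.elim0
  | n + 1, g => (Fin.cons (g 0 0) (Fin.cons (g 0 1) (Fin.cons (g 0 2)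
      (tripleBlocks n fun j => g j.succ) : Fin (3 * n + 1) → L) : Fin (3 * n + 2) → L) :
        Fin (3 * n + 3) → L)

/-- The word which consists of `n` blocks of two letters. -/
def pairBlocks : ∀ n : ℕ, (Fin n → Fin 2 → L) → Fin (2 * n) → L
  | 0, _ => Fin.elim0
  | n + 1, g => (Fin.cons (g 0 0) (Fin.cons (g 0 1)
      (pairBlocks n fun j => g j.succ) : Fin (2 * n + 1) → L) : Fin (2 * n + 2) → L)

lemma blockEquiv_val (n k : ℕ) (p : Fin n × Fin k) : (blockEquiv n k p : ℕ) = p.2 + k * p.1 := rfl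

lemma tripleBlocks_blockEquiv (n : ℕ) (g : Fin n → Fin 3 → L) (i : Fin n) (j : Fin 3) :
    tripleBlocks n g (blockEquiv n 3 (i, j)) = g i j := by
  induction n with
  | zero => exact i.elim0
  | succ n ih =>
    cases i using Fin.cases with
    | zero =>
      fin_cases j
      · have h : blockEquiv (n + 1) 3 (0, 0) = (0 : Fin (3 * n + 3)) := Fin.ext rfl
        exact congrArg (tripleBlocks (n + 1) g) h
      · have h : blockEquiv (n + 1) 3 (0, 1) = ((0 : Fin (3 * n + 2)).succ : Fin (3 * n + 3)) :=
          Fin.ext rfl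
        exact congrArg (tripleBlocks (n + 1) g) h
      · have h : blockEquiv (n + 1) 3 (0, 2) =
            ((0 : Fin (3 * n + 1)).succ.succ : Fin (3 * n + 3)) := Fin.ext rfl
        exact congrArg (tripleBlocks (n + 1) g) h
    | succ i =>
      have h : blockEquiv (n + 1) 3 (i.succ, j) =
          ((blockEquiv n 3 (i, j)).succ.succ.succ : Fin (3 * n + 3)) := by
        apply Fin.ext
        simp only [blockEquiv_val, Fin.val_succ]
        omega
      rw [h]
      exact ih (fun j => g j.succ) i

lemma pairBlocks_blockEquiv (n : ℕ) (g : Fin n → Fin 2 → L) (i : Fin n) (j : Fin 2) :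
    pairBlocks n g (blockEquiv n 2 (i, j)) = g i j := by
  induction n with
  | zero => exact i.elim0
  | succ n ih =>
    cases i using Fin.cases with
    | zero =>
      fin_cases j
      · have h : blockEquiv (n + 1) 2 (0, 0) = (0 : Fin (2 * n + 2)) := Fin.ext rfl
        exact congrArg (pairBlocks (n + 1) g) h
      · have h : blockEquiv (n + 1) 2 (0, 1) = ((0 : Fin (2 * n + 1)).succ : Fin (2 * n + 2)) :=
          Fin.ext rfl
        exact congrArg (pairBlocks (n + 1) g) h
    | succ i =>
      have h : blockEquiv (n + 1) 2 (i.succ, j) =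
          ((blockEquiv n 2 (i, j)).succ.succ : Fin (2 * n + 2)) := by
        apply Fin.ext
        simp only [blockEquiv_val, Fin.val_succ]
        omega
      rw [h]
      exact ih (fun j => g j.succ) i

variable {C : Type u} [Category.{v} C] [MonoidalCategory C] [SymmetricCategory C]

section Pairings

variable (A : C)

/-- The permutation of factors which pairs the factors of two tensor powers. -/
def interleave : ∀ m : ℕ, tensorPow A m ⊗ tensorPow A m ⟶ tensorPow A (2 * m)
  | 0 => (λ_ (𝟙_ C)).hom
  | m + 1 => (α_ A (tensorPow A m) (A ⊗ tensorPow A m)).hom ≫ A ◁ exch (tensorPow A m) A _ ≫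
      A ◁ A ◁ interleave m

variable {A} in
lemma permRel_interleave (m : ℕ) (a c : Fin m → L) :
    PermRel A (tensorPowJoin A m m) (catWord a c) (interleave A m)
      (pairBlocks m fun j => Fin.cons (a j) (singleWord (c j))) := by
  induction m with
  | zero =>
    exact (PermRel.refl (A := A) (tensorPowJoin A 0 0) (catWord a c)).congr rfl
      (Subsingleton.elim (α := Fin 0 → L) _ _) rfl (Subsingleton.elim (α := Fin 0 → L) _ _)
  | succ m ih =>
    obtain ⟨x, a, rfl⟩ := Fin.exists_cons a
    obtain ⟨y, c, rfl⟩ := Fin.exists_cons c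
    have h1 := ((PermRel.past_symm (A := A) y a c).cons x).precomp (α_ A (tensorPow A m) _).hom
    have h2 := (((ih a c).cons y).cons x).precomp
      ((α_ A (tensorPow A m) _).hom ≫ A ◁ exch (tensorPow A m) A _)
    refine (h1.trans (h2.congr (by simp) rfl rfl rfl)).congr rfl (by rw [catWord_cons]) ?_ rfl
    rw [Category.assoc]
    rfl

lemma shuffleEquiv_val_left (m : ℕ) (p : Fin (m + m)) (i : Fin m) (h : (p : ℕ) = i) :
    shuffleEquiv m p = blockEquiv m 2 (i, 0) := by
  obtain rfl : p = finSumFinEquiv (Sum.inl i) := Fin.ext (by simpa using h)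
  simp [shuffleEquiv, finTwoEquiv]

lemma shuffleEquiv_val_right (m : ℕ) (p : Fin (m + m)) (i : Fin m) (h : (p : ℕ) = m + i) :
    shuffleEquiv m p = blockEquiv m 2 (i, 1) := by
  obtain rfl : p = finSumFinEquiv (Sum.inr i) := Fin.ext h
  rw [shuffleEquiv, Equiv.trans_apply, Equiv.symm_apply_apply]
  rfl

/-- Replaces the index formula `shuffleEquiv` by a recursion. Both permutations have the same effect
on a word with pairwise distinct letters, which determines a permutation. -/
lemma join_shuffle (m : ℕ) :
    tensorPowJoin A m m ≫ tensorPerm A (shuffleEquiv m) = interleave A m := by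
  let a : Fin m → Fin m ⊕ Fin m := Sum.inl
  let c : Fin m → Fin m ⊕ Fin m := Sum.inr
  obtain ⟨e, h1, h2⟩ := permRel_interleave (A := A) m a c
  rw [← h2]
  congr 2
  have hs : catWord a c =
      (pairBlocks m fun j => Fin.cons (a j) (singleWord (c j))) ∘ shuffleEquiv m := by
    funext p
    rcases lt_or_ge (p : ℕ) m with hp | hp
    · rw [catWord_left a c p ⟨p, hp⟩ rfl, Function.comp_apply,
        shuffleEquiv_val_left m p ⟨p, hp⟩ rfl, pairBlocks_blockEquiv]
      rfl
    · have hq : (p : ℕ) = m + (⟨p - m, by omega⟩ : Fin m) := by simp; omega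
      rw [catWord_right a c p _ hq, Function.comp_apply, shuffleEquiv_val_right m p _ hq,
        pairBlocks_blockEquiv]
      rfl
  have hinj : Function.Injective (pairBlocks m fun j => Fin.cons (a j) (singleWord (c j)) :
      Fin (2 * m) → Fin m ⊕ Fin m) := by
    intro p q hpq
    obtain ⟨⟨i, j⟩, rfl⟩ := (blockEquiv m 2).surjective p
    obtain ⟨⟨i', j'⟩, rfl⟩ := (blockEquiv m 2).surjective q
    rw [pairBlocks_blockEquiv, pairBlocks_blockEquiv] at hpq
    congr 1
    fin_cases j <;> fin_cases j' <;>
      simp [a, c, singleWord] at hpq ⊢ <;> exact hpq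
  rw [hs] at h1
  exact Equiv.ext fun i => hinj (congrFun h1 i)

/-- The total pairing of two tensor powers. -/
def pairAll (b : A ⊗ A ⟶ 𝟙_ C) : ∀ m : ℕ, tensorPow A m ⊗ tensorPow A m ⟶ 𝟙_ C
  | 0 => (λ_ (𝟙_ C)).hom
  | m + 1 => pairStep b (pairAll b m)

lemma join_shuffle_pairings (b : A ⊗ A ⟶ 𝟙_ C) (m : ℕ) :
    tensorPowJoin A m m ≫ tensorPerm A (shuffleEquiv m) ≫ tensorPairings A b m = pairAll A b m := by
  rw [comp_eq₂ (join_shuffle A m)]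
  induction m with
  | zero => exact Category.comp_id _
  | succ m ih =>
    have h : ∀ {X W : C} (f : X ⟶ W) (r : W ⟶ 𝟙_ C), A ◁ A ◁ f ≫ (α_ A A W).inv ≫ b ▷ W ≫
        (λ_ W).hom ≫ r = (α_ A A X).inv ≫ b ▷ X ≫ (λ_ X).hom ≫ f ≫ r := by
      intro X W f r
      rw [associator_inv_naturality_right_assoc, whisker_exchange_assoc,
        leftUnitor_naturality_assoc]
    rw [pairAll, ← ih, pairStep, ← h, interleave, Category.assoc, Category.assoc]
    rfl

end Pairings

end Unrolling

/-! ### Boundary insertions as additional faces -/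

section FaceProducts

set_option linter.unusedSectionVars false

open TensorFamily LabelledForm

variable {L : Type w} {C : Type u} [Category.{v} C] [MonoidalCategory C] [SymmetricCategory C]
  {A : C}

instance (X Y W : C) : IsIso (exch X Y W) := ⟨exch Y X W, exch_exch X Y W, exch_exch Y X W⟩

lemma pairStep_three (b : A ⊗ A ⟶ 𝟙_ C) {Y W : C} (θ : Y ⊗ W ⟶ 𝟙_ C) :
    (((α_ A (A ⊗ A) Y).hom ≫ A ◁ (α_ A A Y).hom) ⊗ₘ ((α_ A (A ⊗ A) W).hom ≫ A ◁ (α_ A A W).hom)) ≫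
      pairStep b (pairStep b (pairStep b θ)) = pairMul (pairStep b (pairStep b b)) θ := by
  simp only [pairStep_eq_pairMul]
  rw [← pairMul_assoc, ← pairMul_assoc, ← tensorHom_comp_tensorHom, Category.assoc,
    ← id_tensorHom, ← id_tensorHom, pairMul_naturality]
  simp

/-- A functional applied in the middle of a tensor product splits off as a factor, since its block
can be moved to the front. -/
lemma ofIso_whiskerLeft_tensorForm {X W Q : C} {k m n : ℕ} (f : X ⟶ tensorPow A k) [IsIso f]
    (g : Q ⟶ tensorPow A m) [IsIso g] (h : W ⟶ tensorPow A n) [IsIso h] (v : Fin k → L)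
    (w : Fin m → L) (u : Fin n → L) (t : Q ⟶ 𝟙_ C) (θ : X ⊗ W ⟶ 𝟙_ C) :
    ofIso ((f ⊗ₘ ((g ⊗ₘ h) ≫ tensorPowJoin A n m)) ≫ tensorPowJoin A (n + m) k)
      (catWord v (catWord w u)) (X ◁ (t ▷ W ≫ (λ_ W).hom) ≫ θ) =
    ofIso g w t * ofIso ((f ⊗ₘ h) ≫ tensorPowJoin A n k) (catWord v u) θ := by
  rw [ofIso_mul_ofIso]
  have h1 := (PermRel.swapBlocks (A := A) v w u).precomp (f ⊗ₘ (g ⊗ₘ h))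
  have e : (f ⊗ₘ (g ⊗ₘ h)) ≫ exch _ _ _ = exch X Q W ≫ (g ⊗ₘ (f ⊗ₘ h)) := by
    simp only [MonoidalCategory.tensorHom_def, MonoidalCategory.whiskerLeft_comp, Category.assoc]
    rw [exch_naturality_right, comp_eq₂ (exch_naturality_middle _ _ _), Category.assoc,
      comp_eq₂ (exch_naturality_left _ _ _), Category.assoc, whisker_exchange_assoc]
  have h2 : ofIso ((f ⊗ₘ ((g ⊗ₘ h) ≫ tensorPowJoin A n m)) ≫ tensorPowJoin A (n + m) k)
      (catWord v (catWord w u)) (X ◁ (t ▷ W ≫ (λ_ W).hom) ≫ θ) =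
      ofIso (exch X Q W ≫ (g ⊗ₘ ((f ⊗ₘ h) ≫ tensorPowJoin A n k)) ≫ tensorPowJoin A (n + k) m)
        (catWord w (catWord v u)) (X ◁ (t ▷ W ≫ (λ_ W).hom) ≫ θ) := by
    refine ofIso_eq_of_permRel (h1.congr ?_ rfl ?_ rfl) _
    · rw [← id_tensorHom, tensorHom_comp_tensorHom_assoc, Category.comp_id]
    · rw [comp_eq₂ e, Category.assoc, ← id_tensorHom, tensorHom_comp_tensorHom_assoc,
        Category.comp_id]
  rw [h2]
  refine ofIso_precomp_eq (exch X Q W) _ _ _ _ _ rfl ?_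
  rw [MonoidalCategory.tensorHom_def]
  have e2 := exch_naturality_middle X t W
  simp only [Category.assoc, MonoidalCategory.whiskerLeft_comp]
  rw [comp_eq₂ e2.symm, Category.assoc, exch_unit_middle, leftUnitor_naturality]
  simp

variable [MonObj A] [ComonObj A]

/-- The face of a boundary component, into which an endomorphism of `A` is inserted. -/
def boundaryFace (P : A ⟶ A) (x : L) (z : Fin 3 → L) : LabelledForm A L :=
  labelledFace (singleWord x) ((ρ_ A).hom ≫ P) z

/-- The face of a triangle. -/
def triangleFace (A : C) [MonObj A] [ComonObj A] (z : Fin 3 → L) : LabelledForm A L :=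
  labelledFace (A := A) (Fin.elim0 : Fin 0 → L) η[A] z

lemma IsTwisted.precomp {X Y : C} {a : X ⟶ A} {t : ℤˣ} (ha : IsTwisted a t) (j : Y ⟶ X) :
    IsTwisted (j ≫ a) t := by
  have h := congrArg (fun f => j ▷ A ≫ f) (show (a ⊗ₘ 𝟙 A) ≫ μ[A] = _ from ha)
  simp only [← tensorHom_id, tensorHom_comp_tensorHom_assoc, Category.id_comp] at h
  rw [IsTwisted, h, tensorHom_id, BraidedCategory.braiding_naturality_left_assoc,
    ← id_tensorHom, tensorHom_comp_tensorHom_assoc, Category.id_comp]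

lemma faceForm_precomp {X Y : C} (a : X ⟶ A) (j : Y ⟶ X) :
    faceForm (j ≫ a) = j ▷ _ ≫ faceForm a := by
  simp [faceForm, ← tensorHom_id, tensorHom_comp_tensorHom_assoc]

lemma boundaryFace_eq (P : A ⟶ A) (x : L) (z : Fin 3 → L) :
    boundaryFace P x z = ofIso (((ρ_ A).inv ⊗ₘ (A ◁ A ◁ (ρ_ A).inv)) ≫ tensorPowJoin A 3 1)
      (catWord (singleWord x) (tripleWord (z 0) (z 1) (z 2))) (faceForm P) := by
  refine ofIso_precomp_eq ((ρ_ A).hom ▷ (A ⊗ (A ⊗ A))) _ _ _ _ _ ?_ (faceForm_precomp _ _)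
  rw [joinTriple, ← tensorHom_id, tensorHom_comp_tensorHom_assoc, Iso.hom_inv_id, Category.id_comp,
    ← id_tensorHom]

lemma triangleFace_eq (z : Fin 3 → L) :
    triangleFace A z = ofIso (A ◁ A ◁ (ρ_ A).inv) (tripleWord (z 0) (z 1) (z 2) : Fin 3 → L)
      (frobTriangle A) := by
  refine ofIso_precomp_eq (λ_ (A ⊗ (A ⊗ A))).hom _ _ _ _ _ ?_ ?_
  · exact leftUnitor_naturality _
  · simp [faceForm, frobTriangle, frobPairing, MonoidalCategory.tensorHom_def']

variable [IsFrobeniusObj A]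

/-- The first three pairings see only the first boundary component, and `iotaOneThree_pairing`
evaluates them to its face functional. -/
lemma tensorTriples_pairing_succ (B : ℕ) (P : Fin (B + 1) → (A ⟶ A)) :
    tensorTriples A (B + 1) (fun i => P i ≫ iotaOneThree A) ▷ tensorPow A (3 * B + 3) ≫
      pairAll A (frobPairing A) (3 * B + 3) =
    (A ⊗ tensorPow A B) ◁ (A ◁ (α_ A A (tensorPow A (3 * B))).inv ≫
      (α_ A (A ⊗ A) (tensorPow A (3 * B))).inv) ≫
    pairMul (faceForm (P 0)) (tensorTriples A B (fun i => P i.succ ≫ iotaOneThree A) ▷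
      tensorPow A (3 * B) ≫ pairAll A (frobPairing A) (3 * B)) := by
  have h1 := pairStep_three (frobPairing A) (pairAll A (frobPairing A) (3 * B))
  have h2 : faceForm (P 0) = ((P 0 ≫ iotaOneThree A) ⊗ₘ 𝟙 _) ≫
      pairStep (frobPairing A) (pairStep (frobPairing A) (frobPairing A)) := by
    rw [tensorHom_id, comp_whiskerRight, Category.assoc, iotaOneThree_pairing, faceForm]
    simp only [← tensorHom_id, ← id_tensorHom, tensorHom_comp_tensorHom_assoc, Category.id_comp,
      Category.comp_id]
  rw [h2, ← tensorHom_id, ← tensorHom_id, ← pairMul_naturality, ← h1, tensorHom_comp_tensorHom_assoc, id_tensorHom_id,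
    Category.id_comp, ← id_tensorHom, tensorHom_comp_tensorHom_assoc, Category.id_comp]
  simp only [Category.assoc]
  rw [Iso.inv_hom_id_assoc, ← MonoidalCategory.whiskerLeft_comp, Iso.inv_hom_id,
    MonoidalCategory.whiskerLeft_id]
  rfl

lemma ofIso_tensorTriples_pairing (B : ℕ) (P : Fin B → (A ⟶ A)) (xs : Fin B → L)
    (g : Fin B → Fin 3 → L) :
    ofIso (tensorPowJoin A (3 * B) B) (catWord xs (tripleBlocks B g))
      (tensorTriples A B (fun i => P i ≫ iotaOneThree A) ▷ tensorPow A (3 * B) ≫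
        pairAll A (frobPairing A) (3 * B)) = ∏ i : Fin B, boundaryFace (P i) (xs i) (g i) := by
  induction B with
  | zero =>
    rw [Finset.univ_eq_empty, Finset.prod_empty, one_def]
    refine mk_eq_of_permRel (f := tensorPowJoin A 0 0) (f' := tensorPowJoin A 0 0)
      ((PermRel.refl _ _).congr rfl (Subsingleton.elim (α := Fin 0 → L) _ _) rfl rfl) ?_
    rw [IsIso.hom_inv_id_assoc]
    simp [tensorTriples, pairAll, tensorPowJoin]
  | succ B ih =>
    obtain ⟨x, xs, rfl⟩ := Fin.exists_cons xs
    rw [Fin.prod_univ_succ, boundaryFace_eq]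
    simp only [Fin.cons_succ, Fin.cons_zero]
    rw [← ih (fun i => P i.succ) xs (fun i => g i.succ)]
    have h := ofIso_pairMul (A := A) ((ρ_ A).inv : A ⟶ tensorPow A 1) (𝟙 (tensorPow A B))
      (A ◁ A ◁ (ρ_ A).inv : A ⊗ (A ⊗ A) ⟶ tensorPow A 3) (𝟙 (tensorPow A (3 * B)))
      (singleWord x) xs (tripleWord (g 0 0) (g 0 1) (g 0 2)) (tripleBlocks B fun i => g i.succ)
      (faceForm (P 0)) (tensorTriples A B (fun i => P i.succ ≫ iotaOneThree A) ▷
        tensorPow A (3 * B) ≫ pairAll A (frobPairing A) (3 * B))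
    simp only [id_tensorHom_id, Category.id_comp] at h
    rw [← h]
    refine ofIso_precomp_eq ((A ⊗ tensorPow A B) ◁ (A ◁ (α_ A A (tensorPow A (3 * B))).inv ≫
      (α_ A (A ⊗ A) (tensorPow A (3 * B))).inv)) _ _ _ _ _ ?_ (tensorTriples_pairing_succ B P)
    have e1 : ((ρ_ A).inv ⊗ₘ 𝟙 (tensorPow A B)) ≫ tensorPowJoin A B 1 = 𝟙 (A ⊗ tensorPow A B) := by
      simp [tensorPowJoin]
    have e2 : (A ◁ (α_ A A (tensorPow A (3 * B))).inv ≫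
        (α_ A (A ⊗ A) (tensorPow A (3 * B))).inv) ≫
        ((A ◁ A ◁ (ρ_ A).inv ⊗ₘ 𝟙 (tensorPow A (3 * B))) ≫ tensorPowJoin A (3 * B) 3) = 𝟙 _ := by
      simp only [tensorPowJoin]
      monoidal
    rw [e1, id_tensorHom, ← MonoidalCategory.whiskerLeft_comp_assoc, e2,
      MonoidalCategory.whiskerLeft_id]
    exact (Category.id_comp _).symm

end FaceProducts

/-! ### The state sum as a contraction of a product of faces -/

section StateSumForm

set_option linter.unusedSectionVars false

open TensorFamily LabelledForm

variable {L : Type w} {C : Type u} [Category.{v} C] [MonoidalCategory C] [SymmetricCategory C]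
  {A : C}

section Contractions

variable {Z Y : C}

/-- Contract several pairs of factors. -/
def contractPairs : ∀ n : ℕ, (Fin n → (𝟙_ C ⟶ A ⊗ A)) → (Fin n → Fin 2 → L) →
    TensorFamily A L Z Y → TensorFamily A L Z Y
  | 0, _, _, F => F
  | n + 1, c, g, F =>
      contractPairs n (fun j => c j.succ) (fun j => g j.succ) (contract (c 0) (g 0 0) (g 0 1) F)

/-- Contracting pairs one after another amounts to inserting all copairings at once: naturality of
`cupFront` puts each copairing in front of those to its right. -/
lemma contractPairs_apply (n : ℕ) (c : Fin n → (𝟙_ C ⟶ A ⊗ A)) (g : Fin n → Fin 2 → L)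
    (F : TensorFamily A L Z Y) (k : ℕ) (w : Fin k → L) :
    contractPairs n c g F k w =
      Z ◁ ((λ_ _).inv ≫ tensorCopairings A n c ▷ tensorPow A k ≫ tensorPowJoin A k (2 * n)) ≫
        F (k + 2 * n) (catWord (pairBlocks n g) w) := by
  induction n generalizing F with
  | zero =>
    have h : (λ_ (tensorPow A k)).inv ≫ tensorCopairings A 0 c ▷ tensorPow A k ≫
        tensorPowJoin A k 0 = 𝟙 (tensorPow A k) := by
      simp [tensorCopairings, tensorPowJoin]
    exact (Category.id_comp _).symm.trans (congrArg (fun f => f ≫ F k w)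
      ((MonoidalCategory.whiskerLeft_id _ _).symm.trans (congrArg (fun f => Z ◁ f) h.symm)))
  | succ n ih =>
    have h : (λ_ (tensorPow A k)).inv ≫ tensorCopairings A (n + 1) c ▷ tensorPow A k ≫
        tensorPowJoin A k (2 * n + 2) =
        ((λ_ (tensorPow A k)).inv ≫ tensorCopairings A n (fun j => c j.succ) ▷ tensorPow A k ≫
          tensorPowJoin A k (2 * n)) ≫ cupFront A (c 0) (tensorPow A (k + 2 * n)) := by
      rw [cupFront_naturality]
      simp only [tensorCopairings, tensorPowJoin, cupFront, MonoidalCategory.tensorHom_def]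
      monoidal
    rw [contractPairs, ih, contract, ← MonoidalCategory.whiskerLeft_comp_assoc, ← h]
    rfl

end Contractions

variable [MonObj A] [ComonObj A]

/-- The triangles are split off one at a time from behind the block of `f`. -/
lemma ofIso_tensorTriangles {X : C} {k m : ℕ} (f : X ⟶ tensorPow A k) [IsIso f] (v : Fin k → L)
    (u : Fin m → L) (n : ℕ) (g : Fin n → Fin 3 → L) (θ : X ⊗ tensorPow A m ⟶ 𝟙_ C) :
    ofIso (f ▷ _ ≫ tensorPowJoin A (m + 3 * n) k) (catWord v (catWord (tripleBlocks n g) u))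
      (X ◁ tensorTriangles A (frobTriangle A) m n ≫ θ) =
    (∏ i : Fin n, triangleFace A (g i)) *
      ofIso (f ▷ _ ≫ tensorPowJoin A m k) (catWord v u) θ := by
  induction n with
  | zero =>
    rw [Finset.univ_eq_empty, Finset.prod_empty, one_mul]
    congr 1
    exact (congrArg (fun x => x ≫ θ) (MonoidalCategory.whiskerLeft_id _ _)).trans
      (Category.id_comp _)
  | succ n ih =>
    rw [Fin.prod_univ_succ, mul_assoc, ← ih, triangleFace_eq]
    have h := ofIso_whiskerLeft_tensorForm f (A ◁ A ◁ (ρ_ A).inv : A ⊗ (A ⊗ A) ⟶ tensorPow A 3)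
      (𝟙 (tensorPow A (m + 3 * n))) v (tripleWord (g 0 0) (g 0 1) (g 0 2))
      (catWord (tripleBlocks n fun i => g i.succ) u) (frobTriangle A)
      (X ◁ tensorTriangles A (frobTriangle A) m n ≫ θ)
    simp only [tensorHom_id f] at h
    rw [← h]
    refine ofIso_precomp_eq (X ◁ (A ◁ (α_ A A (tensorPow A (m + 3 * n))).inv ≫
      (α_ A (A ⊗ A) (tensorPow A (m + 3 * n))).inv)) _ _ _ _ _ ?_ ?_
    · have e : (A ◁ (α_ A A (tensorPow A (m + 3 * n))).inv ≫
          (α_ A (A ⊗ A) (tensorPow A (m + 3 * n))).inv) ≫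
          ((A ◁ A ◁ (ρ_ A).inv ⊗ₘ 𝟙 (tensorPow A (m + 3 * n))) ≫
            tensorPowJoin A (m + 3 * n) 3) = 𝟙 _ := by
        simp only [tensorPowJoin]
        monoidal
      rw [← id_tensorHom, tensorHom_comp_tensorHom_assoc, e, Category.id_comp, tensorHom_id f]
      rfl
    · simp only [tensorTriangles, MonoidalCategory.whiskerLeft_comp, Category.assoc]

variable [IsFrobeniusObj A]

/-- The product of the faces of a surface as a functional on one tensor power. -/
lemma ofIso_faces {B nE nT : ℕ} (e : Fin (2 * nE) ≃ Fin (3 * B + 3 * nT))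
    (P : Fin B → (A ⟶ A)) (xs : Fin B → L)
    (gB : Fin B → Fin 3 → L) (gT : Fin nT → Fin 3 → L) (gE : Fin nE → Fin 2 → L)
    (hE : catWord (tripleBlocks nT gT) (tripleBlocks B gB) ∘ e = pairBlocks nE gE) :
    ofIso (tensorPowJoin A B (2 * nE)) (catWord (pairBlocks nE gE) xs)
      ((β_ _ _).hom ≫ tensorPow A B ◁ (tensorPerm A e ≫
        tensorTriangles A (frobTriangle A) (3 * B) nT) ≫
          tensorTriples A B (fun i => P i ≫ iotaOneThree A) ▷ tensorPow A (3 * B) ≫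
            pairAll A (frobPairing A) (3 * B)) =
      (∏ i, triangleFace A (gT i)) * ∏ i, boundaryFace (P i) (xs i) (gB i) := by
  set Ψ := tensorTriples A B (fun i => P i ≫ iotaOneThree A) ▷ tensorPow A (3 * B) ≫
        pairAll A (frobPairing A) (3 * B) with hΨ
  have h1 := ofIso_tensorTriangles (𝟙 (tensorPow A B)) xs (tripleBlocks B gB) nT gT Ψ
  have h2 : ofIso (𝟙 (tensorPow A B) ▷ _ ≫ tensorPowJoin A (3 * B) B)
      (catWord xs (tripleBlocks B gB)) Ψ = ∏ i, boundaryFace (P i) (xs i) (gB i) := by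
    rw [← ofIso_tensorTriples_pairing]
    congr 1
    simp
  rw [h2] at h1
  rw [← h1]
  have h4 := PermRel.swapTwo (A := A) (pairBlocks nE gE) xs
  have h5 := ((PermRel.perm (A := A) e
    (catWord (tripleBlocks nT gT) (tripleBlocks B gB))).whiskerLeft xs).precomp (β_ _ _).hom
  rw [hE] at h5
  refine mk_eq_of_permRel ((h4.trans (h5.congr (by simp) rfl rfl rfl))) ?_
  simp

/-- The composite of copairings, a permutation of tensor factors, triangles and boundary components is
a contraction of a product of faces. -/
lemma contractPairs_toFamily_faces [Preadditive C] {B nE nT : ℕ}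
    (e : Fin (2 * nE) ≃ Fin (3 * B + 3 * nT))
    (c : Fin nE → (𝟙_ C ⟶ A ⊗ A)) (P : Fin B → (A ⟶ A)) (xs : Fin B → L)
    (gB : Fin B → Fin 3 → L) (gT : Fin nT → Fin 3 → L) (gE : Fin nE → Fin 2 → L)
    (hE : catWord (tripleBlocks nT gT) (tripleBlocks B gB) ∘ e = pairBlocks nE gE)
    (hnodup : (letters (catWord (pairBlocks nE gE) xs)).Nodup) :
    contractPairs nE c gE (toFamily ((∏ i, triangleFace A (gT i)) *
      ∏ i, boundaryFace (P i) (xs i) (gB i))) B xs =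
    (λ_ _).hom ≫ tensorTriples A B (fun i => P i ≫ iotaOneThree A) ≫
      (ρ_ (tensorPow A (3 * B))).inv ≫
      tensorPow A (3 * B) ◁ (tensorCopairings A nE c ≫ tensorPerm A e ≫
        tensorTriangles A (frobTriangle A) (3 * B) nT) ≫
      tensorPowJoin A (3 * B) (3 * B) ≫ tensorPerm A (shuffleEquiv (3 * B)) ≫
      tensorPairings A (frobPairing A) (3 * B) := by
  rw [← ofIso_faces e P xs gB gT gE hE, contractPairs_apply, ofIso, toFamily_mk hnodup,
    leftUnitor_naturality_assoc, join_shuffle_pairings A (frobPairing A) (3 * B)]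
  congr 1
  simp only [Category.assoc, IsIso.hom_inv_id_assoc]
  -- What is left is that the copairings and the boundary insertion act on disjoint factors and so
  -- may be interchanged.
  rw [BraidedCategory.braiding_naturality_left_assoc, rightUnitor_inv_naturality_assoc,
    ← whisker_exchange_assoc]
  simp

end StateSumForm

/-! ### The cycle of corners at a vertex -/

namespace CombinatorialSurface.Marking

variable {V : Type w} [DecidableEq V] {B : ℕ} {S : CombinatorialSurface V B} (M : S.Marking)

/-- The other side of an edge. -/
def opposite : Equiv.Perm ((S.Triangle ⊕ Fin B) × Fin 3) :=
  (M.sideEquiv.trans (Equiv.prodCongr (Equiv.refl S.Edge) (Equiv.swap 0 1))).trans M.sideEquiv.symm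

lemma sideEquiv_apply (p : (S.Triangle ⊕ Fin B) × Fin 3) :
    M.sideEquiv p = (M.edgeAt p.1 p.2, M.side p.1 p.2) := rfl

lemma sideEquiv_opposite (p : (S.Triangle ⊕ Fin B) × Fin 3) :
    M.sideEquiv (M.opposite p) = (M.edgeAt p.1 p.2, Equiv.swap 0 1 (M.side p.1 p.2)) := by
  simp [opposite, sideEquiv_apply]

lemma opposite_opposite (p : (S.Triangle ⊕ Fin B) × Fin 3) : M.opposite (M.opposite p) = p := by
  apply M.sideEquiv.injective
  have h := M.sideEquiv_opposite p
  rw [sideEquiv_apply, Prod.mk.injEq] at h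
  have h2 : ∀ j : Fin 2, Equiv.swap 0 1 (Equiv.swap 0 1 j) = j := by decide
  rw [sideEquiv_opposite, h.1, h.2, h2, sideEquiv_apply]

lemma source_eq_or (x : S.Triangle ⊕ Fin B) (k : Fin 3) :
    M.source (M.edgeAt x k) = M.corner x k ∨ M.source (M.edgeAt x k) = M.corner x (k + 1) := by
  have h : M.source (M.edgeAt x k) ∈ ({M.corner x k, M.corner x (k + 1)} : Finset V) :=
    M.source_mem (M.edgeAt x k)
  simpa using h

lemma side_eq_zero_iff (x : S.Triangle ⊕ Fin B) (k : Fin 3) :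
    M.side x k = 0 ↔ M.source (M.edgeAt x k) = M.corner x k := by
  unfold side
  split_ifs with h <;> simp [h]

/-- The two sides traverse the edge in opposite directions: if they started at the same vertex, both
would be its left side or both its right side. -/
lemma corner_opposite (p : (S.Triangle ⊕ Fin B) × Fin 3) :
    M.corner (M.opposite p).1 (M.opposite p).2 = M.corner p.1 (p.2 + 1) := by
  have h := M.sideEquiv_opposite p
  rw [sideEquiv_apply, Prod.mk.injEq] at h
  obtain ⟨h1, h2⟩ := h
  have h3 := M.side_eq_zero_iff p.1 p.2
  have h4 := M.side_eq_zero_iff (M.opposite p).1 (M.opposite p).2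
  have h5 := M.source_eq_or p.1 p.2
  have h6 := M.source_eq_or (M.opposite p).1 (M.opposite p).2
  have h7 := M.corner_ne p.1 p.2
  have h8 : ({M.corner p.1 p.2, M.corner p.1 (p.2 + 1)} : Finset V) =
      {M.corner (M.opposite p).1 (M.opposite p).2,
        M.corner (M.opposite p).1 ((M.opposite p).2 + 1)} := congrArg Subtype.val h1.symm
  have h9 : M.corner (M.opposite p).1 (M.opposite p).2 ∈
      ({M.corner p.1 p.2, M.corner p.1 (p.2 + 1)} : Finset V) := by rw [h8]; simp
  rw [h1] at h4 h6
  simp only [Finset.mem_insert, Finset.mem_singleton] at h9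
  rcases h9 with h9 | h9
  · exfalso
    rw [h9, ← h3, h2] at h4
    have : M.side p.1 p.2 = 0 ∨ M.side p.1 p.2 = 1 := by
      generalize M.side p.1 p.2 = j
      fin_cases j <;> simp
    rcases this with h | h <;> simp [h] at h4
  · exact h9

lemma corner_succ_opposite (p : (S.Triangle ⊕ Fin B) × Fin 3) :
    M.corner (M.opposite p).1 ((M.opposite p).2 + 1) = M.corner p.1 p.2 := by
  rw [← corner_opposite, opposite_opposite]

/-- The next corner at the same vertex. -/
def nextCorner : Equiv.Perm ((S.Triangle ⊕ Fin B) × Fin 3) :=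
  (Equiv.prodCongr (Equiv.refl _) (Equiv.addRight 2)).trans M.opposite

lemma nextCorner_apply (p : (S.Triangle ⊕ Fin B) × Fin 3) :
    M.nextCorner p = M.opposite (p.1, p.2 + 2) := rfl

lemma corner_nextCorner (p : (S.Triangle ⊕ Fin B) × Fin 3) :
    M.corner (M.nextCorner p).1 (M.nextCorner p).2 = M.corner p.1 p.2 := by
  rw [nextCorner_apply, corner_opposite]
  congr 1
  generalize p.2 = k
  fin_cases k <;> rfl

lemma corner_succ_nextCorner (p : (S.Triangle ⊕ Fin B) × Fin 3) :
    M.corner (M.nextCorner p).1 ((M.nextCorner p).2 + 1) = M.corner p.1 (p.2 + 2) := by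
  rw [nextCorner_apply, corner_succ_opposite]

lemma exists_position {v a : V} (ha : a ≠ v) (h : ({v, a} : Finset V) ∈ S.faces) :
    ∃ p : (S.Triangle ⊕ Fin B) × Fin 3, M.corner p.1 p.2 = v ∧ M.corner p.1 (p.2 + 1) = a := by
  obtain ⟨x, k, h1, h2⟩ := M.exists_side ⟨{v, a}, h, Finset.card_pair ha.symm⟩ ha.symm rfl
  exact ⟨(x, k), h1, h2⟩

/-- A position starting at v is determined by the other end of its edge. From the edge of the
triangle leaving v, `nextCorner` crosses the edge arriving at v, whose other side leaves v towards
the third vertex. So neighbours in the link give consecutive positions, in an order fixed by the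
orientation. -/
lemma sameCycle_of_triangle {v a b : V} (h : ({v, a, b} : Finset V) ∈ S.faces)
    (hc : ({v, a, b} : Finset V).card = 3) {p q : (S.Triangle ⊕ Fin B) × Fin 3}
    (hp : M.corner p.1 p.2 = v) (hp' : M.corner p.1 (p.2 + 1) = a)
    (hq : M.corner q.1 q.2 = v) (hq' : M.corner q.1 (q.2 + 1) = b) :
    M.nextCorner.SameCycle p q := by
  let σ : S.Triangle := ⟨{v, a, b}, h, hc⟩
  have hv : v ∈ σ.1 := by simp [σ]
  obtain ⟨k, hk⟩ := M.exists_corner σ hv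
  have h1 := M.corner_succ σ k
  have h2 : M.corner (.inl σ) (k + 2) = S.next σ (S.next σ v) := by
    have h3 := M.corner_succ σ (k + 1)
    rw [h1, hk] at h3
    rw [← h3]
    congr 1
    fin_cases k <;> rfl
  rw [hk] at h1
  have m1 : S.next σ v ∈ σ.1 := S.next_mem σ v hv
  have m2 : S.next σ (S.next σ v) ∈ σ.1 := S.next_mem σ _ m1
  have n1 := S.next_ne σ v hv
  have n2 := S.next_ne σ _ m1
  have n3 := next_next_ne S σ hv
  simp only [σ, Finset.mem_insert, Finset.mem_singleton] at m1 m2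
  have key : ∀ {r r' : (S.Triangle ⊕ Fin B) × Fin 3} (_ : M.corner r.1 r.2 = v)
      (_ : M.corner r.1 (r.2 + 1) = S.next σ v) (_ : M.corner r'.1 r'.2 = v)
      (_ : M.corner r'.1 (r'.2 + 1) = S.next σ (S.next σ v)), M.nextCorner r = r' := by
    intro r r' e1 e2 e3 e4
    obtain rfl : r = (.inl σ, k) := M.corner_unique _ _ _ _ (e1.trans hk.symm) (e2.trans h1.symm)
    refine M.corner_unique (M.nextCorner (.inl σ, k)).1 r'.1 (M.nextCorner (.inl σ, k)).2 r'.2 ?_ ?_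
    · rw [corner_nextCorner, e1, e3]
    · rw [corner_succ_nextCorner, e4, ← h2]
  rcases m1 with m1 | m1 | m1
  · exact absurd m1 n1
  · rcases m2 with m2 | m2 | m2
    · exact absurd m2 n3
    · exact absurd (m2.trans m1.symm) n2
    · rw [← key hp (hp'.trans m1.symm) hq (hq'.trans m2.symm)]
      exact (Equiv.Perm.SameCycle.refl _ _).apply_right
  · rcases m2 with m2 | m2 | m2
    · exact absurd m2 n3
    · rw [← key hq (hq'.trans m1.symm) hp (hp'.trans m2.symm)]
      exact (Equiv.Perm.SameCycle.refl _ _).apply_left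
    · exact absurd (m2.trans m1.symm) n2

lemma edge_mem_faces (p : (S.Triangle ⊕ Fin B) × Fin 3) :
    ({M.corner p.1 p.2, M.corner p.1 (p.2 + 1)} : Finset V) ∈ S.faces := (M.edgeAt p.1 p.2).2.1

/-- The corners at a vertex form a single cycle. -/
lemma sameCycle_nextCorner {p q : (S.Triangle ⊕ Fin B) × Fin 3}
    (h : M.corner p.1 p.2 = M.corner q.1 q.2) : M.nextCorner.SameCycle p q := by
  have hp := M.edge_mem_faces p
  have hq := M.edge_mem_faces q
  rw [← h] at hq
  have hpn := (M.corner_ne p.1 p.2).symm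
  have hqn := (M.corner_ne q.1 q.2).symm
  rw [← h] at hqn
  -- A path in the link is followed edge by edge, each edge being a triangle at v. At a boundary
  -- vertex the glued-in face closes the fan of triangles to a cycle.
  have hlink := S.link_connected _ _ _ hpn hqn hp hq
  generalize hv : M.corner p.1 p.2 = v at *
  generalize hb : M.corner q.1 (q.2 + 1) = b at *
  clear hpn hp hq hqn
  induction hlink generalizing q with
  | refl =>
    have := M.corner_unique p.1 q.1 p.2 q.2 (hv.trans h) hb.symm
    have hpq : p = q := this
    rw [hpq]
  | @tail c d h1 h2 ih =>
    have hcv : c ≠ v := by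
      rintro rfl
      have := h2.2
      have h3 := Finset.card_insert_le c ({d} : Finset V)
      simp only [Finset.insert_idem, Finset.card_singleton] at this h3
      omega
    have hvc : ({v, c} : Finset V) ∈ S.faces := by
      refine (S.isRelLowerSet_faces h2.1).2 ?_ ?_
      · intro x hx
        simp only [Finset.mem_insert, Finset.mem_singleton] at hx ⊢
        tauto
      · exact Finset.insert_nonempty _ _
    obtain ⟨r, hr1, hr2⟩ := M.exists_position hcv hvc
    exact (ih hr1.symm hr2).trans (M.sameCycle_of_triangle h2.1 h2.2 hr1 hr2 h.symm hb)

/-- A cyclic enumeration of the corners at a vertex. -/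
lemma exists_cyclic_list [Finite V] (v : V) :
    ∃ (p : (S.Triangle ⊕ Fin B) × Fin 3) (l : List ((S.Triangle ⊕ Fin B) × Fin 3)),
      (p :: l).Nodup ∧ (∀ q, q ∈ p :: l ↔ M.corner q.1 q.2 = v) ∧
        List.IsChain (fun a b => M.nextCorner a = b) (p :: (l ++ [p])) := by
  obtain ⟨τ, hτ⟩ := S.exists_triangle {v} (S.singleton_mem v)
  obtain ⟨k, hk⟩ := M.exists_corner τ (hτ (Finset.mem_singleton_self v))
  -- The set of positions is finite, so every orbit of the permutation is periodic and its periodic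
  -- orbit is the required cyclic list.
  have hper : ((.inl τ, k) : (S.Triangle ⊕ Fin B) × Fin 3) ∈
      Function.periodicPts M.nextCorner := M.nextCorner.injective.mem_periodicPts _
  obtain ⟨l, hl'⟩ : ∃ l : List ((S.Triangle ⊕ Fin B) × Fin 3),
    (l : Cycle ((S.Triangle ⊕ Fin B) × Fin 3)) =
      Function.periodicOrbit M.nextCorner (.inl τ, k) := ⟨_, rfl⟩
  have hnodup : (l : Cycle ((S.Triangle ⊕ Fin B) × Fin 3)).Nodup := by
    rw [hl']
    exact Function.nodup_periodicOrbit
  have hmem : ∀ q, q ∈ l ↔ M.corner q.1 q.2 = v := by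
    intro q
    rw [← Cycle.mem_coe_iff, hl', Function.mem_periodicOrbit_iff hper]
    constructor
    · rintro ⟨n, rfl⟩
      induction n with
      | zero => exact hk
      | succ n ih => rw [Function.iterate_succ_apply', corner_nextCorner, ih]
    · intro hq
      obtain ⟨n, hn⟩ := (M.sameCycle_nextCorner (p := (.inl τ, k)) (q := q)
        (hk.trans hq.symm)).exists_nat_pow_eq
      exact ⟨n, by rw [← hn, Equiv.Perm.iterate_eq_pow]⟩
  have hchain : (l : Cycle ((S.Triangle ⊕ Fin B) × Fin 3)).Chain (fun a b => M.nextCorner a = b) := by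
    rw [hl', Function.periodicOrbit_chain']
    · intro n
      exact (Function.iterate_succ_apply' _ _ _).symm
    · exact hper
  cases l with
  | nil => exact absurd ((hmem (.inl τ, k)).2 hk) (by simp)
  | cons p l => exact ⟨p, l, Cycle.nodup_coe_iff.1 hnodup, hmem, (Cycle.chain_coe_cons _ _ _).1 hchain⟩

end CombinatorialSurface.Marking

/-! ### The total sign around a vertex -/

namespace CombinatorialSurface.Marking

variable {V : Type w} [DecidableEq V] {B : ℕ} {S : CombinatorialSurface V B} (M : S.Marking)

variable (S) in
/-- The twist of a face. -/
def faceSign (δ : Fin B → BoundaryType) : S.Triangle ⊕ Fin B → ℤˣ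
  | .inl _ => 1
  | .inr i => projectorSign (δ i)

variable (S) in
/-- The twist of a corner. -/
def cornerTwist (δ : Fin B → BoundaryType) (p : (S.Triangle ⊕ Fin B) × Fin 3) : ℤˣ :=
  if p.2 = 0 then faceSign S δ p.1 else -1

/-- The sign of the copairing whose second factor belongs to the edge which starts at a corner. -/
def cornerSign (s : S.Edge → ℤˣ) (p : (S.Triangle ⊕ Fin B) × Fin 3) : ℤˣ :=
  if M.side p.1 p.2 = 0 then -s (M.edgeAt p.1 p.2) else s (M.edgeAt p.1 p.2)

variable (S) in
/-- The number of boundary components of type `NS` which start at a vertex. -/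
def numBoundaryStart (δ : Fin B → BoundaryType) (v : V) : ℕ :=
  {i : Fin B | S.param i 0 = v ∧ δ i = .NS}.ncard

lemma faceSign_eq_or (δ : Fin B → BoundaryType) (x : S.Triangle ⊕ Fin B) :
    faceSign S δ x = 1 ∨ faceSign S δ x = -1 := Int.units_eq_one_or _

/-- Of the two sides of an edge at v only one starts at v, so corners at v correspond to edges
containing v. This converts products over corners into products over edges. -/
lemma edgeAt_injOn {v : V} {p q : (S.Triangle ⊕ Fin B) × Fin 3} (hp : M.corner p.1 p.2 = v)
    (hq : M.corner q.1 q.2 = v) (h : M.edgeAt p.1 p.2 = M.edgeAt q.1 q.2) : p = q := by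
  apply M.sideEquiv.injective
  rw [sideEquiv_apply, sideEquiv_apply, h]
  congr 1
  unfold side
  rw [h, hp, hq]

lemma mem_edge_iff (v : V) (e : S.Edge) :
    v ∈ e.1 ↔ ∃ p : (S.Triangle ⊕ Fin B) × Fin 3, M.corner p.1 p.2 = v ∧ M.edgeAt p.1 p.2 = e := by
  constructor
  · intro h
    obtain ⟨p, hp⟩ := M.sideEquiv.surjective (e, 0)
    have hpe : M.edgeAt p.1 p.2 = e := congrArg Prod.fst hp
    have hv : v ∈ ({M.corner p.1 p.2, M.corner p.1 (p.2 + 1)} : Finset V) := by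
      rw [← hpe] at h
      exact h
    simp only [Finset.mem_insert, Finset.mem_singleton] at hv
    rcases hv with hv | hv
    · exact ⟨p, hv.symm, hpe⟩
    · refine ⟨M.opposite p, by rw [corner_opposite, hv], ?_⟩
      rw [← hpe]
      exact congrArg Prod.fst (M.sideEquiv_opposite p)
  · rintro ⟨p, rfl, rfl⟩
    exact Finset.mem_insert_self _ _

/-- Counts the exceptional corners, those with twist 1. Type R components have twist -1 at all three
corners and do not contribute, while type NS raises the count exactly at the image of the vertex 0.
-/
lemma corner_zero_iff (δ : Fin B → BoundaryType) [Finite V] (v : V) :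
    {x : S.Triangle ⊕ Fin B | M.corner x 0 = v ∧ faceSign S δ x = 1}.ncard =
      M.numStart v + numBoundaryStart S δ v := by
  have h : {x : S.Triangle ⊕ Fin B | M.corner x 0 = v ∧ faceSign S δ x = 1} =
      Sum.inl '' {σ : S.Triangle | M.start σ = v} ∪
        Sum.inr '' {i : Fin B | S.param i 0 = v ∧ δ i = .NS} := by
    ext x
    rcases x with σ | i
    · simp [faceSign, corner]
    · have h2 : projectorSign (δ i) = 1 ↔ δ i = .NS := by
        cases δ i with
        | NS => simp [projectorSign]
        | R => simp [projectorSign]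
      simp [faceSign, corner, h2]
  rw [h, Set.ncard_union_eq, Set.ncard_image_of_injective _ Sum.inl_injective,
    Set.ncard_image_of_injective _ Sum.inr_injective, numStart, numBoundaryStart]
  rw [Set.disjoint_left]
  rintro _ ⟨σ, -, rfl⟩ ⟨i, -, h⟩
  exact absurd h (by simp)

/-- The product of the signs of the corners at a vertex. -/
lemma prod_corners [Finite V] (s : S.Edge → ℤˣ) (δ : Fin B → BoundaryType) (v : V)
    (l : List ((S.Triangle ⊕ Fin B) × Fin 3)) (hl : l.Nodup)
    (hmem : ∀ q, q ∈ l ↔ M.corner q.1 q.2 = v) :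
    (l.map fun p => cornerTwist S δ p * -M.cornerSign s p).prod =
      signProd S s v * (-1) ^ (M.numStart v + numBoundaryStart S δ v + M.numOut v) := by
  classical
  have hm : ∀ q, q ∈ l.toFinset ↔ M.corner q.1 q.2 = v := by simpa using hmem
  rw [← List.prod_toFinset _ hl]
  -- At a generic corner the twist -1 cancels the explicit minus sign. A sign remains for an
  -- exceptional corner, counted by D, and another if the corner is on the left of its edge, that is
  -- if the edge points away from v, counted by K.
  have h1 : ∀ p, cornerTwist S δ p * -M.cornerSign s p = s (M.edgeAt p.1 p.2) *
      ((if p.2 = 0 ∧ faceSign S δ p.1 = 1 then -1 else 1) *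
        (if M.side p.1 p.2 = 0 then -1 else 1)) := by
    intro p
    unfold cornerTwist cornerSign
    generalize M.side p.1 p.2 = j
    generalize s (M.edgeAt p.1 p.2) = a
    rcases faceSign_eq_or δ p.1 with h | h <;> by_cases h2 : p.2 = 0 <;>
      by_cases h3 : j = 0 <;> simp [h, h2, h3]
  rw [Finset.prod_congr rfl fun p _ => h1 p, Finset.prod_mul_distrib, Finset.prod_mul_distrib]
  have h2 : ∏ p ∈ l.toFinset, s (M.edgeAt p.1 p.2) = signProd S s v := by
    have h : {e : S.Edge | v ∈ e.1} = ↑(l.toFinset.image fun p => M.edgeAt p.1 p.2) := by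
      ext e
      simp only [Set.mem_ofPred_eq, Finset.coe_image, Set.mem_image, Finset.mem_coe, hm]
      exact M.mem_edge_iff v e
    rw [signProd, h, finprod_mem_coe_finset, Finset.prod_image]
    intro p hp q hq hpq
    exact M.edgeAt_injOn ((hm p).1 hp) ((hm q).1 hq) hpq
  have h3 : ∏ p ∈ l.toFinset, (if M.side p.1 p.2 = 0 then (-1 : ℤˣ) else 1) =
      (-1) ^ M.numOut v := by
    have h : {e : S.Edge | M.source e = v} =
        ↑((l.toFinset.filter fun p => M.side p.1 p.2 = 0).image fun p => M.edgeAt p.1 p.2) := by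
      ext e
      simp only [Set.mem_ofPred_eq, Finset.coe_image, Set.mem_image, Finset.mem_coe,
        Finset.mem_filter, hm, side_eq_zero_iff]
      constructor
      · intro he
        obtain ⟨p, hp, rfl⟩ := (M.mem_edge_iff v e).1 (he ▸ M.source_mem e)
        exact ⟨p, ⟨hp, he.trans hp.symm⟩, rfl⟩
      · rintro ⟨p, ⟨hp, hs⟩, rfl⟩
        exact hs.trans hp
    rw [Finset.prod_ite, Finset.prod_const, Finset.prod_const_one, mul_one, numOut, h,
      Set.ncard_coe_finset, Finset.card_image_of_injOn]
    intro p hp q hq hpq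
    simp only [Finset.coe_filter, Set.mem_ofPred_eq, hm] at hp hq
    exact M.edgeAt_injOn hp.1 hq.1 hpq
  have h4 : ∏ p ∈ l.toFinset, (if p.2 = 0 ∧ faceSign S δ p.1 = 1 then (-1 : ℤˣ) else 1) =
      (-1) ^ (M.numStart v + numBoundaryStart S δ v) := by
    have h : {x : S.Triangle ⊕ Fin B | M.corner x 0 = v ∧ faceSign S δ x = 1} =
        ↑((l.toFinset.filter fun p => p.2 = 0 ∧ faceSign S δ p.1 = 1).image Prod.fst) := by
      ext x
      simp only [Set.mem_ofPred_eq, Finset.coe_image, Set.mem_image, Finset.mem_coe,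
        Finset.mem_filter, hm]
      constructor
      · rintro ⟨h5, h6⟩
        exact ⟨(x, 0), ⟨h5, rfl, h6⟩, rfl⟩
      · rintro ⟨⟨y, k⟩, ⟨h5, h6, h7⟩, rfl⟩
        obtain rfl : k = 0 := h6
        exact ⟨h5, h7⟩
    rw [Finset.prod_ite, Finset.prod_const, Finset.prod_const_one, mul_one, ← corner_zero_iff, h,
      Set.ncard_coe_finset, Finset.card_image_of_injOn]
    rintro ⟨x, k⟩ hp ⟨y, k'⟩ hq hpq
    simp only [Finset.coe_filter, Set.mem_ofPred_eq] at hp hq hpq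
    rw [hp.2.1, hq.2.1, hpq]
  rw [h2, h3, h4, ← pow_add]

lemma numBoundaryStart_of_inner (δ : Fin B → BoundaryType) {v : V}
    (hv : ∀ i k, S.param i k ≠ v) : numBoundaryStart S δ v = 0 := by
  rw [numBoundaryStart, Set.ncard_eq_zero]
  ext i
  simp [hv i 0]

open Classical in
lemma numBoundaryStart_param (δ : Fin B → BoundaryType) (i : Fin B) (k : Fin 3) :
    numBoundaryStart S δ (S.param i k) = if k = 0 ∧ δ i = .NS then 1 else 0 := by
  have h : ∀ j, S.param j 0 = S.param i k ↔ j = i ∧ k = 0 := by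
    intro j
    constructor
    · intro h
      have := S.param_injective (a₁ := (j, 0)) (a₂ := (i, k)) h
      simp only [Prod.mk.injEq] at this
      exact ⟨this.1, this.2.symm⟩
    · rintro ⟨rfl, rfl⟩
      rfl
  rw [numBoundaryStart]
  split_ifs with hk
  · rw [Set.ncard_eq_one]
    refine ⟨i, ?_⟩
    ext j
    simp only [Set.mem_ofPred_eq, h, Set.mem_singleton_iff]
    constructor
    · exact fun h => h.1.1
    · rintro rfl
      exact ⟨⟨rfl, hk.1⟩, hk.2⟩
  · rw [Set.ncard_eq_zero]
    ext j
    simp only [Set.mem_ofPred_eq, h, Set.mem_empty_iff_false, iff_false]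
    rintro ⟨⟨rfl, h0⟩, h1⟩
    exact hk ⟨h0, h1⟩

/-- If the signs are not admissible, the product of the signs of the corners is trivial at some
vertex. -/
lemma exists_vertex_of_not_admissible (s : S.Edge → ℤˣ) (δ : Fin B → BoundaryType)
    (h : ¬ M.AdmissibleOfType s δ) : ∃ v : V,
      signProd S s v * (-1) ^ (M.numStart v + numBoundaryStart S δ v + M.numOut v) = 1 := by
  -- There are only two signs, so one that violates the rule is the opposite of the prescribed
  -- value.
  have aux : ∀ (a : ℤˣ) (n : ℕ), a ≠ (-1) ^ (n + 1) → a * (-1) ^ n = 1 := by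
    intro a n hn
    rcases Int.units_eq_one_or a with rfl | rfl <;>
      rcases neg_one_pow_eq_or ℤˣ n with h | h <;> rw [pow_succ, h] at hn <;> rw [h] <;> simp_all
  rw [AdmissibleOfType, not_and_or] at h
  rcases h with h | h
  · push Not at h
    obtain ⟨v, hv, h⟩ := h
    refine ⟨v, aux _ _ ?_⟩
    rw [numBoundaryStart_of_inner δ hv]
    exact h
  · push Not at h
    obtain ⟨i, k, h⟩ := h
    refine ⟨S.param i k, aux _ _ ?_⟩
    rw [numBoundaryStart_param]
    cases hd : δ i with
    | NS =>
      rw [hd] at h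
      simpa [BoundaryRule] using h
    | R =>
      rw [hd] at h
      simpa [BoundaryRule] using h

end CombinatorialSurface.Marking

/-! ### Vanishing of the contraction at a violating vertex -/

namespace CombinatorialSurface.Marking

set_option linter.unusedSectionVars false

open TensorFamily LabelledForm

variable {V : Type w} [DecidableEq V] {B : ℕ} {S : CombinatorialSurface V B} (M : S.Marking)
  {C : Type u} [Category.{v} C] [MonoidalCategory C] [SymmetricCategory C]
  (A : C) [MonObj A] [ComonObj A]

variable (S) in
/-- The labels of the tensor factors: the edge positions of the faces, and the arguments of the
boundary components. -/
abbrev Leg : Type w := ((S.Triangle ⊕ Fin B) × Fin 3) ⊕ Fin B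

variable (S) in
/-- The functional of a triangle or of a boundary component. -/
def faceOf (δ : Fin B → BoundaryType) : S.Triangle ⊕ Fin B → LabelledForm A (Leg S)
  | .inl σ => triangleFace A fun k => .inl (.inl σ, k)
  | .inr i => boundaryFace (stateProjector A (δ i)) (.inr i) fun k => .inl (.inr i, k)

/-- The data of the corner of a face. -/
def cornerAt (δ : Fin B → BoundaryType) (s : S.Edge → ℤˣ) :
    (S.Triangle ⊕ Fin B) × Fin 3 → Corner A (Leg S)
  | (.inl σ, k) => faceCorner (Fin.elim0 : Fin 0 → Leg S) η[A] 1 (fun k => .inl (.inl σ, k))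
      (M.cornerSign s (.inl σ, k)) k
  | (.inr i, k) => faceCorner (singleWord (.inr i)) ((ρ_ A).hom ≫ stateProjector A (δ i))
      (projectorSign (δ i)) (fun k => .inl (.inr i, k)) (M.cornerSign s (.inr i, k)) k

variable (δ : Fin B → BoundaryType) (s : S.Edge → ℤˣ)

lemma cornerAt_out (p : (S.Triangle ⊕ Fin B) × Fin 3) : (M.cornerAt A δ s p).out = .inl p := by
  rcases p with ⟨σ | i, k⟩ <;> rfl

lemma cornerAt_inn (p : (S.Triangle ⊕ Fin B) × Fin 3) :
    (M.cornerAt A δ s p).inn = .inl (p.1, p.2 + 2) := by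
  rcases p with ⟨σ | i, k⟩ <;> rfl

lemma cornerAt_sign (p : (S.Triangle ⊕ Fin B) × Fin 3) :
    (M.cornerAt A δ s p).sign = M.cornerSign s p := by
  rcases p with ⟨σ | i, k⟩ <;> rfl

lemma cornerAt_twist (p : (S.Triangle ⊕ Fin B) × Fin 3) :
    (M.cornerAt A δ s p).twist = cornerTwist S δ p := by
  rcases p with ⟨σ | i, k⟩ <;> rfl

lemma chainSign_map_cornerAt (l : List ((S.Triangle ⊕ Fin B) × Fin 3)) :
    chainSign (l.map (M.cornerAt A δ s)) =
      (l.map fun p => cornerTwist S δ p * -M.cornerSign s p).prod := by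
  induction l with
  | nil => rfl
  | cons p l ih =>
    rw [List.map_cons, chainSign, ih, cornerAt_sign, cornerAt_twist, List.map_cons, List.prod_cons]

section Contractions

variable {Z Y : C}

/-- Contract the two factors which belong to an edge. -/
def contractEdge (e : S.Edge) (F : TensorFamily A (Leg S) Z Y) : TensorFamily A (Leg S) Z Y :=
  contract (frobCopairing A (s e)) (.inl (M.sideEquiv.symm (e, 0)))
    (.inl (M.sideEquiv.symm (e, 1))) F

/-- Contract the factors which belong to the edges in a list. -/
def contractEdges : List S.Edge → TensorFamily A (Leg S) Z Y → TensorFamily A (Leg S) Z Y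
  | [], F => F
  | e :: l, F => contractEdges l (M.contractEdge A s e F)

variable {A} {F : TensorFamily A (Leg S) Z Y}

lemma contractEdges_append (l l' : List S.Edge) (F : TensorFamily A (Leg S) Z Y) :
    M.contractEdges A s (l ++ l') F = M.contractEdges A s l' (M.contractEdges A s l F) := by
  induction l generalizing F with
  | nil => rfl
  | cons e l ih => exact ih _

lemma isSymm_contractEdge (hF : F.IsSymm) (e : S.Edge) : (M.contractEdge A s e F).IsSymm :=
  hF.contract _ _ _

lemma contractEdges_perm {l l' : List S.Edge} (h : l.Perm l') (hF : F.IsSymm) :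
    M.contractEdges A s l F = M.contractEdges A s l' F := by
  induction h generalizing F with
  | nil => rfl
  | cons e _ ih => exact ih (M.isSymm_contractEdge s hF e)
  | swap e e' l =>
    exact congrArg (M.contractEdges A s l) (hF.contract_contract _ _ _ _ _ _)
  | trans _ _ ih ih' => exact (ih hF).trans (ih' hF)

lemma contractEdges_zero [Preadditive C] (l : List S.Edge) :
    M.contractEdges A s l (fun _ _ => 0 : TensorFamily A (Leg S) Z Y) = fun _ _ => 0 := by
  induction l with
  | nil => rfl
  | cons e l ih =>
    rw [contractEdges]
    have h : M.contractEdge A s e (fun _ _ => 0 : TensorFamily A (Leg S) Z Y) = fun _ _ => 0 := by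
      funext n w
      exact Limits.comp_zero
    rw [h, ih]

lemma contractPairs_eq_contractEdges (n : ℕ) (f : Fin n → S.Edge)
    (F : TensorFamily A (Leg S) Z Y) :
    contractPairs n (fun m => frobCopairing A (s (f m)))
      (fun m j => .inl (M.sideEquiv.symm (f m, j))) F = M.contractEdges A s (List.ofFn f) F := by
  induction n generalizing F with
  | zero => rfl
  | succ n ih =>
    rw [List.ofFn_succ, contractEdges, ← ih]
    rfl

variable [IsFrobeniusObj A]

/-- The chain always puts the second leg of the copairing at q, while c_{s(e)} has its second leg on
the right of e. If q lies on the left the legs are exchanged, and the sign in `cornerSign`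
compensates. -/
lemma contract_corner (hF : F.IsSymm) {p q : (S.Triangle ⊕ Fin B) × Fin 3}
    (h : M.nextCorner p = q) :
    contract (frobCopairing A (M.cornerSign s q)) (.inl (p.1, p.2 + 2)) (.inl q) F =
      M.contractEdge A s (M.edgeAt q.1 q.2) F := by
  have h1 : (p.1, p.2 + 2) = M.opposite q := by
    rw [← h, nextCorner_apply, opposite_opposite]
  have h2 := M.sideEquiv_apply q
  have h3 := M.sideEquiv_opposite q
  rw [h1, contractEdge, cornerSign]
  by_cases h4 : M.side q.1 q.2 = 0
  · rw [h4, ← Equiv.eq_symm_apply] at h2 h3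
    rw [if_pos h4, hF.contract_comm, frobCopairing_braiding, neg_neg, h3, Equiv.swap_apply_left,
      ← h2]
  · have h5 : M.side q.1 q.2 = 1 := by
      revert h4
      generalize M.side q.1 q.2 = j
      fin_cases j <;> simp
    rw [h5, ← Equiv.eq_symm_apply] at h2 h3
    rw [if_neg h4, h3, Equiv.swap_apply_right, ← h2]

lemma contract_contractChain_eq (l : List ((S.Triangle ⊕ Fin B) × Fin 3))
    {p q : (S.Triangle ⊕ Fin B) × Fin 3}
    (h : List.IsChain (fun a b => M.nextCorner a = b) (p :: (l ++ [q]))) (hF : F.IsSymm) :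
    contract (frobCopairing A (M.cornerSign s q))
      (lastInn (.inl (p.1, p.2 + 2)) (l.map (M.cornerAt A δ s))) (.inl q)
      (contractChain (.inl (p.1, p.2 + 2)) (l.map (M.cornerAt A δ s)) F) =
    M.contractEdges A s ((l ++ [q]).map fun r => M.edgeAt r.1 r.2) F := by
  induction l generalizing p F with
  | nil =>
    rw [List.nil_append, List.isChain_cons_cons] at h
    exact M.contract_corner s hF h.1
  | cons r l ih =>
    rw [List.cons_append, List.isChain_cons_cons] at h
    rw [List.map_cons, lastInn, contractChain, cornerAt_inn, cornerAt_out, cornerAt_sign,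
      ih h.2 (hF.contract _ _ _), M.contract_corner s hF h.1]
    rfl

end Contractions

variable {A} [IsFrobeniusObj A]

lemma cornerAt_form (hN : nakayama A ≫ nakayama A = 𝟙 A) (p : (S.Triangle ⊕ Fin B) × Fin 3) :
    (M.cornerAt A δ s p).form = faceOf S A δ p.1 := by
  rcases p with ⟨σ | i, k⟩
  · exact (labelledFace_eq_form hN _ _ _ isTwisted_one _ _ _).symm
  · exact (labelledFace_eq_form hN _ _ _ ((isTwisted_stateProjector hN (δ i)).precomp _) _ _ _).symm

/-- If the signs of the corners at some vertex have the product `1`, the contraction of the edges which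
contain this vertex vanishes. -/
lemma contractEdges_eq_zero [Preadditive C] [MonoidalPreadditive C] [Finite V]
    [Fintype S.Triangle] (hN : nakayama A ≫ nakayama A = 𝟙 A)
    (hconv : frobConv A (nakayama A) (𝟙 A) = 0) (v : V)
    (hv : signProd S s v * (-1) ^ (M.numStart v + numBoundaryStart S δ v + M.numOut v) = 1)
    (hnodup : (∏ x, faceOf S A δ x).labels.Nodup) (E : List S.Edge) (hE : ∀ e, e ∈ E) :
    M.contractEdges A s E (toFamily (∏ x, faceOf S A δ x)) = fun _ _ => 0 := by
  classical
  obtain ⟨p, l, hl, hmem, hchain⟩ := M.exists_cyclic_list v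
  -- A face has at most one corner at v, so the corners in the cycle belong to distinct faces and
  -- their functionals split off from the total product.
  have hinj : ∀ q ∈ p :: l, ∀ q' ∈ p :: l, q.1 = q'.1 → q = q' := by
    rintro ⟨x, k⟩ hq ⟨y, k'⟩ hq' h
    obtain rfl : x = y := h
    have h1 := ((hmem _).1 hq).trans ((hmem _).1 hq').symm
    rcases x with σ | i
    · exact congrArg (Prod.mk _) (M.corner_injective σ h1)
    · exact congrArg (fun r : Fin B × Fin 3 => ((.inr r.1, r.2) : (S.Triangle ⊕ Fin B) × Fin 3))
        (S.param_injective (a₁ := (i, k)) (a₂ := (i, k')) h1)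
  have hfst : ((p :: l).map Prod.fst).Nodup := List.Nodup.map_on hinj hl
  have hprod : ∃ q : LabelledForm A (Leg S), ∏ x, faceOf S A δ x =
      q * (((p :: l).map (M.cornerAt A δ s)).map Corner.form).prod := by
    refine ⟨∏ x ∈ ((p :: l).map Prod.fst).toFinsetᶜ, faceOf S A δ x, ?_⟩
    rw [← Finset.prod_compl_mul_prod ((p :: l).map Prod.fst).toFinset, List.prod_toFinset _ hfst,
      List.map_map, List.map_map]
    congr 3
    funext r
    exact (M.cornerAt_form δ s hN r).symm
  obtain ⟨q, hq⟩ := hprod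
  have hsign : chainSign ((p :: l).map (M.cornerAt A δ s)) = 1 := by
    rw [chainSign_map_cornerAt, M.prod_corners s δ v _ hl hmem, hv]
  -- The list is rotated because the chain starts inside the face of p and crosses the edge of p
  -- last, when it closes up.
  have hsub : ((l ++ [p]).map fun r => M.edgeAt r.1 r.2).Subperm E := by
    refine List.subperm_of_subset ?_ fun e _ => hE e
    have hperm : (l ++ [p]).Perm (p :: l) := List.perm_append_singleton p l
    refine List.Nodup.map_on ?_ (hperm.nodup_iff.2 hl)
    intro r hr r' hr' h
    exact M.edgeAt_injOn ((hmem r).1 (hperm.mem_iff.1 hr)) ((hmem r').1 (hperm.mem_iff.1 hr')) h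
  obtain ⟨E', hE', hsub'⟩ := hsub
  obtain ⟨R, hR⟩ := hsub'.exists_perm_append
  have hsymm := isSymm_toFamily (∏ x, faceOf S A δ x)
  -- Contractions commute, so the edges at v may be contracted before all the others.
  rw [M.contractEdges_perm s (hR.trans (hE'.append_right R)) hsymm, contractEdges_append]
  have h0 : M.contractEdges A s ((l ++ [p]).map fun r => M.edgeAt r.1 r.2)
      (toFamily (∏ x, faceOf S A δ x)) = fun _ _ => 0 := by
    rw [← M.contract_contractChain_eq δ s l hchain hsymm]
    have h := contract_contractChain_eq_zero hN hconv (M.cornerAt A δ s p)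
      (l.map (M.cornerAt A δ s)) q (by rw [← List.map_cons, ← hq]; exact hnodup) hsign
    rw [cornerAt_inn, cornerAt_out, cornerAt_sign, ← List.map_cons, ← hq] at h
    exact h
  rw [h0, contractEdges_zero]

/-- Labelling each leg by its edge position makes the permutation of the state sum tautological: the
two legs of an edge carry the labels of its two sides. -/
lemma tripleBlocks_comp_legPerm {nE nT : ℕ} (enumE : Fin nE ≃ S.Edge) (enumT : Fin nT ≃ S.Triangle) :
    catWord (tripleBlocks nT fun i k => (.inl (.inl (enumT i), k) : Leg S))
      (tripleBlocks B fun i k => .inl (.inr i, k)) ∘ M.legPerm enumE enumT =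
    pairBlocks nE fun m j => .inl (M.sideEquiv.symm (enumE m, j)) := by
  funext r
  obtain ⟨⟨m, j⟩, rfl⟩ := (blockEquiv nE 2).surjective r
  rw [pairBlocks_blockEquiv, Function.comp_apply]
  obtain ⟨⟨x, k⟩, hx⟩ : ∃ p, p = M.sideEquiv.symm (enumE m, j) := ⟨_, rfl⟩
  rw [← hx]
  rcases x with σ | i
  · have h : M.legPerm enumE enumT (blockEquiv nE 2 (m, j)) =
        Fin.cast (Nat.add_comm (3 * nT) (3 * B))
          (finSumFinEquiv (Sum.inl (blockEquiv nT 3 (enumT.symm σ, k)))) := by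
      simp [legPerm, ← hx]
    rw [h, catWord_left _ _ _ (blockEquiv nT 3 (enumT.symm σ, k)) rfl, tripleBlocks_blockEquiv,
      Equiv.apply_symm_apply]
  · have h : M.legPerm enumE enumT (blockEquiv nE 2 (m, j)) =
        Fin.cast (Nat.add_comm (3 * nT) (3 * B))
          (finSumFinEquiv (Sum.inr (blockEquiv B 3 (i, k)))) := by
      simp [legPerm, ← hx]
    rw [h, catWord_right _ _ _ (blockEquiv B 3 (i, k)) rfl, tripleBlocks_blockEquiv]

/-- Each side of each edge occurs exactly once. This is what allows the product of faces to be read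
as a single functional through `toFamily`. -/
lemma nodup_legs {nE : ℕ} (enumE : Fin nE ≃ S.Edge) :
    (letters (catWord (pairBlocks nE fun m j => (.inl (M.sideEquiv.symm (enumE m, j)) : Leg S))
      fun i : Fin B => .inr i)).Nodup := by
  rw [letters_catWord, Multiset.nodup_add]
  have hp : ∀ r, ∃ m j, (pairBlocks nE fun m j => (.inl (M.sideEquiv.symm (enumE m, j)) : Leg S)) r =
      .inl (M.sideEquiv.symm (enumE m, j)) ∧ blockEquiv nE 2 (m, j) = r := by
    intro r
    obtain ⟨⟨m, j⟩, rfl⟩ := (blockEquiv nE 2).surjective r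
    exact ⟨m, j, pairBlocks_blockEquiv _ _ _ _, rfl⟩
  refine ⟨Multiset.Nodup.map ?_ Finset.univ.nodup, Multiset.Nodup.map Sum.inr_injective
    Finset.univ.nodup, ?_⟩
  · intro r r' h
    obtain ⟨m, j, h1, h2⟩ := hp r
    obtain ⟨m', j', h1', h2'⟩ := hp r'
    rw [h1, h1'] at h
    have h3 := M.sideEquiv.symm.injective (Sum.inl_injective h)
    rw [Prod.mk.injEq] at h3
    rw [← h2, ← h2', enumE.injective h3.1, h3.2]
  · rw [Multiset.disjoint_left]
    intro a ha ha'
    obtain ⟨r, -, rfl⟩ := Multiset.mem_map.1 ha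
    obtain ⟨i, -, h⟩ := Multiset.mem_map.1 ha'
    obtain ⟨m, j, h1, -⟩ := hp r
    rw [h1] at h
    exact absurd h (by simp)

/-- The state sum vanishes on the boundary states of type `δ` if the signs are not admissible of type
`δ`. -/
lemma boundaryInsertion_stateSum_eq_zero [Preadditive C] [MonoidalPreadditive C] [Finite V]
    (hN : nakayama A ≫ nakayama A = 𝟙 A) (hconv : frobConv A (nakayama A) (𝟙 A) = 0)
    {nE nT : ℕ} (enumE : Fin nE ≃ S.Edge) (enumT : Fin nT ≃ S.Triangle)
    (h : ¬ M.AdmissibleOfType s δ) :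
    boundaryInsertion A δ ≫ M.stateSum A s enumE enumT = 0 := by
  let _ : Fintype S.Triangle := Fintype.ofEquiv _ enumT
  obtain ⟨v, hv⟩ := M.exists_vertex_of_not_admissible s δ h
  have hfaces : (∏ i, triangleFace A fun k => (.inl (.inl (enumT i), k) : Leg S)) *
      ∏ i, boundaryFace (stateProjector A (δ i)) (.inr i : Leg S) (fun k => .inl (.inr i, k)) =
        ∏ x, faceOf S A δ x := by
    rw [Fintype.prod_sum_type, ← Equiv.prod_comp enumT]
    rfl
  have h1 := ofIso_faces (A := A) (M.legPerm enumE enumT) (fun i => stateProjector A (δ i))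
    (fun i : Fin B => (.inr i : Leg S)) _ _ _ (M.tripleBlocks_comp_legPerm enumE enumT)
  have h2 := contractPairs_toFamily_faces (A := A) (M.legPerm enumE enumT)
    (fun m => frobCopairing A (s (enumE m))) (fun i => stateProjector A (δ i))
    (fun i : Fin B => (.inr i : Leg S)) _ _ _ (M.tripleBlocks_comp_legPerm enumE enumT)
    (M.nodup_legs enumE)
  rw [hfaces] at h1 h2
  have hnodup : (∏ x, faceOf S A δ x).labels.Nodup := by
    rw [← h1]
    exact M.nodup_legs enumE
  rw [contractPairs_eq_contractEdges, M.contractEdges_eq_zero δ s hN hconv v hv hnodup _ (fun e => by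
    rw [List.mem_ofFn]
    exact enumE.surjective e)] at h2
  -- The families have the unit as parameter object, so `h2` gives the composite up to a left
  -- unitor.
  rw [← cancel_epi (λ_ (tensorPow A B)).hom, Limits.comp_zero]
  exact h2.symm

end CombinatorialSurface.Marking

end

theorem mainTheorem8
    {C : Type u} [Category.{v} C] [Preadditive C] [MonoidalCategory C] [MonoidalPreadditive C]
    [SymmetricCategory C]
    (A : C) [MonObj A] [ComonObj A] [IsFrobeniusObj A]
    (hsep : Δ[A] ≫ μ[A] = 𝟙 A)
    (hN : nakayama A ≫ nakayama A = 𝟙 A)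
    (hconv : frobConv A (nakayama A) (𝟙 A) = 0)
    {V : Type w} [DecidableEq V] [Finite V] {B : ℕ}
    (S : CombinatorialSurface V B) (M : S.Marking) (s : S.Edge → ℤˣ)
    {nE nT : ℕ} (enumE : Fin nE ≃ S.Edge) (enumT : Fin nT ≃ S.Triangle) :
    (¬ M.Admissible s → ∀ δ : Fin B → BoundaryType,
      boundaryInsertion A δ ≫ M.stateSum A s enumE enumT = 0) ∧
    (∀ δ : Fin B → BoundaryType, ¬ M.AdmissibleOfType s δ →
      boundaryInsertion A δ ≫ M.stateSum A s enumE enumT = 0) := by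
  have h : ∀ δ : Fin B → BoundaryType, ¬ M.AdmissibleOfType s δ →
      boundaryInsertion A δ ≫ M.stateSum A s enumE enumT = 0 := fun δ hδ =>
    M.boundaryInsertion_stateSum_eq_zero δ s hN hconv enumE enumT hδ
  -- Signs that are not admissible are not admissible of any type, so the first claim is an instance
  -- of the second.
  exact ⟨fun hs δ => h δ fun hδ => hs ((M.admissible_iff s).2 ⟨δ, hδ⟩), h⟩
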